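/- Let $\mathbb D=\{z\in\mathbb C:|z|<1\}$, let $dA=\frac{dx\,dy}{\pi}$, and let $\mathcal H(\mathbb D)$ be the space of analytic functions in $\mathbb D$. Let $\omega:\mathbb D\to[0,\infty)$ be a radial weight, that is, $\omega$ is integrable over $\mathbb D$ and $\omega(z)=\omega(|z|)$ for all $z\in\mathbb D$. Assume that $\omega\in\widehat{\mathcal D}$, that is, $\widehat\omega(r)=\int_r^1\omega(t)\,dt>0$ for all $0\le r<1$, and there exists a constant $C\ge1$ such that $\widehat\omega(r)\le C\,\widehat\omega\left(\frac{1+r}{2}\right)$ for all $0\le r<1$. For $0<p<\infty$ the weighted Bergman space $A^p_\omega$ consists of those $g\in\mathcal H(\mathbb D)$ with $\|g\|_{A^p_\omega}=\left(\int_{\mathbb D}|g|^p\omega\,dA\right)^{1/p}<\infty$, and $\overline{A^p_\omega}=\{\overline g:g\in A^p_\omega\}$ carries the same norm. Let $B^\omega_z$, $z\in\mathbb D$, denote the reproducing kernels of $A^2_\omega$, that is, $B^\omega_z\in A^2_\omega$ and $g(z)=\int_{\mathbb D}g(\zeta)\overline{B^\omega_z(\zeta)}\,\omega(\zeta)\,dA(\zeta)$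 for all $g\in A^2_\omega$. For $f\in\mathcal H(\mathbb D)$ the small Hankel operator $h^\omega_{\overline f}$ is defined by $$h^\omega_{\overline f}(g)(z)=\int_{\mathbb D}\overline{f(\zeta)}\,g(\zeta)\,B^\omega_z(\zeta)\,\omega(\zeta)\,dA(\zeta),\quad z\in\mathbb D.$$ It is called bounded from $A^p_\omega$ to $\overline{A^q_\omega}$ if for every $g\in A^p_\omega$ this integral converges absolutely for every $z\in\mathbb D$ and $h^\omega_{\overline f}(g)\in\overline{A^q_\omega}$, and there is a constant $C'\ge0$ with $\|h^\omega_{\overline f}(g)\|_{\overline{A^q_\omega}}\le C'\|g\|_{A^p_\omega}$ for all $g\in A^p_\omega$. Let $1<q<p<\infty$ and $\frac1s=\frac1q-\frac1p$ (so that $1<s<\infty$), let $\omega\in\widehat{\mathcal D}$ and let $f\in\mathcal H(\mathbb D)$. Then $h^\omega_{\overline f}:A^p_\omega\to\overline{A^q_\omega}$ is bounded if and only if $f\in A^s_\omega$. -/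

import Mathlib

open MeasureTheory Set
open scoped ENNReal ComplexConjugate

noncomputable section

namespace Bergman

/-- The open unit disc of the complex plane. -/
def unitDisc : Set ℂ := Metric.ball 0 1

/-- The normalized Lebesgue area measure `dx dy / π` on the unit disc. -/
def areaMeasure : Measure ℂ := (ENNReal.ofReal Real.pi)⁻¹ • volume.restrict unitDisc

/-- A weight is a nonnegative integrable function on the unit disc. Functions on the disc are
represented by functions on `ℂ` of which only the values on the disc are used. -/
structure IsWeight (ω : ℂ → ℝ) : Prop where
  nonneg : ∀ z ∈ unitDisc, 0 ≤ ω z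
  integrable : Integrable ω areaMeasure

/-- A radial weight. -/
structure IsRadialWeight (ω : ℂ → ℝ) : Prop extends IsWeight ω where
  radial : ∀ z ∈ unitDisc, ω z = ω ((‖z‖ : ℝ) : ℂ)

/-- The tail integral of a radial weight over `(r, 1)`, as an extended nonnegative real. -/
def tail (ω : ℂ → ℝ) (r : ℝ) : ℝ≥0∞ := ∫⁻ s in Ioo r 1, ENNReal.ofReal (ω (s : ℂ))

/-- The class of radial weights whose tail integral is positive and satisfies the doubling
inequality `tail r ≤ C * tail ((1 + r) / 2)` for `0 ≤ r < 1`. -/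
structure IsDoublingWeight (ω : ℂ → ℝ) : Prop extends IsRadialWeight ω where
  tail_pos : ∀ r ∈ Ico (0 : ℝ) 1, 0 < tail ω r
  doubling : ∃ C : ℝ, 1 ≤ C ∧
    ∀ r ∈ Ico (0 : ℝ) 1, tail ω r ≤ ENNReal.ofReal C * tail ω ((1 + r) / 2)

/-- The extended-real-valued norm `(∫ |f|^p ω dA)^(1/p)`. -/
def bergmanNorm (ω : ℂ → ℝ) (p : ℝ) (f : ℂ → ℂ) : ℝ≥0∞ :=
  (∫⁻ z, ‖f z‖ₑ ^ p * ENNReal.ofReal (ω z) ∂areaMeasure) ^ (1 / p)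

/-- Membership in the weighted Bergman space: `f` is analytic in the disc and has finite norm. -/
def MemBergman (ω : ℂ → ℝ) (p : ℝ) (f : ℂ → ℂ) : Prop :=
  DifferentiableOn ℂ f unitDisc ∧ bergmanNorm ω p f < ∞

/-- Membership in the space of complex conjugates of functions of the weighted Bergman space. -/
def MemConjBergman (ω : ℂ → ℝ) (p : ℝ) (u : ℂ → ℂ) : Prop :=
  MemBergman ω p (fun z => conj (u z))

/-- `K` is the reproducing kernel of the Bergman space with exponent 2 at the point `z`. -/
def IsReproducingKernelAt (ω : ℂ → ℝ) (z : ℂ) (K : ℂ → ℂ) : Prop :=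
  MemBergman ω 2 K ∧
    ∀ f : ℂ → ℂ, MemBergman ω 2 f → f z = ∫ ζ, f ζ * conj (K ζ) * (ω ζ : ℂ) ∂areaMeasure

open Classical in
/-- The reproducing kernel at `z`, as a function on the disc (zero if there is none). -/
def reproducingKernel (ω : ℂ → ℝ) (z : ℂ) : ℂ → ℂ :=
  if h : ∃ K : ℂ → ℂ, IsReproducingKernelAt ω z K then h.choose else 0

/-- The integrand in the definition of the small Hankel operator with symbol `conj f`. -/
def hankelIntegrand (ω : ℂ → ℝ) (f g : ℂ → ℂ) (z ζ : ℂ) : ℂ :=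
  conj (f ζ) * g ζ * reproducingKernel ω z ζ * (ω ζ : ℂ)

/-- The small Hankel operator with symbol `conj f`, applied to `g`. -/
def smallHankel (ω : ℂ → ℝ) (f g : ℂ → ℂ) (z : ℂ) : ℂ :=
  ∫ ζ, hankelIntegrand ω f g z ζ ∂areaMeasure

/-- The small Hankel operator with symbol `conj f` is a bounded operator from the Bergman space
with exponent `p` to the conjugate of the one with exponent `q`: on every `g` of the former its
defining integral converges absolutely at each point of the disc, the resulting function belongs
to the latter, and its norm is at most a constant times that of `g`. -/
structure HankelBounded (ω : ℂ → ℝ) (f : ℂ → ℂ) (p q : ℝ) : Prop where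
  integrable : ∀ g : ℂ → ℂ, MemBergman ω p g → ∀ z ∈ unitDisc,
    Integrable (hankelIntegrand ω f g z) areaMeasure
  mem : ∀ g : ℂ → ℂ, MemBergman ω p g → MemConjBergman ω q (smallHankel ω f g)
  bound : ∃ C : ℝ, 0 ≤ C ∧ ∀ g : ℂ → ℂ, MemBergman ω p g →
    bergmanNorm ω q (smallHankel ω f g) ≤ ENNReal.ofReal C * bergmanNorm ω p g

end Bergman

end

/-! The conjugate of the Hankel image of $g$ is the Bergman projection of $f\bar g$, so its pairing
with a polynomial $b$ is $\int f\,\bar g\,\bar b\,\omega\,dA$. If $f\in A^s_\omega$, Hölder's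
inequality puts $f\bar g$ in $L^q_\omega$, and it remains to bound the projection on $L^q_\omega$.
Conversely, with $r=q'$ and $t=s'$, so that $1/p+1/r=1/t$, boundedness of the operator bounds the
bilinear form $(a,b)\mapsto\int f\,\bar a\,\bar b\,\omega\,dA$ on $A^p_\omega\times A^r_\omega$. A
weak factorization of $A^t_\omega$ turns it into a bounded functional $H\mapsto\int f\bar
H\,\omega\,dA$ on polynomials in $A^t_\omega$, and duality gives $f\in A^s_\omega$.

Both directions rest on a decomposition in frequency. Doubling of the tail gives doubling of the
moments $\int|z|^k\omega\,dA$, hence frequencies $N_n$ along which the moments decay like $K^{-n}$.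
The norm $\|F\|^p_{A^p_\omega}$ is then comparable to $\sum_n K^{-n}\|\Delta_nF\|^p_{L^p(\mathbb
T)}$, where $\Delta_nF$ is the part of the Taylor series with $N_n\le k<N_{n+1}$. One bound is
`exists_analysis`, which uses M. Riesz's theorem for frequency truncations; the other is
`exists_synthesis`, which uses a discrete Hardy inequality and also admits factors $z^{j_n}a_n$
whose supports overlap. Dualizing block by block gives `exists_eLpNorm'_le_of_functional`, which
serves both as the bound for the projection and as the description of the dual space.

For the weak factorization (`exists_functional_le_of_bilinear`), each block is $z^{N_n}Q_n$ and
$Q_n$ is nearly a product $a_nb_n$ with controlled circle norms (`exists_approx_factor`). The power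
$z^{N_n}$ is shared between the factors, and the sums $\sum e^{in\tau}z^{N_n/2}a_n$ and $\sum
e^{-in\tau}z^{N_n/2}b_n$ (the exponents rounded to integers) are tested in the bilinear form.
Averaging over $\tau$ keeps only the diagonal terms, which add up to $H$ up to the error of
factorization. -/

noncomputable section

namespace Bergman

/-! ### The $L^p$ norms on the circle and their duality -/

section

/-- The normalized Haar measure of the circle. -/
abbrev circleMeasure : Measure UnitAddCircle := AddCircle.haarAddCircle

/-- The point of the unit circle with angle `t`. -/
def circlePt (t : UnitAddCircle) : ℂ := fourier 1 t

/-- The `L^p` norm on the circle, as a real number. -/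
def circleNorm (p : ℝ) (u : UnitAddCircle → ℂ) : ℝ := (eLpNorm' u p circleMeasure).toReal

lemma continuous_circlePt : Continuous circlePt := (fourier 1).continuous

@[simp] lemma norm_circlePt (t : UnitAddCircle) : ‖circlePt t‖ = 1 := by
  rw [circlePt, fourier_one]; exact Circle.norm_coe _

@[simp] lemma circlePt_pow (t : UnitAddCircle) (n : ℕ) : circlePt t ^ n = fourier (n : ℤ) t := by
  induction n with
  | zero => simp
  | succ n ih => rw [pow_succ, ih]; push_cast; rw [fourier_add]; rfl

lemma circlePt_add (s t : UnitAddCircle) : circlePt (s + t) = circlePt s * circlePt t := by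
  simp [circlePt, AddCircle.toCircle_add]

lemma exists_circlePt {z : ℂ} (hz : ‖z‖ = 1) : ∃ t, circlePt t = z := by
  obtain ⟨t, ht⟩ := (AddCircle.homeomorphCircle (T := 1) one_ne_zero).surjective
    ⟨z, by simp [Submonoid.unitSphere, hz]⟩
  refine ⟨t, ?_⟩
  rw [circlePt, fourier_one]
  have := congrArg (fun w : Circle => (w : ℂ)) ht
  simpa [AddCircle.homeomorphCircle_apply] using this

lemma exists_bound_of_continuous {u : UnitAddCircle → ℂ} (hu : Continuous u) :
    ∃ B : ℝ, 0 ≤ B ∧ ∀ t, ‖u t‖ ≤ B := by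
  obtain ⟨B, hB⟩ := (isCompact_range hu).isBounded.exists_norm_le
  exact ⟨max B 0, le_max_right _ _, fun t => (hB _ ⟨t, rfl⟩).trans (le_max_left _ _)⟩

lemma integrable_of_continuous {E : Type*} [NormedAddCommGroup E] {u : UnitAddCircle → E}
    (hu : Continuous u) : Integrable u circleMeasure :=
  hu.integrable_of_hasCompactSupport (HasCompactSupport.of_compactSpace u)

/-- The passage to real numbers sends an infinite norm to $0$. Finiteness for continuous functions
is what makes `circleNorm` a faithful norm, and the reason for the continuity hypotheses below. -/
lemma eLpNorm'_circle_lt_top {p : ℝ} (hp : 0 < p) {u : UnitAddCircle → ℂ} (hu : Continuous u) :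
    eLpNorm' u p circleMeasure < ∞ := by
  obtain ⟨B, hB, h⟩ := exists_bound_of_continuous hu
  refine lt_of_le_of_lt (eLpNorm'_mono_ae (g := fun _ => (B : ℂ)) hp.le
    (Filter.Eventually.of_forall fun t => ?_)) ?_
  · simpa [abs_of_nonneg hB] using h t
  · rw [eLpNorm'_const_of_isProbabilityMeasure _ hp]; exact enorm_lt_top

lemma ofReal_circleNorm {p : ℝ} (hp : 0 < p) {u : UnitAddCircle → ℂ} (hu : Continuous u) :
    ENNReal.ofReal (circleNorm p u) = eLpNorm' u p circleMeasure :=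
  ENNReal.ofReal_toReal (eLpNorm'_circle_lt_top hp hu).ne

lemma circleNorm_nonneg (p : ℝ) (u : UnitAddCircle → ℂ) : 0 ≤ circleNorm p u :=
  ENNReal.toReal_nonneg

lemma circleNorm_rpow {p : ℝ} (hp : 0 < p) {u : UnitAddCircle → ℂ} (hu : Continuous u) :
    circleNorm p u ^ p = ∫ t, ‖u t‖ ^ p ∂circleMeasure := by
  rw [circleNorm, eLpNorm'_eq_lintegral_enorm, ← ENNReal.toReal_rpow, ← Real.rpow_mul
    ENNReal.toReal_nonneg, one_div, inv_mul_cancel₀ hp.ne', Real.rpow_one,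
    integral_eq_lintegral_of_nonneg_ae (Filter.Eventually.of_forall fun t => by positivity)]
  · congr 1
    refine lintegral_congr fun t => ?_
    rw [← ENNReal.ofReal_rpow_of_nonneg (norm_nonneg _) hp.le, ofReal_norm]
  · exact (hu.norm.rpow_const fun _ => Or.inr hp.le).aestronglyMeasurable

lemma circleNorm_add_le {p : ℝ} (hp : 1 ≤ p) {u v : UnitAddCircle → ℂ} (hu : Continuous u)
    (hv : Continuous v) : circleNorm p (fun t => u t + v t) ≤ circleNorm p u + circleNorm p v := by
  have hp0 : 0 < p := by linarith
  rw [circleNorm, circleNorm, circleNorm, ← ENNReal.toReal_add (eLpNorm'_circle_lt_top hp0 hu).ne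
    (eLpNorm'_circle_lt_top hp0 hv).ne]
  exact ENNReal.toReal_mono (ENNReal.add_ne_top.2 ⟨(eLpNorm'_circle_lt_top hp0 hu).ne,
    (eLpNorm'_circle_lt_top hp0 hv).ne⟩) (eLpNorm'_add_le hu.aestronglyMeasurable
      hv.aestronglyMeasurable hp)

lemma circleNorm_const_mul {p : ℝ} (hp : 0 < p) (c : ℂ) (u : UnitAddCircle → ℂ) :
    circleNorm p (fun t => c * u t) = ‖c‖ * circleNorm p u := by
  have := eLpNorm'_const_smul (μ := circleMeasure) (f := u) c hp
  rw [circleNorm, circleNorm, ← toReal_enorm c, ← ENNReal.toReal_mul, ← this]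
  rfl

lemma circleNorm_mono {p : ℝ} (hp : 0 < p) {u v : UnitAddCircle → ℂ} (hv : Continuous v)
    (h : ∀ t, ‖u t‖ ≤ ‖v t‖) : circleNorm p u ≤ circleNorm p v :=
  ENNReal.toReal_mono (eLpNorm'_circle_lt_top hp hv).ne
    (eLpNorm'_mono_ae hp.le (Filter.Eventually.of_forall h))

lemma circleNorm_congr {p : ℝ} {u v : UnitAddCircle → ℂ} (h : ∀ t, ‖u t‖ = ‖v t‖) :
    circleNorm p u = circleNorm p v := by
  rw [circleNorm, circleNorm, eLpNorm'_congr_norm_ae (Filter.Eventually.of_forall h)]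

lemma circleNorm_le_of_bound {p : ℝ} (hp : 0 < p) {u : UnitAddCircle → ℂ} {B : ℝ}
    (h : ∀ t, ‖u t‖ ≤ B) : circleNorm p u ≤ B := by
  have hB : 0 ≤ B := (norm_nonneg _).trans (h 0)
  refine (circleNorm_mono hp (v := fun _ => (B : ℂ)) continuous_const fun t => ?_).trans_eq ?_
  · simpa [abs_of_nonneg hB] using h t
  · rw [circleNorm, eLpNorm'_const_of_isProbabilityMeasure _ hp, toReal_enorm]
    simp [abs_of_nonneg hB]

lemma circleNorm_sub_le {p : ℝ} (hp : 1 ≤ p) {u v : UnitAddCircle → ℂ} (hu : Continuous u)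
    (hv : Continuous v) : circleNorm p (fun t => u t - v t) ≤ circleNorm p u + circleNorm p v := by
  have h := circleNorm_add_le hp hu (v := fun t => -v t) hv.neg
  rw [circleNorm_congr (u := fun t => -v t) (v := v) fun t => norm_neg _] at h
  simpa [sub_eq_add_neg] using h

lemma circleNorm_sum_le {p : ℝ} (hp : 1 ≤ p) {ι : Type*} (s : Finset ι)
    {u : ι → UnitAddCircle → ℂ} (hu : ∀ i ∈ s, Continuous (u i)) :
    circleNorm p (fun t => ∑ i ∈ s, u i t) ≤ ∑ i ∈ s, circleNorm p (u i) := by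
  classical
  induction s using Finset.induction_on with
  | empty =>
    simpa using circleNorm_le_of_bound (p := p) (by linarith) (u := fun _ => 0) (B := 0) (by simp)
  | insert i s hi ih =>
    simp only [Finset.sum_insert hi]
    refine (circleNorm_add_le hp (hu i (by simp))
      (continuous_finsetSum _ fun j hj => hu j (by simp [hj]))).trans ?_
    gcongr
    exact ih fun j hj => hu j (by simp [hj])

lemma circleNorm_le_of_exponent_le {p q : ℝ} (hp : 0 < p) (hpq : p ≤ q) {u : UnitAddCircle → ℂ}
    (hu : Continuous u) : circleNorm p u ≤ circleNorm q u :=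
  ENNReal.toReal_mono (eLpNorm'_circle_lt_top (hp.trans_le hpq) hu).ne
    (eLpNorm'_le_eLpNorm'_of_exponent_le hp hpq _ hu.aestronglyMeasurable)

lemma enorm_integral_mul_le {α : Type*} [MeasurableSpace α] {μ : Measure α} {p q : ℝ}
    (hpq : p.HolderConjugate q) {u v : α → ℂ} (hu : AEStronglyMeasurable u μ)
    (hv : AEStronglyMeasurable v μ) :
    ‖∫ t, u t * v t ∂μ‖ₑ ≤ eLpNorm' u p μ * eLpNorm' v q μ := by
  refine (enorm_integral_le_lintegral_enorm _).trans ?_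
  simp_rw [enorm_mul]
  exact ENNReal.lintegral_mul_le_Lp_mul_Lq μ hpq hu.enorm hv.enorm

lemma norm_integral_mul_conj_le {p q : ℝ} (hpq : p.HolderConjugate q) {u v : UnitAddCircle → ℂ}
    (hu : Continuous u) (hv : Continuous v) :
    ‖∫ t, u t * conj (v t) ∂circleMeasure‖ ≤ circleNorm p u * circleNorm q v := by
  have hq0 : 0 < q := hpq.symm.pos
  have h := enorm_integral_mul_le (μ := circleMeasure) hpq hu.aestronglyMeasurable
    (v := fun t => conj (v t)) (Complex.continuous_conj.comp hv).aestronglyMeasurable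
  have h1 : eLpNorm' (fun t => conj (v t)) q circleMeasure = eLpNorm' v q circleMeasure :=
    eLpNorm'_congr_norm_ae (Filter.Eventually.of_forall fun t => by simp)
  rw [h1] at h
  rw [← toReal_enorm, circleNorm, circleNorm, ← ENNReal.toReal_mul]
  exact ENNReal.toReal_mono (ENNReal.mul_ne_top (eLpNorm'_circle_lt_top hpq.pos hu).ne
    (eLpNorm'_circle_lt_top hq0 hv).ne) h

/-- The trigonometric polynomial with analytic part `a` and conjugate analytic part `b`. -/
def trig (a b : Polynomial ℂ) (t : UnitAddCircle) : ℂ :=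
  a.eval (circlePt t) + conj (b.eval (circlePt t))

lemma continuous_eval_circlePt (a : Polynomial ℂ) : Continuous fun t => a.eval (circlePt t) :=
  a.continuous.comp continuous_circlePt

lemma continuous_trig (a b : Polynomial ℂ) : Continuous (trig a b) :=
  (continuous_eval_circlePt a).add (Complex.continuous_conj.comp (continuous_eval_circlePt b))

/-- The constant term is always allotted to the analytic part. The condition `b.coeff 0 = 0` makes
the splitting unique and the two parts orthogonal. -/
lemma exists_trig_of_mem_span {h : C(UnitAddCircle, ℂ)}
    (hh : h ∈ Submodule.span ℂ (range (fourier (T := 1)))) :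
    ∃ a b : Polynomial ℂ, b.coeff 0 = 0 ∧ ∀ t, h t = trig a b t := by
  induction hh using Submodule.span_induction with
  | mem x hx =>
    obtain ⟨n, rfl⟩ := hx
    obtain ⟨k, rfl | rfl⟩ := n.eq_nat_or_neg
    · exact ⟨Polynomial.X ^ k, 0, by simp, fun t => by simp [trig]⟩
    · rcases Nat.eq_zero_or_pos k with rfl | hk
      · exact ⟨1, 0, by simp, fun t => by simp [trig]⟩
      · refine ⟨0, Polynomial.X ^ k, by simp [Polynomial.coeff_X_pow, hk.ne], fun t => ?_⟩
        rw [fourier_neg]; simp [trig]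
  | zero => exact ⟨0, 0, by simp, fun t => by simp [trig]⟩
  | add x y _ _ hx hy =>
    obtain ⟨a, b, hb, h1⟩ := hx
    obtain ⟨a', b', hb', h2⟩ := hy
    refine ⟨a + a', b + b', by simp [hb, hb'], fun t => ?_⟩
    simp only [ContinuousMap.add_apply, h1, h2, trig, Polynomial.eval_add, map_add]; ring
  | smul c x _ hx =>
    obtain ⟨a, b, hb, h1⟩ := hx
    refine ⟨Polynomial.C c * a, Polynomial.C (conj c) * b, by simp [hb], fun t => ?_⟩
    simp only [ContinuousMap.smul_apply, h1, trig, Polynomial.eval_mul, Polynomial.eval_C, map_mul,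
      smul_eq_mul, Complex.conj_conj]; ring

lemma exists_trig_approx {φ : UnitAddCircle → ℂ} (hφ : Continuous φ) {ε : ℝ} (hε : 0 < ε) :
    ∃ a b : Polynomial ℂ, b.coeff 0 = 0 ∧ ∀ t, ‖φ t - trig a b t‖ ≤ ε := by
  have h : (⟨φ, hφ⟩ : C(UnitAddCircle, ℂ)) ∈
      (Submodule.span ℂ (range (fourier (T := 1)))).topologicalClosure := by
    rw [span_fourier_closure_eq_top]; trivial
  rw [← SetLike.mem_coe, Submodule.topologicalClosure_coe, Metric.mem_closure_iff] at h
  obtain ⟨x, hx, hd⟩ := h ε hε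
  obtain ⟨a, b, hb, hab⟩ := exists_trig_of_mem_span hx
  refine ⟨a, b, hb, fun t => ?_⟩
  rw [← hab, ← dist_eq_norm]
  exact (ContinuousMap.dist_apply_le_dist t).trans hd.le

/-- The element `|x|^(p-2) x`, which attains the duality between `L^p` and its dual. -/
def dualElt (p : ℝ) (x : ℂ) : ℂ := ((‖x‖ ^ (p - 2) : ℝ) : ℂ) * x

lemma norm_dualElt {p : ℝ} (hp : 1 < p) (x : ℂ) : ‖dualElt p x‖ = ‖x‖ ^ (p - 1) := by
  rcases eq_or_ne x 0 with rfl | hx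
  · simp [dualElt, Real.zero_rpow (by linarith : p - 1 ≠ 0)]
  · have : 0 < ‖x‖ := norm_pos_iff.2 hx
    rw [dualElt, norm_mul, Complex.norm_real, Real.norm_of_nonneg (by positivity),
      ← Real.rpow_add_one this.ne']
    congr 1; ring

lemma mul_conj_dualElt {p : ℝ} (hp : 1 < p) (x : ℂ) :
    x * conj (dualElt p x) = ((‖x‖ ^ p : ℝ) : ℂ) := by
  rcases eq_or_ne x 0 with rfl | hx
  · simp [Real.zero_rpow (by linarith : p ≠ 0)]
  · have : 0 < ‖x‖ := norm_pos_iff.2 hx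
    rw [dualElt, map_mul, Complex.conj_ofReal, mul_left_comm, Complex.mul_conj,
      Complex.normSq_eq_norm_sq, ← Complex.ofReal_mul, ← Real.rpow_natCast, ← Real.rpow_add this]
    congr 2; norm_num

lemma continuous_dualElt {p : ℝ} (hp : 1 < p) : Continuous (dualElt p) := by
  refine continuous_iff_continuousAt.2 fun x => ?_
  rcases eq_or_ne x 0 with rfl | hx
  · have h0 : dualElt p 0 = 0 := by simp [dualElt]
    rw [ContinuousAt, h0, tendsto_zero_iff_norm_tendsto_zero]
    simp_rw [norm_dualElt hp]
    have : Continuous fun x : ℂ => ‖x‖ ^ (p - 1) :=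
      continuous_norm.rpow_const fun _ => Or.inr (by linarith)
    have h := this.tendsto 0
    rwa [norm_zero, Real.zero_rpow (by linarith : p - 1 ≠ 0)] at h
  · have : ContinuousAt (fun x : ℂ => ‖x‖ ^ (p - 2)) x :=
      continuous_norm.continuousAt.rpow_const (Or.inl (norm_ne_zero_iff.2 hx))
    exact (Complex.continuous_ofReal.continuousAt.comp this).mul continuousAt_id

lemma circleNorm_dualElt {p q : ℝ} (hpq : p.HolderConjugate q) {w : UnitAddCircle → ℂ}
    (hw : Continuous w) : circleNorm q (fun t => dualElt p (w t)) = circleNorm p w ^ (p - 1) := by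
  have hp := hpq.lt
  have hq0 : 0 < q := hpq.symm.pos
  have h1 := circleNorm_rpow hq0 ((continuous_dualElt hp).comp hw)
  simp only [Function.comp_apply, norm_dualElt hp, ← Real.rpow_mul (norm_nonneg _),
    hpq.sub_one_mul_conj] at h1
  rw [← circleNorm_rpow hpq.pos hw] at h1
  have h2 := congrArg (fun x : ℝ => x ^ (1 / q)) h1
  simp only [← Real.rpow_mul (circleNorm_nonneg _ _)] at h2
  rw [mul_one_div_cancel hq0.ne', Real.rpow_one] at h2
  refine Eq.trans h2 ?_
  congr 1
  rw [mul_one_div, div_eq_iff hq0.ne', hpq.sub_one_mul_conj]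

lemma integral_mul_conj_dualElt {p : ℝ} (hp : 1 < p) {w : UnitAddCircle → ℂ} (hw : Continuous w) :
    ∫ t, w t * conj (dualElt p (w t)) ∂circleMeasure = ((circleNorm p w ^ p : ℝ) : ℂ) := by
  simp_rw [mul_conj_dualElt hp, integral_complex_ofReal, circleNorm_rpow (by linarith : 0 < p) hw]

/-- The extremal test function $|w|^{p-2}w$ is itself continuous because $p>1$, so continuous test
functions suffice. -/
lemma circleNorm_le_of_forall_pairing {p q : ℝ} (hpq : p.HolderConjugate q)
    {w : UnitAddCircle → ℂ} (hw : Continuous w) {K : ℝ} (hK : 0 ≤ K)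
    (h : ∀ ψ : UnitAddCircle → ℂ, Continuous ψ →
      ‖∫ t, w t * conj (ψ t) ∂circleMeasure‖ ≤ K * circleNorm q ψ) : circleNorm p w ≤ K := by
  have hp := hpq.lt
  have h1 := h (fun t => dualElt p (w t)) ((continuous_dualElt hp).comp hw)
  rw [integral_mul_conj_dualElt hp hw, circleNorm_dualElt hpq hw, Complex.norm_real,
    Real.norm_of_nonneg (Real.rpow_nonneg (circleNorm_nonneg _ _) _)] at h1
  rcases (circleNorm_nonneg p w).eq_or_lt with h0 | h0
  · rwa [← h0]
  · have : circleNorm p w ^ p = circleNorm p w * circleNorm p w ^ (p - 1) := by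
      rw [← Real.rpow_one_add' h0.le (by linarith)]; congr 1; ring
    rw [this] at h1
    exact le_of_mul_le_mul_right h1 (by positivity)

/-- Trigonometric polynomials are uniformly dense, and both sides are continuous for uniform
convergence. -/
lemma pairing_le_of_forall_trig {q : ℝ} (hq : 1 ≤ q) {w : UnitAddCircle → ℂ} (hw : Continuous w)
    {K : ℝ} (hK : 0 ≤ K)
    (h : ∀ a b : Polynomial ℂ, b.coeff 0 = 0 →
      ‖∫ t, w t * conj (trig a b t) ∂circleMeasure‖ ≤ K * circleNorm q (trig a b))
    {ψ : UnitAddCircle → ℂ} (hψ : Continuous ψ) :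
      ‖∫ t, w t * conj (ψ t) ∂circleMeasure‖ ≤ K * circleNorm q ψ := by
  obtain ⟨B, hB, hwB⟩ := exists_bound_of_continuous hw
  have key : ∀ ε : ℝ, 0 < ε → ‖∫ t, w t * conj (ψ t) ∂circleMeasure‖ ≤
      K * circleNorm q ψ + ε * (K + B) := by
    intro ε hε
    obtain ⟨a, b, hb, hab⟩ := exists_trig_approx hψ hε
    have c1 : Continuous fun t => w t * conj (trig a b t) :=
      hw.mul (Complex.continuous_conj.comp (continuous_trig a b))
    have c2 : Continuous fun t => w t * conj (ψ t - trig a b t) :=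
      hw.mul (Complex.continuous_conj.comp (hψ.sub (continuous_trig a b)))
    have e1 : ∫ t, w t * conj (ψ t) ∂circleMeasure = (∫ t, w t * conj (trig a b t) ∂circleMeasure)
        + ∫ t, w t * conj (ψ t - trig a b t) ∂circleMeasure := by
      rw [← integral_add (integrable_of_continuous c1) (integrable_of_continuous c2)]
      congr 1; ext t; rw [map_sub]; ring
    have e2 : ‖∫ t, w t * conj (ψ t - trig a b t) ∂circleMeasure‖ ≤ B * ε := by
      refine (norm_integral_le_of_norm_le_const (C := B * ε)
        (Filter.Eventually.of_forall fun t => ?_)).trans (by simp)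
      rw [norm_mul, RCLike.norm_conj]
      exact mul_le_mul (hwB t) (hab t) (norm_nonneg _) hB
    have e3 : circleNorm q (trig a b) ≤ circleNorm q ψ + ε := by
      have := circleNorm_sub_le hq hψ (hψ.sub (continuous_trig a b))
      simp only [Pi.sub_apply, sub_sub_cancel] at this
      refine this.trans ?_
      gcongr
      exact circleNorm_le_of_bound (by linarith) hab
    rw [e1]
    refine (norm_add_le _ _).trans ((add_le_add (h a b hb) e2).trans ?_)
    nlinarith [mul_le_mul_of_nonneg_left e3 hK]
  refine le_of_forall_pos_le_add fun ε hε => ?_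
  have := key (ε / (K + B + 1)) (by positivity)
  refine this.trans ?_
  gcongr
  rw [div_mul_eq_mul_div]
  exact div_le_of_le_mul₀ (by positivity) hε.le (by nlinarith)

end

/-! ### M. Riesz's inequality for analytic polynomials, $1<p\le2$ -/

section

/-- With $\theta=|\arg z|<\pi/2$ the claim reads $1\le A\cos^p\theta-B\cos p\theta$. Away from
$\pi/2$ the first term is bounded below. Near $\pi/2$ the angle $p\theta$ lies beyond $\pi/2$ since
$p>1$, and not beyond $\pi$ since $p\le2$, so $\cos p\theta$ is negative and bounded away from $0$.
-/
lemma exists_norm_rpow_le_re_rpow_sub {p : ℝ} (hp : 1 < p) (hp2 : p ≤ 2) :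
    ∃ A B : ℝ, 0 ≤ A ∧ 0 ≤ B ∧ ∀ z : ℂ, 0 < z.re →
      ‖z‖ ^ p ≤ A * z.re ^ p - B * (z ^ (p : ℂ)).re := by
  have hpi := Real.pi_pos
  have hp0 : 0 < p := by linarith
  -- The angle separating the two regimes: the midpoint of $\pi/(2p)$ and $\pi/2$.
  obtain ⟨t₀, ht0, ht1, ht2⟩ : ∃ t₀ : ℝ, 0 < t₀ ∧ t₀ < Real.pi / 2 ∧ Real.pi / 2 < p * t₀ := by
    refine ⟨(Real.pi / 2) * ((1 / p + 1) / 2), by positivity, ?_, ?_⟩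
    · have : 1 / p < 1 := by rw [div_lt_one hp0]; exact hp
      nlinarith
    · have : p * (Real.pi / 2 * ((1 / p + 1) / 2)) = Real.pi / 2 * ((1 + p) / 2) := by
        field_simp
      rw [this]; nlinarith
  have hκ : Real.cos (p * t₀) < 0 := by
    refine Real.cos_neg_of_pi_div_two_lt_of_lt ht2 ?_
    nlinarith
  set κ := -Real.cos (p * t₀) with hκd
  have hκ0 : 0 < κ := by rw [hκd]; linarith
  have hc0 : 0 < Real.cos t₀ := Real.cos_pos_of_mem_Ioo ⟨by linarith, ht1⟩
  refine ⟨(1 + 1 / κ) / Real.cos t₀ ^ p, 1 / κ, by positivity, by positivity, fun z hz => ?_⟩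
  have hz0 : z ≠ 0 := by rintro rfl; simp at hz
  have hn : 0 < ‖z‖ := norm_pos_iff.2 hz0
  have harg : |z.arg| < Real.pi / 2 := by
    rw [Complex.abs_arg_lt_pi_div_two_iff]; exact Or.inl hz
  have hre : z.re = ‖z‖ * Real.cos |z.arg| := by
    rw [Real.cos_abs, Complex.norm_mul_cos_arg]
  have hpow : (z ^ (p : ℂ)).re = ‖z‖ ^ p * Real.cos (p * |z.arg|) := by
    rw [Complex.cpow_def_of_ne_zero hz0, Complex.exp_re]
    congr 1
    · rw [Complex.re_mul_ofReal, Complex.log_re, Real.rpow_def_of_pos hn]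
    · rw [Complex.im_mul_ofReal, Complex.log_im, ← Real.cos_abs, abs_mul, abs_of_pos hp0, mul_comm]
  have hcz : 0 < Real.cos |z.arg| :=
    Real.cos_pos_of_mem_Ioo ⟨by linarith [abs_nonneg z.arg], harg⟩
  rw [hpow, hre, Real.mul_rpow hn.le hcz.le]
  set s := |z.arg|
  have hs0 : 0 ≤ s := abs_nonneg _
  suffices h : 1 ≤ (1 + 1 / κ) / Real.cos t₀ ^ p * Real.cos s ^ p - 1 / κ * Real.cos (p * s) by
    have hnp : 0 < ‖z‖ ^ p := by positivity
    nlinarith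
  rcases le_total s t₀ with hst | hst
  · have h1 : Real.cos t₀ ^ p ≤ Real.cos s ^ p :=
      Real.rpow_le_rpow hc0.le (Real.cos_le_cos_of_nonneg_of_le_pi hs0 (by linarith) hst) hp0.le
    have h2 : (1 + 1 / κ) ≤ (1 + 1 / κ) / Real.cos t₀ ^ p * Real.cos s ^ p := by
      rw [div_mul_eq_mul_div, le_div_iff₀ (by positivity)]
      gcongr
    have h3 : 1 / κ * Real.cos (p * s) ≤ 1 / κ * 1 := by
      gcongr; exact Real.cos_le_one _
    linarith
  · have h1 : Real.cos (p * s) ≤ -κ := by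
      rw [hκd, neg_neg]
      exact Real.cos_le_cos_of_nonneg_of_le_pi (by positivity) (by nlinarith) (by gcongr)
    have h2 : 1 / κ * Real.cos (p * s) ≤ 1 / κ * (-κ) := by gcongr
    have h3 : 1 / κ * (-κ) = -1 := by field_simp
    have h4 : 0 ≤ (1 + 1 / κ) / Real.cos t₀ ^ p * Real.cos s ^ p := by positivity
    linarith

/-- Compactness leaves room for a disc of radius $1+\delta$ inside $U$; the partial sums of the
Taylor series converge uniformly on the disc of radius $1+\delta/2$. -/
lemma exists_polynomial_approx {F : ℂ → ℂ} {U : Set ℂ} (hU : IsOpen U)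
    (hUc : Metric.closedBall 0 1 ⊆ U) (hF : DifferentiableOn ℂ F U) {ε : ℝ} (hε : 0 < ε) :
    ∃ P : Polynomial ℂ, ∀ z : ℂ, ‖z‖ ≤ 1 → ‖F z - P.eval z‖ ≤ ε := by
  obtain ⟨δ, hδ, hδU⟩ := (isCompact_closedBall (0 : ℂ) 1).exists_cthickening_subset_open hU hUc
  have hsub : Metric.closedBall (0 : ℂ) (δ + 1) ⊆ U := by
    rwa [cthickening_closedBall hδ.le zero_le_one] at hδU
  lift δ to NNReal using hδ.le
  have hδ' : 0 < δ := by exact_mod_cast hδ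
  have hps := (hF.mono hsub).hasFPowerSeriesOnBall (R := δ + 1) (by positivity)
  have hlt : ((δ / 2 + 1 : NNReal) : ENNReal) < ((δ + 1 : NNReal) : ENNReal) := by
    rw [ENNReal.coe_lt_coe]
    gcongr
    exact NNReal.half_lt_self hδ'.ne'
  have hu := hps.tendstoUniformlyOn hlt
  rw [Metric.tendstoUniformlyOn_iff] at hu
  obtain ⟨n, hn⟩ := (hu ε hε).exists
  refine ⟨∑ k ∈ Finset.range n, Polynomial.C ((cauchyPowerSeries F 0 ((δ + 1 : NNReal) : ℝ)).coeff k) *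
    Polynomial.X ^ k, fun z hz => ?_⟩
  have := hn z (by
    rw [mem_ball_zero_iff]
    push_cast
    linarith)
  rw [zero_add, dist_eq_norm] at this
  refine le_trans (le_of_eq ?_) this.le
  congr 2
  rw [Polynomial.eval_finsetSum, FormalMultilinearSeries.partialSum]
  refine Finset.sum_congr rfl fun k _ => ?_
  rw [FormalMultilinearSeries.apply_eq_pow_smul_coeff, Polynomial.eval_mul, Polynomial.eval_C,
    Polynomial.eval_pow, Polynomial.eval_X, smul_eq_mul, mul_comm]

lemma integral_fourier (n : ℤ) : ∫ t, fourier n t ∂circleMeasure = if n = 0 then 1 else 0 := by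
  have h := fourierCoeff_fourier (T := 1) n
  have h0 := congrFun h 0
  simp only [fourierCoeff, neg_zero, fourier_zero, one_smul] at h0
  rw [h0, Pi.single_apply]
  simp [eq_comm]

lemma integral_eval_mul_conj_pow (a : Polynomial ℂ) (k : ℕ) :
    ∫ t, a.eval (circlePt t) * conj (circlePt t ^ k) ∂circleMeasure = a.coeff k := by
  induction a using Polynomial.induction_on' with
  | add a b ha hb =>
    rw [Polynomial.coeff_add, ← ha, ← hb, ← integral_add]
    · simp only [Polynomial.eval_add, add_mul]
    · exact integrable_of_continuous ((continuous_eval_circlePt a).mul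
        (Complex.continuous_conj.comp (continuous_circlePt.pow k)))
    · exact integrable_of_continuous ((continuous_eval_circlePt b).mul
        (Complex.continuous_conj.comp (continuous_circlePt.pow k)))
  | monomial n c =>
    simp only [Polynomial.eval_monomial, circlePt_pow, ← fourier_neg, mul_assoc, ← fourier_add]
    rw [integral_const_mul, integral_fourier, Polynomial.coeff_monomial]
    by_cases h : n = k
    · simp [h]
    · rw [if_neg h, if_neg (by omega), mul_zero]

lemma integral_eval_circlePt (a : Polynomial ℂ) :
    ∫ t, a.eval (circlePt t) ∂circleMeasure = a.coeff 0 := by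
  simpa using integral_eval_mul_conj_pow a 0

lemma integral_comp_circlePt {F : ℂ → ℂ} {U : Set ℂ} (hU : IsOpen U)
    (hUc : Metric.closedBall 0 1 ⊆ U) (hF : DifferentiableOn ℂ F U) :
    ∫ t, F (circlePt t) ∂circleMeasure = F 0 := by
  have hc : Continuous fun t => F (circlePt t) :=
    hF.continuousOn.comp_continuous continuous_circlePt fun t => hUc (by simp)
  rw [← sub_eq_zero, ← norm_eq_zero]
  refine le_antisymm (le_of_forall_pos_le_add fun ε hε => ?_) (norm_nonneg _)
  obtain ⟨P, hP⟩ := exists_polynomial_approx hU hUc hF (half_pos hε)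
  have h1 : (∫ t, F (circlePt t) ∂circleMeasure) - F 0 =
      (∫ t, (F (circlePt t) - P.eval (circlePt t)) ∂circleMeasure) - (F 0 - P.eval 0) := by
    rw [integral_sub (integrable_of_continuous hc)
      (integrable_of_continuous (continuous_eval_circlePt P)), integral_eval_circlePt,
      Polynomial.coeff_zero_eq_eval_zero]
    ring
  rw [h1]
  refine (norm_sub_le _ _).trans ?_
  have h2 : ‖∫ t, (F (circlePt t) - P.eval (circlePt t)) ∂circleMeasure‖ ≤ ε / 2 :=
    (norm_integral_le_of_norm_le_const (Filter.Eventually.of_forall fun t =>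
      hP (circlePt t) (by simp))).trans (by simp)
  have h3 := hP 0 (by simp)
  linarith

/-- The maximum principle for $\exp(-G)$, whose modulus is $e^{-\operatorname{Re}G}$. -/
lemma le_re_eval_of_le_re_circle {G : Polynomial ℂ} {c : ℝ}
    (hG : ∀ t, c ≤ (G.eval (circlePt t)).re) {z : ℂ} (hz : ‖z‖ ≤ 1) : c ≤ (G.eval z).re := by
  have hd : DiffContOnCl ℂ (fun z => Complex.exp (-G.eval z)) (Metric.ball 0 1) :=
    (Complex.differentiable_exp.comp G.differentiable.neg).diffContOnCl
  have h := Complex.norm_le_of_forall_mem_frontier_norm_le Metric.isBounded_ball hd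
    (C := Real.exp (-c)) (fun w hw => ?_) (z := z) ?_
  · rw [Complex.norm_exp, Real.exp_le_exp, Complex.neg_re] at h
    linarith
  · rw [frontier_ball _ one_ne_zero, mem_sphere_zero_iff_norm] at hw
    obtain ⟨t, rfl⟩ := exists_circlePt hw
    rw [Complex.norm_exp, Real.exp_le_exp, Complex.neg_re]
    linarith [hG t]
  · rw [closure_ball _ one_ne_zero, mem_closedBall_zero_iff]; exact hz

lemma isOpen_re_eval_pos (G : Polynomial ℂ) : IsOpen {z | 0 < (G.eval z).re} :=
  isOpen_lt continuous_const (Complex.continuous_re.comp G.continuous)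

lemma differentiableOn_eval_cpow (G : Polynomial ℂ) (p : ℂ) :
    DifferentiableOn ℂ (fun z => G.eval z ^ p) {z | 0 < (G.eval z).re} :=
  fun z hz => (G.differentiable z).differentiableWithinAt.cpow_const (Or.inl hz)

lemma closedBall_subset_re_eval_pos {G : Polynomial ℂ} {c : ℝ} (hc : 0 < c)
    (hG : ∀ t, c ≤ (G.eval (circlePt t)).re) :
    Metric.closedBall 0 1 ⊆ {z | 0 < (G.eval z).re} := fun z hz =>
  hc.trans_le (le_re_eval_of_le_re_circle hG (by simpa using hz))

lemma continuous_re_eval_circlePt (G : Polynomial ℂ) :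
    Continuous fun t => (((G.eval (circlePt t)).re : ℝ) : ℂ) :=
  Complex.continuous_ofReal.comp (Complex.continuous_re.comp (continuous_eval_circlePt G))

/-- The pointwise inequality is integrated at $z=G$. Since $G$ has positive real part on the closed
disc, $G^p$ is analytic there and the mean of $\operatorname{Re}G^p$ is $G(0)^p$, which is
nonnegative because $G(0)$ is real and positive. The term with $-B$ can be dropped. -/
lemma exists_circleNorm_le_re_of_pos {p : ℝ} (hp : 1 < p) (hp2 : p ≤ 2) :
    ∃ A : ℝ, 0 ≤ A ∧ ∀ (G : Polynomial ℂ) (c : ℝ), 0 < c → (∀ t, c ≤ (G.eval (circlePt t)).re) →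
      (G.coeff 0).im = 0 → circleNorm p (fun t => G.eval (circlePt t)) ≤
        A * circleNorm p (fun t => ((G.eval (circlePt t)).re : ℂ)) := by
  obtain ⟨A, B, hA, hB, h⟩ := exists_norm_rpow_le_re_rpow_sub hp hp2
  have hp0 : 0 < p := by linarith
  refine ⟨A ^ (1 / p), by positivity, fun G c hc hG hG0 => ?_⟩
  have hmv : ∫ t, G.eval (circlePt t) ^ (p : ℂ) ∂circleMeasure = G.eval 0 ^ (p : ℂ) :=
    integral_comp_circlePt (isOpen_re_eval_pos G) (closedBall_subset_re_eval_pos hc hG)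
      (differentiableOn_eval_cpow G p)
  have hcont : Continuous fun t => G.eval (circlePt t) ^ (p : ℂ) :=
    (differentiableOn_eval_cpow G p).continuousOn.comp_continuous continuous_circlePt
      fun t => hc.trans_le (hG t)
  have h0 : 0 ≤ (G.eval 0 ^ (p : ℂ)).re := by
    have h1 : 0 < (G.eval 0).re := hc.trans_le (le_re_eval_of_le_re_circle hG (by simp))
    have h2 : G.eval 0 = (((G.eval 0).re : ℝ) : ℂ) := by
      rw [← Polynomial.coeff_zero_eq_eval_zero]
      exact Complex.ext (by simp) (by simp [hG0])
    rw [h2, ← Complex.ofReal_cpow h1.le, Complex.ofReal_re]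
    positivity
  have c1 : Continuous fun t => ‖G.eval (circlePt t)‖ ^ p :=
    (continuous_eval_circlePt G).norm.rpow_const fun _ => Or.inr hp0.le
  have c2 : Continuous fun t => (G.eval (circlePt t)).re ^ p :=
    (Complex.continuous_re.comp (continuous_eval_circlePt G)).rpow_const fun _ => Or.inr hp0.le
  have c3 : Continuous fun t => (G.eval (circlePt t) ^ (p : ℂ)).re :=
    Complex.continuous_re.comp hcont
  have key : circleNorm p (fun t => G.eval (circlePt t)) ^ p ≤
      A * circleNorm p (fun t => ((G.eval (circlePt t)).re : ℂ)) ^ p := by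
    rw [circleNorm_rpow hp0 (continuous_eval_circlePt G),
      circleNorm_rpow hp0 (continuous_re_eval_circlePt G)]
    have e1 : ∫ t, (G.eval (circlePt t) ^ (p : ℂ)).re ∂circleMeasure = (G.eval 0 ^ (p : ℂ)).re := by
      rw [← hmv]; exact integral_re (integrable_of_continuous hcont)
    have e2 : ∫ t, ‖G.eval (circlePt t)‖ ^ p ∂circleMeasure ≤
        ∫ t, (A * (G.eval (circlePt t)).re ^ p - B * (G.eval (circlePt t) ^ (p : ℂ)).re)
          ∂circleMeasure :=
      integral_mono (integrable_of_continuous c1)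
        (integrable_of_continuous ((continuous_const.mul c2).sub (continuous_const.mul c3)))
        fun t => h _ (hc.trans_le (hG t))
    rw [integral_sub ((integrable_of_continuous c2).const_mul A)
      ((integrable_of_continuous c3).const_mul B), integral_const_mul, integral_const_mul,
      e1] at e2
    have e3 : ∀ t, ‖(((G.eval (circlePt t)).re : ℝ) : ℂ)‖ ^ p = (G.eval (circlePt t)).re ^ p :=
      fun t => by rw [Complex.norm_real, Real.norm_of_nonneg (hc.le.trans (hG t))]
    simp_rw [e3]
    nlinarith
  have := Real.rpow_le_rpow (by have := circleNorm_nonneg p fun t => G.eval (circlePt t)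
                                positivity) key (by positivity : (0 : ℝ) ≤ 1 / p)
  rwa [Real.mul_rpow hA (by have := circleNorm_nonneg p
                              fun t => ((G.eval (circlePt t)).re : ℂ)
                            positivity),
    ← Real.rpow_mul (circleNorm_nonneg _ _), ← Real.rpow_mul (circleNorm_nonneg _ _),
    mul_one_div_cancel hp0.ne', Real.rpow_one, Real.rpow_one] at this

/-- On the circle $a+\bar b$ and $a+b$ have the same real part, and subtracting an imaginary
constant does not change it. -/
lemma exists_re_approx {φ : UnitAddCircle → ℝ} (hφ : Continuous φ) {ε : ℝ} (hε : 0 < ε) :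
    ∃ G : Polynomial ℂ, (G.coeff 0).im = 0 ∧ ∀ t, |φ t - (G.eval (circlePt t)).re| ≤ ε := by
  obtain ⟨a, b, hb, hab⟩ := exists_trig_approx (Complex.continuous_ofReal.comp hφ) hε
  refine ⟨a + b - Polynomial.C (Complex.I * (a.coeff 0).im), by simp [hb], fun t => ?_⟩
  refine le_trans (le_of_eq ?_) ((Complex.abs_re_le_norm _).trans (hab t))
  simp [trig]

/-- From $|R|^2=2(\operatorname{Re}R)^2-\operatorname{Re}R^2$, where the mean of
$\operatorname{Re}R^2$ is $R(0)^2\ge0$ as $R(0)$ is real. -/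
lemma circleNorm_two_le_of_re {R : Polynomial ℂ} (hR : (R.coeff 0).im = 0) {ε : ℝ} (hε : 0 ≤ ε)
    (h : ∀ t, |(R.eval (circlePt t)).re| ≤ ε) :
    circleNorm 2 (fun t => R.eval (circlePt t)) ≤ 2 * ε := by
  have hc := continuous_eval_circlePt R
  have h1 := circleNorm_rpow (p := 2) two_pos hc
  have hm : ∫ t, (R * R).eval (circlePt t) ∂circleMeasure = (R * R).coeff 0 :=
    integral_eval_circlePt _
  have hm' : 0 ≤ ∫ t, ((R * R).eval (circlePt t)).re ∂circleMeasure := by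
    have : ∫ t, ((R * R).eval (circlePt t)).re ∂circleMeasure = ((R * R).coeff 0).re := by
      rw [← hm]; exact integral_re (integrable_of_continuous (continuous_eval_circlePt _))
    rw [this, Polynomial.mul_coeff_zero, Complex.mul_re, hR]
    nlinarith [sq_nonneg (R.coeff 0).re]
  have h2 : ∫ t, ‖R.eval (circlePt t)‖ ^ (2 : ℝ) ∂circleMeasure ≤
      ∫ t, (2 * ε ^ 2 - ((R * R).eval (circlePt t)).re) ∂circleMeasure := by
    refine integral_mono (integrable_of_continuous (hc.norm.rpow_const fun _ => Or.inr zero_le_two))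
      (integrable_of_continuous (continuous_const.sub (Complex.continuous_re.comp
        (continuous_eval_circlePt _)))) fun t => ?_
    have h3 := sq_le_sq' (abs_le.1 (h t)).1 (abs_le.1 (h t)).2
    simp only [Real.rpow_two, Polynomial.eval_mul, Complex.mul_re, Complex.sq_norm,
      Complex.normSq_apply]
    nlinarith
  have ci : Integrable (fun t => ((R * R).eval (circlePt t)).re) circleMeasure :=
    (integrable_of_continuous (continuous_eval_circlePt (R * R))).re
  rw [integral_sub (integrable_of_continuous continuous_const) ci] at h2
  simp only [integral_const, probReal_univ, smul_eq_mul, one_mul] at h2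
  rw [Real.rpow_two] at h1
  have := circleNorm_nonneg 2 fun t => R.eval (circlePt t)
  nlinarith

/-- M. Riesz's inequality: the `L^p` norm of an analytic polynomial, real at the origin, is
controlled by that of its real part, for `1 < p ≤ 2`. -/
lemma exists_circleNorm_le_re {p : ℝ} (hp : 1 < p) (hp2 : p ≤ 2) :
    ∃ A : ℝ, 0 ≤ A ∧ ∀ G : Polynomial ℂ, (G.coeff 0).im = 0 →
      circleNorm p (fun t => G.eval (circlePt t)) ≤
        A * circleNorm p (fun t => ((G.eval (circlePt t)).re : ℂ)) := by
  obtain ⟨A, hA, h⟩ := exists_circleNorm_le_re_of_pos hp hp2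
  have hp0 : 0 < p := by linarith
  refine ⟨2 * A, by positivity, fun G hG0 => ?_⟩
  set u : UnitAddCircle → ℝ := fun t => (G.eval (circlePt t)).re with hu
  have hcu : Continuous u := Complex.continuous_re.comp (continuous_eval_circlePt G)
  set N := circleNorm p (fun t => ((u t : ℝ) : ℂ))
  -- Treats the positive or the negative part $v$ of $u$. The shift by $2\varepsilon$ and an
  -- approximation within $\varepsilon$ give a polynomial whose real part lies between $\varepsilon$
  -- and $|u|+3\varepsilon$, so the positive case applies.
  have half : ∀ (v : UnitAddCircle → ℝ), Continuous v → (∀ t, 0 ≤ v t) → (∀ t, v t ≤ |u t|) →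
      ∀ ε : ℝ, 0 < ε → ∃ G₁ : Polynomial ℂ, (G₁.coeff 0).im = 0 ∧
        (∀ t, |v t + 2 * ε - (G₁.eval (circlePt t)).re| ≤ ε) ∧
        circleNorm p (fun t => G₁.eval (circlePt t)) ≤ A * (N + 3 * ε) := by
    intro v hv hv0 hvu ε hε
    obtain ⟨G₁, hG1, hG2⟩ := exists_re_approx (φ := fun t => v t + 2 * ε)
      (hv.add continuous_const) hε
    refine ⟨G₁, hG1, hG2, (h G₁ ε hε (fun t => ?_) hG1).trans ?_⟩
    · have := (abs_le.1 (hG2 t)).2; linarith [hv0 t]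
    · gcongr
      have e1 : Continuous fun t => ((|u t| : ℝ) : ℂ) :=
        Complex.continuous_ofReal.comp hcu.abs
      refine (circleNorm_mono hp0 (v := fun t => ((|u t| : ℝ) : ℂ) + ((3 * ε : ℝ) : ℂ))
        (e1.add continuous_const) fun t => ?_).trans
        ((circleNorm_add_le hp.le e1 continuous_const).trans ?_)
      · rw [← Complex.ofReal_add, Complex.norm_real, Complex.norm_real, Real.norm_eq_abs,
          Real.norm_eq_abs]
        have := abs_le.1 (hG2 t)
        refine (abs_le.2 ⟨?_, ?_⟩).trans (le_abs_self _)
        · linarith [hv0 t, abs_nonneg (u t)]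
        · linarith [hvu t]
      · refine add_le_add (le_of_eq (circleNorm_congr fun t => by simp)) ?_
        refine circleNorm_le_of_bound hp0 fun t => ?_
        rw [Complex.norm_real, Real.norm_of_nonneg (by positivity)]
  have key : ∀ ε : ℝ, 0 < ε → circleNorm p (fun t => G.eval (circlePt t)) ≤
      2 * A * N + ε * (6 * A + 4) := by
    intro ε hε
    obtain ⟨G₁, h10, h11, h12⟩ := half (fun t => max (u t) 0) (hcu.max continuous_const)
      (fun t => le_max_right _ _) (fun t => max_le (le_abs_self _) (abs_nonneg _)) ε hε
    obtain ⟨G₂, h20, h21, h22⟩ := half (fun t => max (-u t) 0) (hcu.neg.max continuous_const)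
      (fun t => le_max_right _ _) (fun t => max_le (neg_le_abs _) (abs_nonneg _)) ε hε
    -- The shifts cancel in $G_1-G_2$, so $G-(G_1-G_2)$ has real part at most $2\varepsilon$. Its
    -- $L^2$ norm is then small, and dominates its $L^p$ norm because $p\le2$.
    have hR := circleNorm_two_le_of_re (R := G - (G₁ - G₂)) (by simp [hG0, h10, h20])
      (ε := 2 * ε) (by positivity) (fun t => by
        have e1 := abs_le.1 (h11 t)
        have e2 := abs_le.1 (h21 t)
        have e3 : u t = max (u t) 0 - max (-u t) 0 := by
          rcases le_total (u t) 0 with h | h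
          · rw [max_eq_right h, max_eq_left (by linarith)]; ring
          · rw [max_eq_left h, max_eq_right (by linarith)]; ring
        have e4 : (G.eval (circlePt t)).re = u t := rfl
        simp only [Polynomial.eval_sub, Complex.sub_re, e4]
        rw [abs_le]; constructor <;> linarith)
    have hR' := (circleNorm_le_of_exponent_le hp0 hp2
      (continuous_eval_circlePt (G - (G₁ - G₂)))).trans hR
    have s1 := circleNorm_add_le hp.le (continuous_eval_circlePt (G - (G₁ - G₂)))
      (continuous_eval_circlePt (G₁ - G₂))
    have s2 := circleNorm_sub_le hp.le (continuous_eval_circlePt G₁) (continuous_eval_circlePt G₂)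
    simp only [Polynomial.eval_sub, sub_add_cancel] at s1 hR' s2
    linarith
  refine le_of_forall_pos_le_add fun ε hε => ?_
  refine (key (ε / (6 * A + 4)) (by positivity)).trans (le_of_eq ?_)
  have : (6 * A + 4) ≠ 0 := by positivity
  field_simp

end

/-! ### The Riesz projection and truncation of frequencies, $1<p<\infty$ -/

section

lemma norm_integral_le_circleNorm {p : ℝ} (hp : 1 ≤ p) {u : UnitAddCircle → ℂ}
    (hu : Continuous u) : ‖∫ t, u t ∂circleMeasure‖ ≤ circleNorm p u := by
  have h1 := circleNorm_rpow one_pos hu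
  simp only [Real.rpow_one] at h1
  exact (norm_integral_le_integral_norm _).trans
    (h1 ▸ circleNorm_le_of_exponent_le one_pos hp hu)

lemma integral_eval_mul_eval_eq_zero (a b : Polynomial ℂ) (hb : b.coeff 0 = 0) :
    ∫ t, a.eval (circlePt t) * b.eval (circlePt t) ∂circleMeasure = 0 := by
  have := integral_eval_circlePt (a * b)
  simpa [Polynomial.mul_coeff_zero, hb] using this

/-- Conjugate analytic polynomials without constant term are orthogonal to analytic ones. Together
with `integral_eval_mul_conj_trig` this makes the map to the analytic part self-adjoint, so that
bounds pass to the conjugate exponent. -/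
lemma integral_trig_mul_conj (a b α : Polynomial ℂ) (hb : b.coeff 0 = 0) :
    ∫ t, trig a b t * conj (α.eval (circlePt t)) ∂circleMeasure =
      ∫ t, a.eval (circlePt t) * conj (α.eval (circlePt t)) ∂circleMeasure := by
  have c0 : Continuous fun t => conj (α.eval (circlePt t)) :=
    Complex.continuous_conj.comp (continuous_eval_circlePt α)
  have c1 : Continuous fun t => conj (b.eval (circlePt t)) :=
    Complex.continuous_conj.comp (continuous_eval_circlePt b)
  simp only [trig, add_mul]
  have i1 : Integrable (fun t => a.eval (circlePt t) * conj (α.eval (circlePt t))) circleMeasure :=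
    integrable_of_continuous ((continuous_eval_circlePt a).mul c0)
  have i2 : Integrable (fun t => conj (b.eval (circlePt t)) * conj (α.eval (circlePt t)))
    circleMeasure := integrable_of_continuous (c1.mul c0)
  rw [integral_add i1 i2]
  simp_rw [← map_mul]
  rw [integral_conj, mul_comm_integral_zero α b hb, map_zero, add_zero]
where
  mul_comm_integral_zero (α b : Polynomial ℂ) (hb : b.coeff 0 = 0) :
      ∫ t, b.eval (circlePt t) * α.eval (circlePt t) ∂circleMeasure = 0 := by
    simp_rw [mul_comm (Polynomial.eval _ b)]; exact integral_eval_mul_eval_eq_zero α b hb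

lemma integral_eval_mul_conj_trig (a α β : Polynomial ℂ) (hβ : β.coeff 0 = 0) :
    ∫ t, a.eval (circlePt t) * conj (trig α β t) ∂circleMeasure =
      ∫ t, a.eval (circlePt t) * conj (α.eval (circlePt t)) ∂circleMeasure := by
  have c0 : Continuous fun t => conj (α.eval (circlePt t)) :=
    Complex.continuous_conj.comp (continuous_eval_circlePt α)
  simp only [trig, map_add, Complex.conj_conj, mul_add]
  have i1 : Integrable (fun t => a.eval (circlePt t) * conj (α.eval (circlePt t))) circleMeasure :=
    integrable_of_continuous ((continuous_eval_circlePt a).mul c0)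
  have i2 : Integrable (fun t => a.eval (circlePt t) * β.eval (circlePt t)) circleMeasure :=
    integrable_of_continuous ((continuous_eval_circlePt a).mul (continuous_eval_circlePt β))
  rw [integral_add i1 i2, integral_eval_mul_eval_eq_zero a β hβ, add_zero]

/-- Once the constant is removed from $a$, the real parts of $a'+b$ and $-i(a'-b)$ are the real and
imaginary parts of $a'+\bar b$. The inequality for real parts bounds both polynomials, and $2a'$ is
$(a'+b)+(a'-b)$. Removing the constant also makes the values at the origin real. -/
lemma exists_circleNorm_le_trig_of_le_two {p : ℝ} (hp : 1 < p) (hp2 : p ≤ 2) :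
    ∃ A : ℝ, 0 ≤ A ∧ ∀ a b : Polynomial ℂ, b.coeff 0 = 0 →
      circleNorm p (fun t => a.eval (circlePt t)) ≤ A * circleNorm p (trig a b) := by
  obtain ⟨A, hA, h⟩ := exists_circleNorm_le_re hp hp2
  have hp0 : 0 < p := by linarith
  refine ⟨2 * A + 1, by positivity, fun a b hb => ?_⟩
  set N := circleNorm p (trig a b) with hN
  have hN0 : 0 ≤ N := circleNorm_nonneg _ _
  have hc0 : ‖a.coeff 0‖ ≤ N := by
    refine le_trans (le_of_eq ?_) (norm_integral_le_circleNorm hp.le (continuous_trig a b))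
    have := integral_trig_mul_conj a b 1 hb
    simp only [Polynomial.eval_one, map_one, mul_one, integral_eval_circlePt] at this
    rw [this]
  set a' := a - Polynomial.C (a.coeff 0) with ha'
  have hv : circleNorm p (fun t => trig a b t - a.coeff 0) ≤ 2 * N := by
    refine (circleNorm_sub_le hp.le (continuous_trig a b) continuous_const).trans ?_
    have := circleNorm_le_of_bound hp0 (u := fun _ : UnitAddCircle => a.coeff 0) fun _ => hc0
    linarith
  have hcv : Continuous fun t => trig a b t - a.coeff 0 :=
    (continuous_trig a b).sub continuous_const
  have h1 : circleNorm p (fun t => (a' + b).eval (circlePt t)) ≤ A * (2 * N) := by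
    refine (h (a' + b) (by simp [ha', hb])).trans ?_
    gcongr
    refine (circleNorm_mono hp0 hcv fun t => ?_).trans hv
    rw [Complex.norm_real]
    refine le_trans (le_of_eq ?_) (Complex.abs_re_le_norm _)
    simp [trig, ha']; congr 1; ring
  have h2 : circleNorm p (fun t => (a' - b).eval (circlePt t)) ≤ A * (2 * N) := by
    have e : ∀ t, ‖(a' - b).eval (circlePt t)‖ =
        ‖(Polynomial.C (-Complex.I) * (a' - b)).eval (circlePt t)‖ := fun t => by simp
    rw [circleNorm_congr e]
    refine (h _ (by simp [ha', hb])).trans ?_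
    gcongr
    refine (circleNorm_mono hp0 hcv fun t => ?_).trans hv
    rw [Complex.norm_real]
    refine le_trans (le_of_eq ?_) (Complex.abs_im_le_norm _)
    simp [trig, ha']; congr 1; ring
  have h3 : circleNorm p (fun t => 2 * a'.eval (circlePt t)) ≤ A * (2 * N) + A * (2 * N) := by
    refine le_trans (le_of_eq (circleNorm_congr fun t => ?_)) ((circleNorm_add_le hp.le
      (continuous_eval_circlePt (a' + b)) (continuous_eval_circlePt (a' - b))).trans
      (add_le_add h1 h2))
    congr 1; simp; ring
  rw [circleNorm_const_mul hp0, Complex.norm_ofNat] at h3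
  have h4 : circleNorm p (fun t => a.eval (circlePt t)) ≤
      circleNorm p (fun t => a'.eval (circlePt t)) + N := by
    have := circleNorm_le_of_bound hp0 (u := fun _ : UnitAddCircle => a.coeff 0) fun _ => hc0
    refine le_trans (le_of_eq (circleNorm_congr fun t => ?_)) ((circleNorm_add_le hp.le
      (continuous_eval_circlePt a') (continuous_const (y := a.coeff 0))).trans
      (add_le_add_right this _))
    congr 1; simp [ha']
  linarith

/-- M. Riesz's theorem for trigonometric polynomials: the analytic part is bounded in `L^p`. -/
lemma exists_circleNorm_le_trig {p : ℝ} (hp : 1 < p) :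
    ∃ A : ℝ, 0 ≤ A ∧ ∀ a b : Polynomial ℂ, b.coeff 0 = 0 →
      circleNorm p (fun t => a.eval (circlePt t)) ≤ A * circleNorm p (trig a b) := by
  rcases le_total p 2 with hp2 | hp2
  · exact exists_circleNorm_le_trig_of_le_two hp hp2
  have hpq := Real.HolderConjugate.conjExponent hp
  set q := p.conjExponent
  have hq2 : q ≤ 2 := by
    have := hpq.sub_one_mul_conj
    have := hpq.symm.pos
    nlinarith
  obtain ⟨A, hA, h⟩ := exists_circleNorm_le_trig_of_le_two hpq.symm.lt hq2
  refine ⟨A, hA, fun a b hb => ?_⟩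
  have hN := circleNorm_nonneg p (trig a b)
  refine circleNorm_le_of_forall_pairing hpq (continuous_eval_circlePt a) (by positivity)
    fun ψ hψ => pairing_le_of_forall_trig hpq.symm.lt.le (continuous_eval_circlePt a)
      (by positivity) (fun α β hβ => ?_) hψ
  -- The projection is moved from $a$ to the test function, whose exponent $q\le2$ is already
  -- covered.
  rw [integral_eval_mul_conj_trig a α β hβ, ← integral_trig_mul_conj a b α hb]
  refine (norm_integral_mul_conj_le hpq (continuous_trig a b)
    (continuous_eval_circlePt α)).trans ?_
  calc _ ≤ circleNorm p (trig a b) * (A * circleNorm q (trig α β)) := by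
        gcongr; exact h α β hβ
    _ = _ := by ring

/-- On the circle $\operatorname{Re}G$ is a trigonometric polynomial with analytic part
$a=(G+G(0))/2$, so $G=2a-G(0)$. This carries the inequality for real parts to every $p>1$. -/
lemma exists_circleNorm_eval_le_re {p : ℝ} (hp : 1 < p) :
    ∃ A : ℝ, 0 ≤ A ∧ ∀ G : Polynomial ℂ, (G.coeff 0).im = 0 →
      circleNorm p (fun t => G.eval (circlePt t)) ≤
        A * circleNorm p (fun t => ((G.eval (circlePt t)).re : ℂ)) := by
  obtain ⟨A, hA, h⟩ := exists_circleNorm_le_trig hp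
  have hp0 : 0 < p := by linarith
  refine ⟨2 * A + 1, by positivity, fun G hG => ?_⟩
  set a := Polynomial.C (1 / 2) * (G + Polynomial.C (G.coeff 0)) with ha
  set b := Polynomial.C (1 / 2) * (G - Polynomial.C (G.coeff 0)) with hb
  have hb0 : b.coeff 0 = 0 := by simp [hb]
  have hconj : conj (G.coeff 0) = G.coeff 0 := Complex.conj_eq_iff_im.2 hG
  have ht : trig a b = fun t => ((G.eval (circlePt t)).re : ℂ) := by
    ext t
    rw [Complex.re_eq_add_conj]
    simp [trig, ha, hb, hconj, map_ofNat]; ring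
  have h1 := h a b hb0
  rw [ht] at h1
  have h2 : ‖G.coeff 0‖ ≤ circleNorm p (fun t => ((G.eval (circlePt t)).re : ℂ)) := by
    have e := integral_trig_mul_conj a b 1 hb0
    simp only [Polynomial.eval_one, map_one, mul_one, integral_eval_circlePt] at e
    have e2 : a.coeff 0 = G.coeff 0 := by simp [ha]; ring
    rw [e2] at e
    rw [← e, ← ht]
    exact norm_integral_le_circleNorm hp.le (continuous_trig a b)
  have h3 : circleNorm p (fun t => G.eval (circlePt t)) ≤
      2 * circleNorm p (fun t => a.eval (circlePt t)) + ‖G.coeff 0‖ := by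
    have e1 := circleNorm_le_of_bound hp0 (u := fun _ : UnitAddCircle => G.coeff 0) fun _ => le_rfl
    have e2 := circleNorm_const_mul hp0 2 (fun t => a.eval (circlePt t))
    rw [Complex.norm_ofNat] at e2
    rw [← e2]
    refine le_trans (le_of_eq (circleNorm_congr fun t => ?_)) ((circleNorm_sub_le hp.le
      (continuous_const.mul (continuous_eval_circlePt a)) (continuous_const (y := G.coeff 0))).trans
      (add_le_add_right e1 _))
    congr 1; simp [ha]
  linarith

lemma continuous_sum_fourier (s : Finset ℤ) (c : ℤ → ℂ) :
    Continuous fun t : UnitAddCircle => ∑ k ∈ s, c k * fourier k t :=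
  continuous_finsetSum _ fun k _ => continuous_const.mul (fourier k).continuous

/-- Multiplication by the unimodular character of frequency $-M$ moves the cut to the origin, where
the truncation is the analytic part. -/
lemma exists_circleNorm_filter_le {p : ℝ} (hp : 1 < p) :
    ∃ A : ℝ, 0 ≤ A ∧ ∀ (s : Finset ℤ) (c : ℤ → ℂ) (M : ℤ),
      circleNorm p (fun t => ∑ k ∈ s with M ≤ k, c k * fourier k t) ≤
        A * circleNorm p (fun t => ∑ k ∈ s, c k * fourier k t) := by
  obtain ⟨A, hA, h⟩ := exists_circleNorm_le_trig hp
  refine ⟨A, hA, fun s c M => ?_⟩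
  set a : Polynomial ℂ := ∑ k ∈ s with M ≤ k, Polynomial.C (c k) * Polynomial.X ^ (k - M).toNat
    with ha
  set b : Polynomial ℂ :=
    ∑ k ∈ s with ¬ M ≤ k, Polynomial.C (conj (c k)) * Polynomial.X ^ (M - k).toNat with hb
  have hb0 : b.coeff 0 = 0 := by
    rw [hb, Polynomial.finsetSum_coeff]
    refine Finset.sum_eq_zero fun k hk => ?_
    rw [Finset.mem_filter] at hk
    rw [Polynomial.coeff_C_mul, Polynomial.coeff_X_pow, if_neg (by omega), mul_zero]
  have hae : ∀ t, a.eval (circlePt t) =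
      fourier (-M) t * ∑ k ∈ s with M ≤ k, c k * fourier k t := by
    intro t
    rw [ha, Polynomial.eval_finsetSum, Finset.mul_sum]
    refine Finset.sum_congr rfl fun k hk => ?_
    rw [Finset.mem_filter] at hk
    rw [Polynomial.eval_mul, Polynomial.eval_C, Polynomial.eval_pow, Polynomial.eval_X, circlePt_pow,
      Int.toNat_of_nonneg (by omega), sub_eq_add_neg, fourier_add]
    ring
  have hbe : ∀ t, conj (b.eval (circlePt t)) =
      fourier (-M) t * ∑ k ∈ s with ¬ M ≤ k, c k * fourier k t := by
    intro t
    rw [hb, Polynomial.eval_finsetSum, map_sum, Finset.mul_sum]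
    refine Finset.sum_congr rfl fun k hk => ?_
    rw [Finset.mem_filter] at hk
    rw [Polynomial.eval_mul, Polynomial.eval_C, Polynomial.eval_pow, Polynomial.eval_X, circlePt_pow,
      Int.toNat_of_nonneg (by omega), map_mul, Complex.conj_conj, ← fourier_neg, neg_sub,
      sub_eq_add_neg, fourier_add]
    ring
  have hfn : ∀ t : UnitAddCircle, ‖fourier (-M) t‖ = 1 := fun t => by
    rw [fourier_apply]; exact Circle.norm_coe _
  have e1 := h a b hb0
  rw [circleNorm_congr (u := fun t => a.eval (circlePt t))
    (v := fun t => ∑ k ∈ s with M ≤ k, c k * fourier k t) fun t => by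
      rw [hae, norm_mul, hfn, one_mul]] at e1
  rwa [circleNorm_congr (u := trig a b) (v := fun t => ∑ k ∈ s, c k * fourier k t) fun t => by
      rw [trig, hae, hbe, ← mul_add, Finset.sum_filter_add_sum_filter_not, norm_mul, hfn,
        one_mul]] at e1

lemma fourierCoeff_sum_fourier (s : Finset ℤ) (c : ℤ → ℂ) (n : ℤ) :
    fourierCoeff (T := 1) (fun t => ∑ k ∈ s, c k * fourier k t) n = if n ∈ s then c n else 0 := by
  simp only [fourierCoeff, smul_eq_mul, Finset.mul_sum]
  rw [integral_finsetSum]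
  · have : ∀ k ∈ s, ∫ t : UnitAddCircle, fourier (-n) t * (c k * fourier k t) ∂circleMeasure =
        if k = n then c k else 0 := by
      intro k _
      have e : ∀ t : UnitAddCircle, fourier (-n) t * (c k * fourier k t) =
          c k * fourier (-n + k) t := fun t => by rw [fourier_add]; ring
      simp_rw [e]
      rw [integral_const_mul, integral_fourier]
      by_cases h : k = n
      · simp [h]
      · rw [if_neg (by omega), if_neg h, mul_zero]
    rw [Finset.sum_congr rfl this, Finset.sum_ite_eq']
  · exact fun k _ => integrable_of_continuous
      ((fourier (-n)).continuous.mul (continuous_const.mul (fourier k).continuous))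

lemma exists_sum_fourier_approx {ψ : UnitAddCircle → ℂ} (hψ : Continuous ψ) {ε : ℝ} (hε : 0 < ε) :
    ∃ (s : Finset ℤ) (c : ℤ → ℂ), ∀ t, ‖ψ t - ∑ k ∈ s, c k * fourier k t‖ ≤ ε := by
  have h : (⟨ψ, hψ⟩ : C(UnitAddCircle, ℂ)) ∈
      (Submodule.span ℂ (range (fourier (T := 1)))).topologicalClosure := by
    rw [span_fourier_closure_eq_top]; trivial
  rw [← SetLike.mem_coe, Submodule.topologicalClosure_coe, Metric.mem_closure_iff] at h
  obtain ⟨x, hx, hd⟩ := h ε hε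
  rw [SetLike.mem_coe, Finsupp.mem_span_range_iff_exists_finsupp] at hx
  obtain ⟨c, rfl⟩ := hx
  refine ⟨c.support, c, fun t => ?_⟩
  refine le_trans (le_of_eq ?_) ((ContinuousMap.dist_apply_le_dist t).trans hd.le)
  rw [dist_eq_norm]
  congr 2
  rw [Finsupp.sum, ContinuousMap.sum_apply]
  rfl

/-- Frequency truncations to intervals are bounded on `L^p`, uniformly in the interval. -/
lemma exists_circleNorm_sum_fourierCoeff_le {p : ℝ} (hp : 1 < p) :
    ∃ A : ℝ, 0 ≤ A ∧ ∀ (ψ : UnitAddCircle → ℂ), Continuous ψ → ∀ M N : ℤ,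
      circleNorm p (fun t => ∑ k ∈ Finset.Ico M N, fourierCoeff ψ k * fourier k t) ≤
        A * circleNorm p ψ := by
  obtain ⟨A, hA, h⟩ := exists_circleNorm_filter_le hp
  have hp0 : 0 < p := by linarith
  refine ⟨2 * A, by positivity, fun ψ hψ M N => ?_⟩
  rcases le_total N M with hMN | hMN
  · rw [Finset.Ico_eq_empty_of_le hMN]
    refine (circleNorm_le_of_bound hp0 (B := 0) (by simp)).trans ?_
    have := circleNorm_nonneg p ψ
    positivity
  -- For trigonometric polynomials, the truncation to $[M,N)$ is the difference of two truncations
  -- to half-lines.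
  have htrig : ∀ (s : Finset ℤ) (c : ℤ → ℂ), circleNorm p (fun t => ∑ k ∈ Finset.Ico M N,
      (if k ∈ s then c k else 0) * fourier k t) ≤
      2 * A * circleNorm p (fun t => ∑ k ∈ s, c k * fourier k t) := by
    intro s c
    have e : ∀ t : UnitAddCircle, ∑ k ∈ Finset.Ico M N, (if k ∈ s then c k else 0) * fourier k t =
        (∑ k ∈ s with M ≤ k, c k * fourier k t) - ∑ k ∈ s with N ≤ k, c k * fourier k t := by
      intro t
      rw [eq_sub_iff_add_eq]
      have e1 : ∑ k ∈ Finset.Ico M N, (if k ∈ s then c k else 0) * fourier k t =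
          ∑ k ∈ s with M ≤ k ∧ k < N, c k * fourier k t := by
        simp_rw [ite_mul, zero_mul]
        rw [← Finset.sum_filter]
        refine Finset.sum_congr ?_ fun _ _ => rfl
        ext k; simp [and_comm]
      rw [e1, ← Finset.sum_union]
      · refine Finset.sum_congr ?_ fun _ _ => rfl
        ext k; simp only [Finset.mem_union, Finset.mem_filter]; grind
      · rw [Finset.disjoint_left]
        intro k hk hk'
        simp only [Finset.mem_filter] at hk hk'
        omega
    simp_rw [e]
    refine (circleNorm_sub_le hp.le (continuous_sum_fourier _ c)
      (continuous_sum_fourier _ c)).trans ?_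
    linarith [h s c M, h s c N]
  -- A uniform approximation within $\varepsilon$ changes each Fourier coefficient by at most
  -- $\varepsilon$, and only finitely many coefficients enter.
  have key : ∀ ε : ℝ, 0 < ε →
      circleNorm p (fun t => ∑ k ∈ Finset.Ico M N, fourierCoeff ψ k * fourier k t) ≤
        2 * A * circleNorm p ψ + ε * (2 * A + (Finset.Ico M N).card) := by
    intro ε hε
    obtain ⟨s, c, hsc⟩ := exists_sum_fourier_approx hψ hε
    have hcd : Continuous fun t => ψ t - ∑ k ∈ s, c k * fourier k t :=
      hψ.sub (continuous_sum_fourier s c)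
    have e1 : ∀ k, ‖fourierCoeff ψ k - if k ∈ s then c k else 0‖ ≤ ε := by
      intro k
      rw [← fourierCoeff_sum_fourier, fourierCoeff, fourierCoeff, ← integral_sub]
      · refine (norm_integral_le_of_norm_le_const (C := ε)
          (Filter.Eventually.of_forall fun t => ?_)).trans (by simp)
        rw [← smul_sub, norm_smul, fourier_apply, Circle.norm_coe, one_mul]
        exact hsc t
      · exact integrable_of_continuous ((fourier (-k)).continuous.smul hψ)
      · exact integrable_of_continuous ((fourier (-k)).continuous.smul (continuous_sum_fourier s c))
    have e2 : circleNorm p (fun t => ∑ k ∈ Finset.Ico M N,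
        (fourierCoeff ψ k - if k ∈ s then c k else 0) * fourier k t) ≤
          ε * (Finset.Ico M N).card := by
      refine circleNorm_le_of_bound hp0 fun t => (norm_sum_le _ _).trans ?_
      rw [mul_comm, ← nsmul_eq_mul]
      refine Finset.sum_le_card_nsmul _ _ _ fun k _ => ?_
      rw [norm_mul, fourier_apply, Circle.norm_coe, mul_one]
      exact e1 k
    have e3 : circleNorm p (fun t => ∑ k ∈ s, c k * fourier k t) ≤ circleNorm p ψ + ε := by
      have := circleNorm_sub_le hp.le hψ hcd
      simp only [sub_sub_cancel] at this
      exact this.trans (add_le_add_right (circleNorm_le_of_bound hp0 hsc) _)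
    have e4 := circleNorm_add_le hp.le
      (continuous_sum_fourier (Finset.Ico M N) fun k => fourierCoeff ψ k - if k ∈ s then c k else 0)
      (continuous_sum_fourier (Finset.Ico M N) fun k => if k ∈ s then c k else 0)
    simp only [← Finset.sum_add_distrib, ← add_mul, sub_add_cancel] at e4
    have e5 := htrig s c
    have e6 := mul_le_mul_of_nonneg_left e3 (by positivity : 0 ≤ 2 * A)
    linarith
  refine le_of_forall_pos_le_add fun ε hε => ?_
  refine (key (ε / (2 * A + (Finset.Ico M N).card + 1)) (by positivity)).trans ?_
  gcongr
  rw [div_mul_eq_mul_div]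
  exact div_le_of_le_mul₀ (by positivity) hε.le (by nlinarith)

end

/-! ### Blocks of Taylor coefficients: multipliers and radial means -/

section

/-- The polynomial `∑ a k X^k`, the sum being over `M ≤ k < N`. -/
def blockPoly (a : ℕ → ℂ) (M N : ℕ) : Polynomial ℂ :=
  ∑ k ∈ Finset.Ico M N, Polynomial.C (a k) * Polynomial.X ^ k

lemma eval_blockPoly (a : ℕ → ℂ) (M N : ℕ) (z : ℂ) :
    (blockPoly a M N).eval z = ∑ k ∈ Finset.Ico M N, a k * z ^ k := by
  simp [blockPoly, Polynomial.eval_finsetSum]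

lemma coeff_blockPoly (a : ℕ → ℂ) (M N k : ℕ) :
    (blockPoly a M N).coeff k = if k ∈ Finset.Ico M N then a k else 0 := by
  simp [blockPoly, Polynomial.finsetSum_coeff, Polynomial.coeff_X_pow]

lemma fourierCoeff_eval_circlePt (P : Polynomial ℂ) (k : ℕ) :
    fourierCoeff (T := 1) (fun t => P.eval (circlePt t)) k = P.coeff k := by
  rw [← integral_eval_mul_conj_pow, fourierCoeff]
  congr 1; ext t
  rw [circlePt_pow, ← fourier_neg, smul_eq_mul, mul_comm]

lemma exists_circleNorm_blockPoly_le {p : ℝ} (hp : 1 < p) :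
    ∃ A : ℝ, 0 ≤ A ∧ ∀ (ψ : UnitAddCircle → ℂ), Continuous ψ → ∀ M N : ℕ,
      circleNorm p (fun t => (blockPoly (fun k => fourierCoeff ψ k) M N).eval (circlePt t)) ≤
        A * circleNorm p ψ := by
  obtain ⟨A, hA, h⟩ := exists_circleNorm_sum_fourierCoeff_le hp
  refine ⟨A, hA, fun ψ hψ M N => ?_⟩
  convert h ψ hψ M N using 3 with t
  rw [eval_blockPoly]
  refine Finset.sum_nbij' (fun k => (k : ℤ)) Int.toNat (fun k hk => ?_) (fun k hk => ?_)
    (fun k _ => by simp) (fun k hk => ?_) (fun k _ => by simp)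
  all_goals rw [Finset.mem_Ico] at *; omega

/-- Summation by parts: the multiplied block is a combination of the tails of the block with the
nonnegative coefficients $\lambda_M$ and $\lambda_{j+1}-\lambda_j$, which add up to at most $L$.
Each tail is a truncation and costs a factor $A$. -/
lemma circleNorm_blockPoly_mul_le {p A : ℝ} (hp : 1 < p)
    (h : ∀ (ψ : UnitAddCircle → ℂ), Continuous ψ → ∀ M N : ℕ,
      circleNorm p (fun t => (blockPoly (fun k => fourierCoeff ψ k) M N).eval (circlePt t)) ≤
        A * circleNorm p ψ) (hA : 0 ≤ A)
    {lam : ℕ → ℝ} (hl : Monotone lam) (hl0 : ∀ k, 0 ≤ lam k) (a : ℕ → ℂ) {M N : ℕ} {L : ℝ}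
    (hL : ∀ k < N, lam k ≤ L) :
    circleNorm p (fun t => (blockPoly (fun k => lam k * a k) M N).eval (circlePt t)) ≤
      A * L * circleNorm p (fun t => (blockPoly a M N).eval (circlePt t)) := by
  have hp0 : 0 < p := by linarith
  rcases le_or_gt N M with hMN | hMN
  · simp only [eval_blockPoly, Finset.Ico_eq_empty_of_le hMN, Finset.sum_empty]
    have h0 : circleNorm p (fun _ => (0 : ℂ)) = 0 :=
      le_antisymm (circleNorm_le_of_bound hp0 (by simp)) (circleNorm_nonneg _ _)
    rw [h0, mul_zero]
  set K := A * circleNorm p (fun t => (blockPoly a M N).eval (circlePt t)) with hK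
  have hK0 : 0 ≤ K := mul_nonneg hA (circleNorm_nonneg _ _)
  have htail : ∀ j, M ≤ j →
      circleNorm p (fun t => (blockPoly a j N).eval (circlePt t)) ≤ K := by
    intro j hj
    have := h _ (continuous_eval_circlePt (blockPoly a M N)) j N
    refine le_trans (le_of_eq (circleNorm_congr fun t => ?_)) this
    simp only [eval_blockPoly]
    congr 1
    refine Finset.sum_congr rfl fun k hk => ?_
    have e := fourierCoeff_eval_circlePt (blockPoly a M N) k
    simp only [eval_blockPoly] at e
    rw [Finset.mem_Ico] at hk
    rw [e, coeff_blockPoly, if_pos (by rw [Finset.mem_Ico]; omega)]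
  -- The summation by parts runs downward from the last index; `d` is the distance from `j` to
  -- $N-1$.
  have key : ∀ d j, M ≤ j → j + d + 1 = N →
      circleNorm p (fun t => (blockPoly (fun k => lam k * a k) j N).eval (circlePt t) -
        lam j * (blockPoly a j N).eval (circlePt t)) ≤ (lam (N - 1) - lam j) * K := by
    intro d
    induction d with
    | zero =>
      intro j _ hj
      have e : ∀ t, (blockPoly (fun k => lam k * a k) j N).eval (circlePt t) -
        lam j * (blockPoly a j N).eval (circlePt t) = 0 := by
        intro t
        simp only [eval_blockPoly, ← hj, add_zero, Nat.Ico_succ_singleton, Finset.sum_singleton]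
        ring
      simp_rw [e]
      rw [show N - 1 = j by omega, sub_self, zero_mul]
      exact circleNorm_le_of_bound hp0 (by simp)
    | succ d ih =>
      intro j hMj hj
      have e : ∀ t, (blockPoly (fun k => lam k * a k) j N).eval (circlePt t) -
          lam j * (blockPoly a j N).eval (circlePt t) =
          ((blockPoly (fun k => lam k * a k) (j + 1) N).eval (circlePt t) -
            lam (j + 1) * (blockPoly a (j + 1) N).eval (circlePt t)) +
          ((lam (j + 1) - lam j : ℝ) : ℂ) * (blockPoly a (j + 1) N).eval (circlePt t) := by
        intro t
        simp only [eval_blockPoly]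
        rw [Finset.sum_eq_sum_Ico_succ_bot (by omega : j < N),
          Finset.sum_eq_sum_Ico_succ_bot (by omega : j < N)]
        push_cast; ring
      simp_rw [e]
      refine (circleNorm_add_le hp.le
        (u := fun t => (blockPoly (fun k => lam k * a k) (j + 1) N).eval (circlePt t) -
          lam (j + 1) * (blockPoly a (j + 1) N).eval (circlePt t))
        (v := fun t => ((lam (j + 1) - lam j : ℝ) : ℂ) *
          (blockPoly a (j + 1) N).eval (circlePt t)) ((continuous_eval_circlePt _).sub
        (continuous_const.mul (continuous_eval_circlePt _)))
        (continuous_const.mul (continuous_eval_circlePt _))).trans ?_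
      rw [circleNorm_const_mul hp0, Complex.norm_real,
        Real.norm_of_nonneg (sub_nonneg.2 (hl (Nat.le_succ j)))]
      have h1 := ih (j + 1) (by omega) (by omega)
      have h2 := mul_le_mul_of_nonneg_left (htail (j + 1) (by omega))
        (sub_nonneg.2 (hl (Nat.le_succ j)))
      linarith
  have h1 := key (N - M - 1) M le_rfl (by omega)
  have h2 : circleNorm p (fun t => lam M * (blockPoly a M N).eval (circlePt t)) ≤ lam M * K := by
    rw [circleNorm_const_mul hp0, Complex.norm_real, Real.norm_of_nonneg (hl0 M)]
    exact mul_le_mul_of_nonneg_left (htail M le_rfl) (hl0 M)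
  have h3 := circleNorm_add_le hp.le
    (u := fun t => (blockPoly (fun k => lam k * a k) M N).eval (circlePt t) -
      lam M * (blockPoly a M N).eval (circlePt t))
    (v := fun t => lam M * (blockPoly a M N).eval (circlePt t))
    ((continuous_eval_circlePt _).sub (continuous_const.mul (continuous_eval_circlePt _)))
    (continuous_const.mul (continuous_eval_circlePt _))
  simp only [sub_add_cancel] at h3
  have h4 := mul_le_mul_of_nonneg_right (hL (N - 1) (by omega)) hK0
  refine h3.trans ?_
  have : A * L * circleNorm p (fun t => (blockPoly a M N).eval (circlePt t)) = L * K := by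
    rw [hK]; ring
  rw [this]
  linarith

lemma circleNorm_comp_add {p : ℝ} (s : UnitAddCircle) (u : UnitAddCircle → ℂ) :
    circleNorm p (fun t => u (s + t)) = circleNorm p u := by
  rw [circleNorm, circleNorm, eLpNorm'_eq_lintegral_enorm, eLpNorm'_eq_lintegral_enorm,
    lintegral_add_left_eq_self (fun t => ‖u t‖ₑ ^ p) s]

/-- The pairing with a fixed $\psi$ is a polynomial in $w$, so the maximum principle bounds it by
its values on $|w|=1$. The exponents are left free: $n_k=k$ yields monotone means, $n_k=N-k$ the
reverse estimate. -/
lemma circleNorm_sum_pow_le {p : ℝ} (hp : 1 < p) (s : Finset ℕ) (n : ℕ → ℕ)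
    (c : ℕ → ℂ) {K : ℝ} (hK : 0 ≤ K)
    (h : ∀ w : ℂ, ‖w‖ = 1 → circleNorm p (fun t => ∑ k ∈ s, w ^ n k * c k * circlePt t ^ k) ≤ K)
    {w : ℂ} (hw : ‖w‖ ≤ 1) :
    circleNorm p (fun t => ∑ k ∈ s, w ^ n k * c k * circlePt t ^ k) ≤ K := by
  have hcont : ∀ w : ℂ, Continuous fun t => ∑ k ∈ s, w ^ n k * c k * circlePt t ^ k := fun w =>
    continuous_finsetSum _ fun k _ => continuous_const.mul (continuous_circlePt.pow k)
  have hpq := Real.HolderConjugate.conjExponent hp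
  refine circleNorm_le_of_forall_pairing hpq (hcont w) hK fun ψ hψ => ?_
  have hψ' : Continuous fun t => conj (ψ t) := Complex.continuous_conj.comp hψ
  have hint : ∀ w : ℂ, ∫ t, (∑ k ∈ s, w ^ n k * c k * circlePt t ^ k) * conj (ψ t) ∂circleMeasure =
      ∑ k ∈ s, w ^ n k * (c k * ∫ t, circlePt t ^ k * conj (ψ t) ∂circleMeasure) := by
    intro w
    simp_rw [Finset.sum_mul]
    rw [integral_finsetSum]
    · refine Finset.sum_congr rfl fun k _ => ?_
      rw [← integral_const_mul, ← integral_const_mul]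
      congr 1; ext t; ring
    · exact fun k _ => integrable_of_continuous
        ((continuous_const.mul (continuous_circlePt.pow k)).mul hψ')
  have hd : DiffContOnCl ℂ (fun w => ∑ k ∈ s, w ^ n k *
      (c k * ∫ t, circlePt t ^ k * conj (ψ t) ∂circleMeasure)) (Metric.ball 0 1) :=
    Differentiable.diffContOnCl (by fun_prop)
  rw [hint]
  refine Complex.norm_le_of_forall_mem_frontier_norm_le Metric.isBounded_ball hd
    (fun w hw => ?_) (z := w) ?_
  · rw [frontier_ball _ one_ne_zero, mem_sphere_zero_iff_norm] at hw
    rw [← hint]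
    refine (norm_integral_mul_conj_le hpq (hcont w) hψ).trans ?_
    exact mul_le_mul_of_nonneg_right (h w hw) (circleNorm_nonneg _ _)
  · rw [closure_ball _ one_ne_zero, mem_closedBall_zero_iff]; exact hw

/-- The `L^p` means of an analytic polynomial increase with the radius. -/
lemma circleNorm_eval_mul_le {p : ℝ} (hp : 1 < p) (P : Polynomial ℂ) {w : ℂ} (hw : ‖w‖ ≤ 1) :
    circleNorm p (fun t => P.eval (w * circlePt t)) ≤
      circleNorm p (fun t => P.eval (circlePt t)) := by
  have e : ∀ w : ℂ, (fun t => P.eval (w * circlePt t)) =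
      fun t => ∑ k ∈ P.support, w ^ k * P.coeff k * circlePt t ^ k := by
    intro w; ext t
    rw [Polynomial.eval_eq_sum, Polynomial.sum]
    refine Finset.sum_congr rfl fun k _ => ?_
    rw [mul_pow]; ring
  rw [e]
  refine circleNorm_sum_pow_le hp P.support (fun k => k) P.coeff (circleNorm_nonneg _ _)
    (fun w hw => ?_) hw
  obtain ⟨s, rfl⟩ := exists_circlePt hw
  rw [← e]
  simp_rw [← circlePt_add]
  rw [circleNorm_comp_add s fun t => P.eval (circlePt t)]

/-- The reverse estimate for polynomials of bounded degree. -/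
lemma pow_mul_circleNorm_blockPoly_le {p : ℝ} (hp : 1 < p) (a : ℕ → ℂ) (M N : ℕ) {r : ℝ}
    (hr0 : 0 ≤ r) (hr : r ≤ 1) :
    r ^ N * circleNorm p (fun t => (blockPoly a M N).eval (circlePt t)) ≤
      circleNorm p (fun t => (blockPoly a M N).eval (r * circlePt t)) := by
  -- With exponents $N-k$ and coefficients $r^ka_k$, the value at $w=r$ is $r^N$ times the block on
  -- the unit circle, while for $|w|=1$ it is, up to a unimodular factor, a rotation of the block on
  -- the circle of radius $r$.
  have h := circleNorm_sum_pow_le hp (Finset.Ico M N) (fun k => N - k)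
    (fun k => r ^ k * a k) (circleNorm_nonneg p fun t => (blockPoly a M N).eval (r * circlePt t))
    (fun w hw => ?_) (w := r) (by rwa [Complex.norm_real, Real.norm_of_nonneg hr0])
  · refine le_trans (le_of_eq ?_) h
    rw [← Real.norm_of_nonneg (pow_nonneg hr0 N), ← Complex.norm_real,
      ← circleNorm_const_mul (by linarith)]
    congr 1; ext t
    rw [eval_blockPoly, Finset.mul_sum]
    refine Finset.sum_congr rfl fun k hk => ?_
    rw [Finset.mem_Ico] at hk
    rw [Complex.ofReal_pow, ← mul_assoc ((r : ℂ) ^ (N - k)), ← pow_add,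
      Nat.sub_add_cancel hk.2.le]
    ring
  · have hw0 : w ≠ 0 := by rintro rfl; simp at hw
    obtain ⟨s, hs⟩ := exists_circlePt (z := w⁻¹) (by rw [norm_inv, hw, inv_one])
    rw [← circleNorm_comp_add s fun t => (blockPoly a M N).eval (r * circlePt t)]
    refine le_of_eq (circleNorm_congr fun t => ?_)
    have : ∑ k ∈ Finset.Ico M N, w ^ (N - k) * (r ^ k * a k) * circlePt t ^ k =
        w ^ N * (blockPoly a M N).eval (r * circlePt (s + t)) := by
      rw [eval_blockPoly, Finset.mul_sum]
      refine Finset.sum_congr rfl fun k hk => ?_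
      rw [Finset.mem_Ico] at hk
      rw [circlePt_add, hs, mul_pow, mul_pow, inv_pow, pow_sub₀ _ hw0 hk.2.le]
      ring
    rw [this, norm_mul, norm_pow, hw, one_pow, one_mul]

end

/-! ### Duality on a block and approximate factorization of polynomials -/

section

/-- The norm of a block of frequencies is attained, up to a constant, on the same block. -/
lemma exists_dual_block {p q : ℝ} (hpq : p.HolderConjugate q) :
    ∃ A : ℝ, 0 ≤ A ∧ ∀ (a : ℕ → ℂ) (M N : ℕ), ∃ h : ℕ → ℂ,
      ∑ k ∈ Finset.Ico M N, a k * conj (h k) =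
        ((circleNorm p (fun t => (blockPoly a M N).eval (circlePt t)) ^ p : ℝ) : ℂ) ∧
      circleNorm q (fun t => (blockPoly h M N).eval (circlePt t)) ≤
        A * circleNorm p (fun t => (blockPoly a M N).eval (circlePt t)) ^ (p - 1) := by
  obtain ⟨A, hA, hA'⟩ := exists_circleNorm_blockPoly_le hpq.symm.lt
  refine ⟨A, hA, fun a M N => ?_⟩
  have hw := continuous_eval_circlePt (blockPoly a M N)
  set w := fun t => (blockPoly a M N).eval (circlePt t) with hwd
  have hψ : Continuous fun t => dualElt p (w t) := (continuous_dualElt hpq.lt).comp hw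
  have hψ' : Continuous fun t => conj (dualElt p (w t)) := Complex.continuous_conj.comp hψ
  -- The Fourier coefficients of the extremal function $|w|^{p-2}w$. Only those in the block meet
  -- $w$, so cutting down to the block keeps the pairing and costs a factor $A$.
  refine ⟨fun k => fourierCoeff (fun t => dualElt p (w t)) k, ?_, ?_⟩
  · rw [← integral_mul_conj_dualElt hpq.lt hw]
    simp only [hwd, eval_blockPoly, Finset.sum_mul]
    simp only [eval_blockPoly, hwd] at hψ'
    rw [integral_finsetSum]
    · refine Finset.sum_congr rfl fun k _ => ?_
      rw [fourierCoeff, ← integral_conj, ← integral_const_mul]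
      congr 1; ext t
      rw [smul_eq_mul, map_mul, circlePt_pow, fourier_neg, Complex.conj_conj]
      ring
    · exact fun k _ => integrable_of_continuous
        ((continuous_const.mul (continuous_circlePt.pow k)).mul hψ')
  · rw [← circleNorm_dualElt hpq hw]
    exact hA' _ hψ M N

lemma circleNorm_le_zero_imp {p : ℝ} (hp : 1 < p) {Q : Polynomial ℂ}
    (h : circleNorm p (fun t => Q.eval (circlePt t)) ≤ 0) : Q = 0 := by
  ext k
  rw [← integral_eval_mul_conj_pow, Polynomial.coeff_zero, ← norm_le_zero_iff]
  refine (norm_integral_mul_conj_le (Real.HolderConjugate.conjExponent hp)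
    (continuous_eval_circlePt Q) (continuous_circlePt.pow k)).trans ?_
  exact mul_nonpos_of_nonpos_of_nonneg h (circleNorm_nonneg _ _)

lemma circleNorm_le_of_norm_rpow_le {p s x : ℝ} (hp : 0 < p) (hs : 0 < s) (hx : x * p = s)
    {u v : UnitAddCircle → ℂ} (hu : Continuous u) (hv : Continuous v)
    (h : ∀ t, ‖u t‖ ≤ ‖v t‖ ^ x) : circleNorm p u ≤ circleNorm s v ^ (s / p) := by
  have h1 : circleNorm p u ^ p ≤ circleNorm s v ^ s := by
    rw [circleNorm_rpow hp hu, circleNorm_rpow hs hv]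
    refine integral_mono (integrable_of_continuous (hu.norm.rpow_const fun _ => Or.inr hp.le))
      (integrable_of_continuous (hv.norm.rpow_const fun _ => Or.inr hs.le)) fun t => ?_
    refine (Real.rpow_le_rpow (norm_nonneg _) (h t) hp.le).trans (le_of_eq ?_)
    rw [← Real.rpow_mul (norm_nonneg _), hx]
  have h2 := Real.rpow_le_rpow (Real.rpow_nonneg (circleNorm_nonneg _ _) _) h1
    (by positivity : (0 : ℝ) ≤ 1 / p)
  rwa [← Real.rpow_mul (circleNorm_nonneg _ _), ← Real.rpow_mul (circleNorm_nonneg _ _),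
    mul_one_div_cancel hp.ne', Real.rpow_one, mul_one_div] at h2

lemma norm_mul_sub_mul_le {a b c d : ℂ} {B η : ℝ} (ha : ‖a‖ ≤ B) (hb : ‖b‖ ≤ B) (hη1 : η ≤ 1)
    (hac : ‖a - c‖ ≤ η) (hbd : ‖b - d‖ ≤ η) : ‖a * b - c * d‖ ≤ (2 * B + 1) * η := by
  have hη : 0 ≤ η := (norm_nonneg _).trans hac
  have hd : ‖d‖ ≤ B + 1 := by
    have := norm_sub_le b (b - d)
    rw [sub_sub_cancel] at this
    linarith
  have e : a * b - c * d = a * (b - d) + (a - c) * d := by ring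
  rw [e]
  refine (norm_add_le _ _).trans ?_
  rw [norm_mul, norm_mul]
  have h1 := mul_le_mul ha hbd (norm_nonneg _) ((norm_nonneg _).trans ha)
  have h2 := mul_le_mul hac hd (norm_nonneg _) hη
  linarith

/-- Approximate factorization of polynomials with control of the norms of the factors. -/
lemma exists_approx_factor {s p q : ℝ} (hs : 1 < s) (hp : 1 < p) (hq : 1 < q)
    (h : 1 / p + 1 / q = 1 / s) :
    ∃ C : ℝ, 0 ≤ C ∧ ∀ (Q : Polynomial ℂ) (ε : ℝ), 0 < ε → ∃ a b : Polynomial ℂ,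
      circleNorm p (fun t => a.eval (circlePt t)) ≤
        C * circleNorm s (fun t => Q.eval (circlePt t)) ^ (s / p) ∧
      circleNorm q (fun t => b.eval (circlePt t)) ≤
        C * circleNorm s (fun t => Q.eval (circlePt t)) ^ (s / q) ∧
      ∀ z : ℂ, ‖z‖ ≤ 1 → ‖Q.eval z - a.eval z * b.eval z‖ ≤ ε := by
  obtain ⟨A, hA, hAG⟩ := exists_circleNorm_eval_le_re hs
  have hs0 : 0 < s := by linarith
  have hp0 : 0 < p := by linarith
  have hq0 : 0 < q := by linarith
  set C := max ((4 * A) ^ (s / p) + 1) ((4 * A) ^ (s / q) + 1) with hC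
  have hC0 : 0 ≤ C := le_max_of_le_left (by positivity)
  refine ⟨C, hC0, fun Q ε hε => ?_⟩
  set n := circleNorm s (fun t => Q.eval (circlePt t)) with hn
  rcases le_or_gt n 0 with hn0 | hn0
  · have hQ : Q = 0 := circleNorm_le_zero_imp hs hn0
    have hn' : 0 ≤ n := circleNorm_nonneg _ _
    refine ⟨0, 0, ?_, ?_, fun z _ => by simp [hQ, hε.le]⟩
    · exact (circleNorm_le_of_bound hp0 (B := 0) (by simp)).trans (by positivity)
    · exact (circleNorm_le_of_bound hq0 (B := 0) (by simp)).trans (by positivity)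
  -- An analytic majorant of $Q$ replaces the division by zeros: $\operatorname{Re}G$ lies between
  -- $|Q|+n$ and $|Q|+3n$ on the circle. Hence $|Q|\le|G|$ there, powers of $G$ are analytic near
  -- the closed disc, and M. Riesz's inequality bounds the norm of $G$ by a multiple of $n$.
  obtain ⟨G, hG0, hG⟩ := exists_re_approx (φ := fun t => ‖Q.eval (circlePt t)‖ + 2 * n)
    ((continuous_eval_circlePt Q).norm.add continuous_const) hn0
  have hGre : ∀ t, ‖Q.eval (circlePt t)‖ + n ≤ (G.eval (circlePt t)).re := fun t => by
    have := (abs_le.1 (hG t)).2; linarith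
  have hGn : ∀ t, n ≤ (G.eval (circlePt t)).re := fun t => by
    linarith [hGre t, norm_nonneg (Q.eval (circlePt t))]
  have hQG : ∀ t, ‖Q.eval (circlePt t)‖ ≤ ‖G.eval (circlePt t)‖ := fun t => by
    have := Complex.re_le_norm (G.eval (circlePt t))
    linarith [hGre t]
  have hGpos : ∀ t, 0 < ‖G.eval (circlePt t)‖ := fun t => by
    have := Complex.re_le_norm (G.eval (circlePt t))
    linarith [hGn t]
  have hGnorm : circleNorm s (fun t => G.eval (circlePt t)) ≤ 4 * A * n := by
    refine (hAG G hG0).trans ?_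
    rw [mul_comm 4 A, mul_assoc]
    gcongr
    have c1 : Continuous fun t => ((‖Q.eval (circlePt t)‖ : ℝ) : ℂ) :=
      Complex.continuous_ofReal.comp (continuous_eval_circlePt Q).norm
    have e := circleNorm_add_le hs.le c1 (continuous_const (y := ((3 * n : ℝ) : ℂ)))
    have e1 : circleNorm s (fun t => ((‖Q.eval (circlePt t)‖ : ℝ) : ℂ)) = n :=
      circleNorm_congr fun t => by simp
    have e2 : circleNorm s (fun _ => ((3 * n : ℝ) : ℂ)) ≤ 3 * n :=
      circleNorm_le_of_bound hs0 fun t => by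
        rw [Complex.norm_real, Real.norm_of_nonneg (by positivity)]
    rw [e1] at e
    refine (circleNorm_mono hs0 (c1.add continuous_const) (v := fun t =>
      ((‖Q.eval (circlePt t)‖ : ℝ) : ℂ) + ((3 * n : ℝ) : ℂ)) fun t => ?_).trans (by linarith)
    rw [← Complex.ofReal_add, Complex.norm_real, Complex.norm_real,
      Real.norm_of_nonneg (hn0.le.trans (hGn t)), Real.norm_of_nonneg (by positivity)]
    have := (abs_le.1 (hG t)).1; linarith
  have hU := closedBall_subset_re_eval_pos hn0 hGn
  set x := s / p with hx
  set y := s / q with hy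
  have hxy : x + y = 1 := by
    have : s * (1 / p + 1 / q) = 1 := by rw [h]; field_simp
    rw [← this, hx, hy]; ring
  have hx0 : 0 < x := by positivity
  have hy0 : 0 < y := by positivity
  -- Since $x+y=1$, the product of $G^x$ and $QG^{y-1}$ is $Q$. On the circle the factors are at
  -- most $|G|^{s/p}$ and $|G|^{s/q}$, the second by $|Q|\le|G|$.
  set F₁ : ℂ → ℂ := fun z => G.eval z ^ (x : ℂ) with hF1
  set F₂ : ℂ → ℂ := fun z => Q.eval z * G.eval z ^ ((y - 1 : ℝ) : ℂ) with hF2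
  have hd1 : DifferentiableOn ℂ F₁ {z | 0 < (G.eval z).re} := differentiableOn_eval_cpow G _
  have hd2 : DifferentiableOn ℂ F₂ {z | 0 < (G.eval z).re} :=
    Q.differentiable.differentiableOn.mul (differentiableOn_eval_cpow G _)
  have hprod : ∀ z : ℂ, ‖z‖ ≤ 1 → F₁ z * F₂ z = Q.eval z := by
    intro z hz
    have hGz : G.eval z ≠ 0 := by
      intro h0
      have : 0 < (G.eval z).re := hU (by simpa using hz)
      simp [h0] at this
    have e : (x : ℂ) + ((y - 1 : ℝ) : ℂ) = 0 := by
      rw [← Complex.ofReal_add, show x + (y - 1) = 0 by linarith, Complex.ofReal_zero]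
    calc F₁ z * F₂ z = Q.eval z * (G.eval z ^ (x : ℂ) * G.eval z ^ ((y - 1 : ℝ) : ℂ)) := by
          simp only [hF1, hF2]; ring
      _ = Q.eval z := by rw [← Complex.cpow_add _ _ hGz, e, Complex.cpow_zero, mul_one]
  have hc1 : Continuous fun t => F₁ (circlePt t) :=
    hd1.continuousOn.comp_continuous continuous_circlePt fun t => hn0.trans_le (hGn t)
  have hc2 : Continuous fun t => F₂ (circlePt t) :=
    hd2.continuousOn.comp_continuous continuous_circlePt fun t => hn0.trans_le (hGn t)
  have hcpow : ∀ t (c : ℝ), ‖G.eval (circlePt t) ^ (c : ℂ)‖ ≤ ‖G.eval (circlePt t)‖ ^ c := by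
    intro t c
    refine (Complex.norm_cpow_le _ _).trans ?_
    simp
  have hN1 : circleNorm p (fun t => F₁ (circlePt t)) ≤ (4 * A) ^ x * n ^ x := by
    refine (circleNorm_le_of_norm_rpow_le hp0 hs0 (x := x) (by rw [hx]; field_simp) hc1
      (continuous_eval_circlePt G) fun t => hcpow t x).trans ?_
    rw [← Real.mul_rpow (by positivity) hn0.le]
    exact Real.rpow_le_rpow (circleNorm_nonneg _ _) hGnorm hx0.le
  have hN2 : circleNorm q (fun t => F₂ (circlePt t)) ≤ (4 * A) ^ y * n ^ y := by
    refine (circleNorm_le_of_norm_rpow_le hq0 hs0 (x := y) (by rw [hy]; field_simp) hc2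
      (continuous_eval_circlePt G) fun t => ?_).trans ?_
    · simp only [hF2]
      rw [norm_mul]
      refine (mul_le_mul (hQG t) (hcpow t (y - 1)) (norm_nonneg _) (norm_nonneg _)).trans ?_
      rw [mul_comm, ← Real.rpow_add_one (hGpos t).ne', sub_add_cancel]
    · rw [← Real.mul_rpow (by positivity) hn0.le]
      exact Real.rpow_le_rpow (circleNorm_nonneg _ _) hGnorm hy0.le
  obtain ⟨B₁, hB1⟩ := (isCompact_closedBall (0 : ℂ) 1).exists_bound_of_continuousOn
    (hd1.continuousOn.mono hU)
  obtain ⟨B₂, hB2⟩ := (isCompact_closedBall (0 : ℂ) 1).exists_bound_of_continuousOn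
    (hd2.continuousOn.mono hU)
  set B := max (max B₁ B₂) 0
  have hB0 : 0 ≤ B := le_max_right _ _
  -- The first two bounds make the error of the product at most $\varepsilon$; the bounds by $n^x$
  -- and $n^y$ let the norms of the approximants absorb $\eta$, which is the $+1$ in the constant
  -- $C$.
  set η := min (min 1 (ε / (2 * B + 1))) (min (n ^ x) (n ^ y)) with hη
  have hη0 : 0 < η := by rw [hη]; positivity
  obtain ⟨a, ha⟩ := exists_polynomial_approx (isOpen_re_eval_pos G) hU hd1 hη0
  obtain ⟨b, hb⟩ := exists_polynomial_approx (isOpen_re_eval_pos G) hU hd2 hη0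
  have hclose : ∀ (r : ℝ), 1 < r → ∀ (F : ℂ → ℂ) (P : Polynomial ℂ),
      Continuous (fun t => F (circlePt t)) → (∀ z : ℂ, ‖z‖ ≤ 1 → ‖F z - P.eval z‖ ≤ η) →
      circleNorm r (fun t => P.eval (circlePt t)) ≤ circleNorm r (fun t => F (circlePt t)) + η := by
    intro r hr F P hF hFP
    have := circleNorm_sub_le hr.le hF (v := fun t => F (circlePt t) - P.eval (circlePt t))
      (hF.sub (continuous_eval_circlePt P))
    simp only [sub_sub_cancel] at this
    exact this.trans (add_le_add_right (circleNorm_le_of_bound (by linarith)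
      fun t => hFP _ (by simp)) _)
  refine ⟨a, b, ?_, ?_, fun z hz => ?_⟩
  · refine (hclose p hp F₁ a hc1 ha).trans ?_
    have h1 : η ≤ n ^ x := (min_le_right _ _).trans (min_le_left _ _)
    have h2 : ((4 * A) ^ x + 1) * n ^ x ≤ C * n ^ x := by gcongr; exact le_max_left _ _
    linarith
  · refine (hclose q hq F₂ b hc2 hb).trans ?_
    have h1 : η ≤ n ^ y := (min_le_right _ _).trans (min_le_right _ _)
    have h2 : ((4 * A) ^ y + 1) * n ^ y ≤ C * n ^ y := by gcongr; exact le_max_right _ _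
    linarith
  · rw [← hprod z hz]
    have hz' : z ∈ Metric.closedBall (0 : ℂ) 1 := by simpa using hz
    refine (norm_mul_sub_mul_le (B := B) ((hB1 z hz').trans ((le_max_left _ _).trans (le_max_left _ _)))
      ((hB2 z hz').trans ((le_max_right _ _).trans (le_max_left _ _)))
      ((min_le_left _ _).trans (min_le_left _ _)) (ha z hz) (hb z hz)).trans ?_
    have h1 : η ≤ ε / (2 * B + 1) := (min_le_left _ _).trans (min_le_right _ _)
    rw [le_div_iff₀ (by positivity)] at h1
    linarith

end

/-! ### Radial measures with doubling moments, and the frequencies of the blocks -/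

section

/-- The moments of a measure with respect to the distance from the origin. -/
def moment (m : Measure ℂ) (k : ℕ) : ℝ := ∫ z, ‖z‖ ^ k ∂m

/-- Nonzero finite rotation invariant measures on the disc with doubling moments. -/
structure IsRadialDoubling (m : Measure ℂ) : Prop where
  finite : IsFiniteMeasure m
  ae_mem : ∀ᵐ z ∂m, z ∈ unitDisc
  rot : ∀ t, MeasurePreserving (fun z => circlePt t * z) m m
  pos : m univ ≠ 0
  doubling : ∃ C : ℝ, ∀ k, moment m k ≤ C * moment m (2 * k + 1)

namespace IsRadialDoubling

variable {m : Measure ℂ}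

lemma ae_norm_lt (hm : IsRadialDoubling m) : ∀ᵐ z ∂m, ‖z‖ < 1 := by
  filter_upwards [hm.ae_mem] with z hz
  simpa [unitDisc] using hz

lemma integrable_of_bound (hm : IsRadialDoubling m) {E : Type*} [NormedAddCommGroup E] {g : ℂ → E}
    (hg : AEStronglyMeasurable g m) (B : ℝ) (h : ∀ z, ‖z‖ < 1 → ‖g z‖ ≤ B) : Integrable g m := by
  have := hm.finite
  exact Integrable.of_bound hg B (hm.ae_norm_lt.mono h)

lemma integrable_norm_pow (hm : IsRadialDoubling m) (k : ℕ) :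
    Integrable (fun z : ℂ => ‖z‖ ^ k) m := by
  refine hm.integrable_of_bound (continuous_norm.pow k).aestronglyMeasurable 1 fun z hz => ?_
  rw [norm_pow, norm_norm]
  exact pow_le_one₀ (norm_nonneg _) hz.le

lemma moment_nonneg (k : ℕ) : 0 ≤ moment m k := integral_nonneg fun _ => by positivity

lemma moment_antitone (hm : IsRadialDoubling m) : Antitone (moment m) := fun i j hij =>
  integral_mono_ae (hm.integrable_norm_pow j) (hm.integrable_norm_pow i) <|
    hm.ae_norm_lt.mono fun _ hz => pow_le_pow_of_le_one (norm_nonneg _) hz.le hij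

lemma moment_zero_pos (hm : IsRadialDoubling m) : 0 < moment m 0 := by
  have := hm.finite
  simp only [moment, pow_zero, integral_const, smul_eq_mul, mul_one]
  exact ENNReal.toReal_pos hm.pos (measure_ne_top _ _)

lemma exists_doubling (hm : IsRadialDoubling m) :
    ∃ C : ℝ, 1 ≤ C ∧ ∀ k, moment m k ≤ C * moment m (2 * k + 1) := by
  obtain ⟨C, hC⟩ := hm.doubling
  refine ⟨max C 1, le_max_right _ _, fun k => (hC k).trans ?_⟩
  exact mul_le_mul_of_nonneg_right (le_max_left _ _) (moment_nonneg _)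

lemma moment_le_pow_mul (hm : IsRadialDoubling m) {C : ℝ} (hC1 : 1 ≤ C)
    (hC : ∀ k, moment m k ≤ C * moment m (2 * k + 1)) (k j : ℕ) :
    moment m k ≤ C ^ j * moment m (2 ^ j * k) := by
  induction j with
  | zero => simp
  | succ j ih =>
    refine ih.trans ?_
    rw [pow_succ, mul_assoc]
    refine mul_le_mul_of_nonneg_left ((hC _).trans ?_) (by positivity)
    exact mul_le_mul_of_nonneg_left (hm.moment_antitone (by rw [pow_succ]; linarith))
      (by positivity)

lemma moment_pos (hm : IsRadialDoubling m) (k : ℕ) : 0 < moment m k := by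
  obtain ⟨C, hC1, hC⟩ := hm.exists_doubling
  induction k with
  | zero => exact hm.moment_zero_pos
  | succ k ih =>
    have h1 := hC k
    have h2 : moment m (2 * k + 1) ≤ moment m (k + 1) := hm.moment_antitone (by omega)
    by_contra h
    nlinarith

lemma tendsto_moment (hm : IsRadialDoubling m) :
    Filter.Tendsto (moment m) Filter.atTop (nhds 0) := by
  have := hm.finite
  have h := tendsto_integral_of_dominated_convergence (μ := m) (F := fun k (z : ℂ) => ‖z‖ ^ k)
    (f := fun _ => 0) (fun _ => 1) (fun k => (continuous_norm.pow k).aestronglyMeasurable)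
    (integrable_const _) (fun k => ?_) ?_
  · rwa [integral_zero] at h
  · filter_upwards [hm.ae_norm_lt] with z hz
    rw [norm_pow, norm_norm]
    exact pow_le_one₀ (norm_nonneg _) hz.le
  · filter_upwards [hm.ae_norm_lt] with z hz
    exact tendsto_pow_atTop_nhds_zero_of_lt_one (norm_nonneg _) hz

end IsRadialDoubling

/-- A sequence of frequencies along which the moments decay geometrically. -/
structure BlockData (m : Measure ℂ) (P : ℕ) where
  K : ℝ
  N : ℕ → ℕ
  c : ℝ
  c_pos : 0 < c
  N_zero : N 0 = 0
  strictMono : StrictMono N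
  two_pow_le : 2 ^ P ≤ K
  half : ∀ n j, N n ≤ 2 * j + 1 → moment m j ≤ c * K⁻¹ ^ n
  gap : ∀ n, K⁻¹ ^ n ≤ c * (moment m (P * N (n + 1) + N (n + 1)) - moment m (N (n + 2)))
  lower : ∀ n k, k < N (n + 1) → K⁻¹ ^ n ≤ c * moment m (2 * k)

lemma BlockData.K_pos {m : Measure ℂ} {P : ℕ} (D : BlockData m P) : 0 < D.K :=
  lt_of_lt_of_le (by positivity) D.two_pow_le

/-- $N_n$ is the first index at which the moment is at most $vK^{-n}$, where $v$ is the total mass.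
By doubling the moment at $N_n$ is also at least a multiple of $K^{-n}$, and remains so when the
index is multiplied by a constant. The field `half` serves synthesis with vanishing of order about
$N_n/2$, `gap` gives each block its own annulus in the analysis, and `lower` bounds the multipliers
in the duality. -/
lemma IsRadialDoubling.nonempty_blockData {m : Measure ℂ} (hm : IsRadialDoubling m) (P : ℕ) :
    Nonempty (BlockData m P) := by
  obtain ⟨C, hC1, hC⟩ := hm.exists_doubling
  have hC0 : 0 < C := by linarith
  have hv0 := hm.moment_zero_pos
  set v := moment m 0 with hv
  -- The bound $2^P$ is for Hardy's inequality. The bound $2C^{P+1}$ makes the moment at $N_{n+2}$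
  -- at most half of the lower bound for the moment at $(P+1)N_{n+1}$.
  set K : ℝ := max (2 ^ P) (2 * C ^ (P + 1)) with hK
  have hK1 : 2 * C ^ (P + 1) ≤ K := le_max_right _ _
  have hCP : C ≤ C ^ (P + 1) := le_self_pow₀ hC1 (by omega)
  have hKC : 2 * C ≤ K := by linarith
  have hK0 : 0 < K := by linarith
  have hκ0 : 0 < K⁻¹ := by positivity
  have hKi : K⁻¹ * K = 1 := inv_mul_cancel₀ hK0.ne'
  have hκ1 : K⁻¹ ≤ 1 := inv_le_one_of_one_le₀ (by linarith)
  have hex : ∀ n, ∃ j, moment m j ≤ v * K⁻¹ ^ n := fun n =>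
    ((hm.tendsto_moment.eventually_lt_const (by positivity : 0 < v * K⁻¹ ^ n)).exists).imp
      fun _ h => h.le
  classical
  set N : ℕ → ℕ := fun n => Nat.find (hex n) with hN
  have F1 : ∀ n, moment m (N n) ≤ v * K⁻¹ ^ n := fun n => Nat.find_spec (hex n)
  have F2 : ∀ n k, k < N n → v * K⁻¹ ^ n < moment m k := fun n k hk =>
    not_le.1 (Nat.find_min (hex n) hk)
  have F3 : ∀ n, v * K⁻¹ ^ n ≤ C * moment m (N n) := by
    intro n
    rcases Nat.eq_zero_or_eq_succ_pred (N n) with h | h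
    · rw [h, ← hv]
      have : K⁻¹ ^ n ≤ 1 := pow_le_one₀ hκ0.le hκ1
      nlinarith
    · rw [h]
      refine (F2 n (N n).pred (by omega)).le.trans ((hC _).trans ?_)
      exact mul_le_mul_of_nonneg_left (hm.moment_antitone (by omega)) hC0.le
  have hpos : ∀ n, 0 < K⁻¹ ^ n := fun n => by positivity
  refine ⟨⟨K, N, C * v + 2 * K * C ^ (P + 1) / v + K * C / v, by positivity, ?_, ?_,
    le_max_left _ _, fun n j hj => ?_, fun n => ?_, fun n k hk => ?_⟩⟩
  · rw [hN]; simp only [Nat.find_eq_zero]; simp [hv]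
  · refine strictMono_nat_of_lt_succ fun n => ?_
    by_contra! h
    have h1 := (hm.moment_antitone h).trans (F1 (n + 1))
    have h2 := F3 n
    have h3 : v * K⁻¹ ^ n ≤ C * (v * K⁻¹ ^ (n + 1)) := h2.trans (by gcongr)
    have h4 : C * (v * K⁻¹ ^ (n + 1)) = (v * K⁻¹ ^ n) * (C * K⁻¹) := by rw [pow_succ]; ring
    rw [h4] at h3
    have h5 : 0 < v * K⁻¹ ^ n := by have := hpos n; positivity
    have h6 : 1 ≤ C * K⁻¹ := by
      by_contra! h7
      nlinarith
    nlinarith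
  · calc moment m j ≤ C * moment m (2 * j + 1) := hC j
      _ ≤ C * moment m (N n) := by gcongr; exact hm.moment_antitone hj
      _ ≤ C * (v * K⁻¹ ^ n) := by gcongr; exact F1 n
      _ = C * v * K⁻¹ ^ n := by ring
      _ ≤ _ := by
        gcongr ?_ * _
        rw [add_assoc]
        exact le_add_of_nonneg_right (by positivity)
  · have h1 : v * K⁻¹ ^ (n + 1) ≤
        C ^ (P + 1) * moment m (P * N (n + 1) + N (n + 1)) := by
      calc v * K⁻¹ ^ (n + 1) ≤ C * moment m (N (n + 1)) := F3 _
        _ ≤ C * (C ^ P * moment m (2 ^ P * N (n + 1))) := by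
          gcongr; exact hm.moment_le_pow_mul hC1 hC _ _
        _ ≤ C * (C ^ P * moment m (P * N (n + 1) + N (n + 1))) := by
          gcongr
          refine hm.moment_antitone ?_
          have := Nat.lt_two_pow_self (n := P)
          calc P * N (n + 1) + N (n + 1) = (P + 1) * N (n + 1) := by ring
            _ ≤ _ := Nat.mul_le_mul_right _ this
        _ = _ := by rw [pow_succ]; ring
    have h2 := F1 (n + 2)
    set X := moment m (P * N (n + 1) + N (n + 1))
    set Y := moment m (N (n + 2))
    have hCP0 : 0 < C ^ (P + 1) := by positivity
    have h3 : C ^ (P + 1) * Y ≤ v * K⁻¹ ^ (n + 1) / 2 := by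
      calc C ^ (P + 1) * Y ≤ (K / 2) * (v * K⁻¹ ^ (n + 2)) := by
            gcongr
            · exact IsRadialDoubling.moment_nonneg _
            · linarith
        _ = v * K⁻¹ ^ (n + 1) * (K⁻¹ * K) / 2 := by rw [pow_succ _ (n + 1)]; ring
        _ = _ := by rw [hKi, mul_one]
    have h4 : v * K⁻¹ ^ (n + 1) / 2 ≤ C ^ (P + 1) * (X - Y) := by rw [mul_sub]; linarith
    have h5 : K⁻¹ ^ n = 2 * K / v * (v * K⁻¹ ^ (n + 1) / 2) := by
      rw [pow_succ]; field_simp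
    have h6 : 0 ≤ X - Y := by
      have : 0 < v * K⁻¹ ^ (n + 1) / 2 := by have := hpos (n + 1); positivity
      by_contra! h7
      nlinarith
    calc K⁻¹ ^ n = 2 * K / v * (v * K⁻¹ ^ (n + 1) / 2) := h5
      _ ≤ 2 * K / v * (C ^ (P + 1) * (X - Y)) := by gcongr
      _ = 2 * K * C ^ (P + 1) / v * (X - Y) := by ring
      _ ≤ _ := by
        gcongr ?_ * _
        rw [add_comm (C * v), add_assoc]
        exact le_add_of_nonneg_right (by positivity)
  · have h1 := (F2 (n + 1) k hk).le
    have h2 : moment m k ≤ C * moment m (2 * k) := (hC k).trans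
      (mul_le_mul_of_nonneg_left (hm.moment_antitone (by omega)) hC0.le)
    calc K⁻¹ ^ n = K / v * (v * K⁻¹ ^ (n + 1)) := by rw [pow_succ]; field_simp
      _ ≤ K / v * (C * moment m (2 * k)) := mul_le_mul_of_nonneg_left (h1.trans h2) (by positivity)
      _ = K * C / v * moment m (2 * k) := by ring
      _ ≤ _ := by
        gcongr ?_ * _
        · exact IsRadialDoubling.moment_nonneg _
        · exact le_add_of_nonneg_left (by positivity)

/-- Convexity: the power lies above its tangent at $S+x$, which is Bernoulli's inequality after
scaling. -/
lemma add_rpow_le_rpow_add_mul {S x p : ℝ} (hS : 0 ≤ S) (hx : 0 ≤ x) (hp : 1 ≤ p) :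
    (S + x) ^ p ≤ S ^ p + p * (x * (S + x) ^ (p - 1)) := by
  rcases (add_nonneg hS hx).eq_or_lt with h | hT
  · rw [← h, Real.zero_rpow (by linarith)]; positivity
  have hb := one_add_mul_self_le_rpow_one_add (s := -(x / (S + x)))
    (by rw [neg_le_neg_iff, div_le_one hT]; linarith) hp
  have e : S = (S + x) * (1 + -(x / (S + x))) := by field_simp; ring
  have h1 : S ^ p = (S + x) ^ p * (1 + -(x / (S + x))) ^ p := by
    conv_lhs => rw [e]
    refine Real.mul_rpow hT.le ?_
    have : x / (S + x) ≤ 1 := by rw [div_le_one hT]; linarith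
    linarith
  have h2 : (S + x) ^ p = (S + x) ^ (p - 1) * (S + x) := by
    rw [← Real.rpow_add_one hT.ne', sub_add_cancel]
  have h3 : (S + x) ^ p * (1 + p * -(x / (S + x))) =
      (S + x) ^ p - p * (x * (S + x) ^ (p - 1)) := by
    rw [h2]; field_simp; ring
  have h4 := mul_le_mul_of_nonneg_left hb (by positivity : 0 ≤ (S + x) ^ p)
  rw [h3, ← h1] at h4
  linarith

/-- Telescoping of the partial sums to the power $p$. It isolates one factor $x_n$ outside the
power, so that an integral can be taken term by term. -/
lemma sum_rpow_le {p : ℝ} (hp : 1 ≤ p) {x : ℕ → ℝ} (hx : ∀ n, 0 ≤ x n) (M : ℕ) :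
    (∑ n ∈ Finset.range M, x n) ^ p ≤
      p * ∑ n ∈ Finset.range M, x n * (∑ l ∈ Finset.range (n + 1), x l) ^ (p - 1) := by
  induction M with
  | zero => simp [Real.zero_rpow (by linarith : p ≠ 0)]
  | succ M ih =>
    rw [Finset.sum_range_succ, Finset.sum_range_succ _ M, Finset.sum_range_succ _ M]
    have := add_rpow_le_rpow_add_mul (Finset.sum_nonneg fun n (_ : n ∈ Finset.range M) => hx n)
      (hx M) hp
    linarith

/-- A discrete Hardy inequality with geometric weights. -/
lemma sum_pow_mul_sum_rpow_le {p K : ℝ} (hp : 1 ≤ p) (hK : (2 : ℝ) ^ p ≤ K) {A : ℕ → ℝ}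
    (hA : ∀ n, 0 ≤ A n) (M : ℕ) :
    ∑ n ∈ Finset.range M, K⁻¹ ^ n * (∑ l ∈ Finset.range (n + 1), A l) ^ p ≤
      (2 : ℝ) ^ p * ∑ n ∈ Finset.range M, K⁻¹ ^ n * A n ^ p := by
  have hK0 : 0 < K := lt_of_lt_of_le (by positivity) hK
  have hB : ∀ n, 0 ≤ ∑ l ∈ Finset.range n, A l := fun n => Finset.sum_nonneg fun n _ => hA n
  -- The additional copy of the last term is what closes the induction: by $2(B+A)^p\le2^p(B^p+A^p)$
  -- and $2^p\le K$, the doubled new term is paid by the spare old one and by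
  -- $2^pK^{-(M+1)}A_{M+1}^p$.
  have key : ∀ M, (∑ n ∈ Finset.range (M + 1), K⁻¹ ^ n * (∑ l ∈ Finset.range (n + 1), A l) ^ p) +
      K⁻¹ ^ M * (∑ l ∈ Finset.range (M + 1), A l) ^ p ≤
      (2 : ℝ) ^ p * ∑ n ∈ Finset.range (M + 1), K⁻¹ ^ n * A n ^ p := by
    intro M
    induction M with
    | zero =>
      have h2 : (2 : ℝ) ≤ 2 ^ p := by
        conv_lhs => rw [← Real.rpow_one 2]
        exact Real.rpow_le_rpow_of_exponent_le (by norm_num) hp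
      have : 0 ≤ A 0 ^ p := Real.rpow_nonneg (hA 0) p
      simp
      nlinarith
    | succ M ih =>
      rw [Finset.sum_range_succ _ (M + 1), Finset.sum_range_succ (fun n => K⁻¹ ^ n * A n ^ p) (M + 1),
        mul_add, Finset.sum_range_succ A (M + 1)]
      set B := ∑ l ∈ Finset.range (M + 1), A l
      have h1 := NNReal.coe_le_coe.2
        (NNReal.rpow_add_le_mul_rpow_add_rpow B.toNNReal (A (M + 1)).toNNReal hp)
      push_cast [Real.coe_toNNReal B (hB _), Real.coe_toNNReal _ (hA (M + 1))] at h1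
      have h2 : (2 : ℝ) ^ p = 2 * 2 ^ (p - 1) := by
        rw [mul_comm, ← Real.rpow_add_one (by norm_num), sub_add_cancel]
      have h3 : K⁻¹ ^ (M + 1) * (2 ^ p * B ^ p) ≤ K⁻¹ ^ M * B ^ p := by
        have e : K⁻¹ * 2 ^ p ≤ 1 := by
          rw [inv_mul_le_iff₀ hK0, mul_one]; exact hK
        calc K⁻¹ ^ (M + 1) * (2 ^ p * B ^ p) = K⁻¹ ^ M * B ^ p * (K⁻¹ * 2 ^ p) := by
              rw [pow_succ]; ring
          _ ≤ K⁻¹ ^ M * B ^ p * 1 := by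
              gcongr
              have := Real.rpow_nonneg (hB (M + 1)) p
              positivity
          _ = _ := mul_one _
      have h4 : K⁻¹ ^ (M + 1) * (2 * (B + A (M + 1)) ^ p) ≤
          K⁻¹ ^ (M + 1) * (2 ^ p * B ^ p + 2 ^ p * A (M + 1) ^ p) := by
        gcongr
        rw [h2]
        linarith
      linarith
  cases M with
  | zero => simp
  | succ M =>
    refine le_trans ?_ (key M)
    have := Real.rpow_nonneg (hB (M + 1)) p
    exact le_add_of_nonneg_right (by positivity)

end

/-! ### Synthesis and analysis: Bergman norms against block norms -/

section

variable {m : Measure ℂ}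

lemma IsRadialDoubling.lintegral_average (hm : IsRadialDoubling m) {g : ℂ → ℝ≥0∞}
    (hg : Measurable g) : ∫⁻ z, ∫⁻ t, g (circlePt t * z) ∂circleMeasure ∂m = ∫⁻ z, g z ∂m := by
  have := hm.finite
  rw [lintegral_lintegral_swap]
  · simp_rw [(hm.rot _).lintegral_comp hg]
    simp
  · refine (hg.comp ?_).aemeasurable
    exact ((continuous_circlePt.comp continuous_snd).mul continuous_fst).measurable

lemma lintegral_circle_rpow {p : ℝ} (hp : 0 < p) {u : UnitAddCircle → ℂ} (hu : Continuous u) :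
    ∫⁻ t, ‖u t‖ₑ ^ p ∂circleMeasure = ENNReal.ofReal (circleNorm p u ^ p) := by
  rw [← ENNReal.ofReal_rpow_of_nonneg (circleNorm_nonneg _ _) hp.le, ofReal_circleNorm hp hu,
    eLpNorm'_eq_lintegral_enorm, ← ENNReal.rpow_mul, one_div, inv_mul_cancel₀ hp.ne',
    ENNReal.rpow_one]

/-- Rotation invariance stands in for polar coordinates. -/
lemma IsRadialDoubling.lintegral_eval_rpow (hm : IsRadialDoubling m) {p : ℝ} (hp : 0 < p)
    (F : Polynomial ℂ) : ∫⁻ z, ‖F.eval z‖ₑ ^ p ∂m =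
      ∫⁻ z, ENNReal.ofReal (circleNorm p (fun t => F.eval (z * circlePt t)) ^ p) ∂m := by
  rw [← hm.lintegral_average (g := fun z => ‖F.eval z‖ₑ ^ p)
    (F.continuous.measurable.enorm.pow_const p)]
  refine lintegral_congr fun z => ?_
  rw [← lintegral_circle_rpow hp (u := fun t => F.eval (z * circlePt t)) (F.continuous.comp (continuous_const.mul continuous_circlePt))]
  simp_rw [mul_comm z]

lemma circleNorm_eval_norm_mul {p : ℝ} (F : Polynomial ℂ) (z : ℂ) :
    circleNorm p (fun t => F.eval (z * circlePt t)) =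
      circleNorm p (fun t => F.eval (‖z‖ * circlePt t)) := by
  rcases eq_or_ne z 0 with rfl | hz
  · simp
  have hz' : (‖z‖ : ℂ) ≠ 0 := by simpa using hz
  obtain ⟨s, hs⟩ := exists_circlePt (z := z / ‖z‖) (by
    rw [norm_div, Complex.norm_real, norm_norm, div_self (norm_ne_zero_iff.2 hz)])
  rw [← circleNorm_comp_add s fun t => F.eval (‖z‖ * circlePt t)]
  refine congrArg _ (funext fun t => ?_)
  rw [circlePt_add, hs, ← mul_assoc, mul_div_cancel₀ _ hz']

lemma two_rpow_le_of_le {p : ℝ} {P : ℕ} (D : BlockData m P) (hP : p ≤ P) :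
    (2 : ℝ) ^ p ≤ D.K := by
  refine le_trans ?_ D.two_pow_le
  rw [← Real.rpow_natCast]
  exact Real.rpow_le_rpow_of_exponent_le (by norm_num) hP

/-- Synthesis: sums of functions vanishing to a high order at the origin are controlled by the
boundary norms of the cofactors. -/
lemma IsRadialDoubling.exists_synthesis (hm : IsRadialDoubling m) {P : ℕ} (D : BlockData m P)
    {p : ℝ} (hp : 1 < p) (hP : p ≤ P) :
    ∃ C : ℝ, 0 ≤ C ∧ ∀ (M : ℕ) (j : ℕ → ℕ) (a : ℕ → Polynomial ℂ), (∀ n, D.N n ≤ 2 * j n + 1) →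
      ∫⁻ z, ‖(∑ n ∈ Finset.range M, Polynomial.X ^ j n * a n).eval z‖ₑ ^ p ∂m ≤
        ENNReal.ofReal (C * ∑ n ∈ Finset.range M,
          D.K⁻¹ ^ n * circleNorm p (fun t => (a n).eval (circlePt t)) ^ p) := by
  have hp0 : 0 < p := by linarith
  have hc := D.c_pos
  have hκ : 0 < D.K⁻¹ := inv_pos.2 D.K_pos
  refine ⟨p * (D.c * 2 ^ p), by positivity, fun M j a hj => ?_⟩
  set A : ℕ → ℝ := fun n => circleNorm p (fun t => (a n).eval (circlePt t)) with hA
  have hA0 : ∀ n, 0 ≤ A n := fun n => circleNorm_nonneg _ _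
  set B : ℕ → ℝ := fun n => ∑ l ∈ Finset.range (n + 1), A l with hB
  have hB0 : ∀ n, 0 ≤ B n := fun n => Finset.sum_nonneg fun l _ => hA0 l
  have hAB : ∀ n, A n ≤ B n := fun n =>
    Finset.single_le_sum (fun l _ => hA0 l) (Finset.self_mem_range_succ n)
  have hcont : ∀ (F : Polynomial ℂ) (z : ℂ), Continuous fun t => F.eval (z * circlePt t) :=
    fun F z => F.continuous.comp (continuous_const.mul continuous_circlePt)
  -- Minkowski's inequality and monotone means bound the norm by $\sum|z|^{j_n}A_n$. After
  -- `sum_rpow_le` the powers of $|z|$ in the partial sums are estimated by $1$, leaving one power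
  -- per term to be integrated.
  have hpt : ∀ z : ℂ, ‖z‖ < 1 → circleNorm p (fun t =>
      (∑ n ∈ Finset.range M, Polynomial.X ^ j n * a n).eval (z * circlePt t)) ^ p ≤
        p * ∑ n ∈ Finset.range M, ‖z‖ ^ j n * (A n * B n ^ (p - 1)) := by
    intro z hz
    have h1 : circleNorm p (fun t =>
        (∑ n ∈ Finset.range M, Polynomial.X ^ j n * a n).eval (z * circlePt t)) ≤
          ∑ n ∈ Finset.range M, ‖z‖ ^ j n * A n := by
      simp only [Polynomial.eval_finsetSum]
      refine (circleNorm_sum_le hp.le _ fun n _ => hcont _ z).trans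
        (Finset.sum_le_sum fun n _ => ?_)
      refine le_trans (le_of_eq ?_) (mul_le_mul_of_nonneg_left
        (circleNorm_eval_mul_le hp (a n) hz.le) (by positivity))
      rw [← norm_pow, ← circleNorm_const_mul hp0]
      refine circleNorm_congr fun t => ?_
      simp only [Polynomial.eval_mul, Polynomial.eval_pow, Polynomial.eval_X, norm_mul, norm_pow,
        norm_circlePt, mul_one]
    have hx0 : ∀ n, 0 ≤ ‖z‖ ^ j n * A n := fun n => mul_nonneg (by positivity) (hA0 n)
    refine (Real.rpow_le_rpow (circleNorm_nonneg _ _) h1 hp0.le).trans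
      ((sum_rpow_le hp.le hx0 M).trans ?_)
    refine mul_le_mul_of_nonneg_left (Finset.sum_le_sum fun n _ => ?_) hp0.le
    rw [mul_assoc]
    refine mul_le_mul_of_nonneg_left (mul_le_mul_of_nonneg_left ?_ (hA0 n)) (by positivity)
    refine Real.rpow_le_rpow (Finset.sum_nonneg fun l _ => hx0 l)
      (Finset.sum_le_sum fun l _ => ?_) (by linarith)
    exact mul_le_of_le_one_left (hA0 l) (pow_le_one₀ (norm_nonneg _) hz.le)
  rw [hm.lintegral_eval_rpow hp0]
  have hint : ∀ n, Integrable (fun z : ℂ => ‖z‖ ^ j n * (A n * B n ^ (p - 1))) m := fun n =>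
    (hm.integrable_norm_pow _).mul_const _
  have hBp : ∀ n, 0 ≤ B n ^ (p - 1) := fun n => Real.rpow_nonneg (hB0 n) _
  calc _ ≤ ∫⁻ z, ENNReal.ofReal (p * ∑ n ∈ Finset.range M,
          ‖z‖ ^ j n * (A n * B n ^ (p - 1))) ∂m := by
        refine lintegral_mono_ae (hm.ae_norm_lt.mono fun z hz => ?_)
        exact ENNReal.ofReal_le_ofReal (hpt z hz)
    _ = ENNReal.ofReal (p * ∑ n ∈ Finset.range M, moment m (j n) * (A n * B n ^ (p - 1))) := by
        rw [← ofReal_integral_eq_lintegral_ofReal ((integrable_finsetSum _ fun n _ =>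
          hint n).const_mul p) (Filter.Eventually.of_forall fun z => mul_nonneg hp0.le
            (Finset.sum_nonneg fun n _ => mul_nonneg (by positivity)
              (mul_nonneg (hA0 n) (hBp n))))]
        rw [integral_const_mul, integral_finsetSum _ fun n _ => hint n]
        simp_rw [integral_mul_const]
        rfl
    _ ≤ _ := by
        refine ENNReal.ofReal_le_ofReal ?_
        -- The field `half` bounds the moment of order $j_n$ by $cK^{-n}$, and $A_n\le B_n$ brings
        -- the sum to the form of Hardy's inequality.
        have h1 : ∑ n ∈ Finset.range M, moment m (j n) * (A n * B n ^ (p - 1)) ≤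
            ∑ n ∈ Finset.range M, D.c * (D.K⁻¹ ^ n * B n ^ p) := by
          refine Finset.sum_le_sum fun n _ => ?_
          rw [← mul_assoc D.c]
          refine mul_le_mul (D.half n _ (hj n)) ?_ (mul_nonneg (hA0 n) (hBp n)) (by positivity)
          have e : B n ^ p = B n * B n ^ (p - 1) := by
            rw [← Real.rpow_one_add' (hB0 n) (by linarith)]; congr 1; ring
          rw [e]
          exact mul_le_mul_of_nonneg_right (hAB n) (hBp n)
        rw [← Finset.mul_sum] at h1
        have h2 := sum_pow_mul_sum_rpow_le hp.le (two_rpow_le_of_le D hP) hA0 M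
        calc _ ≤ p * (D.c * (2 ^ p * ∑ n ∈ Finset.range M, D.K⁻¹ ^ n * A n ^ p)) := by
              refine mul_le_mul_of_nonneg_left (h1.trans ?_) hp0.le
              exact mul_le_mul_of_nonneg_left h2 hc.le
          _ = _ := by ring

/-- Analysis: the boundary norms of the blocks of a polynomial are controlled by its norm. -/
lemma IsRadialDoubling.exists_analysis (hm : IsRadialDoubling m) {P : ℕ} (D : BlockData m P)
    {p : ℝ} (hp : 1 < p) (hP : p ≤ P) :
    ∃ C : ℝ, 0 ≤ C ∧ ∀ (M : ℕ) (F : Polynomial ℂ),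
      ENNReal.ofReal (∑ n ∈ Finset.range M, D.K⁻¹ ^ n * circleNorm p (fun t =>
        (blockPoly F.coeff (D.N n) (D.N (n + 1))).eval (circlePt t)) ^ p) ≤
      ENNReal.ofReal C * ∫⁻ z, ‖F.eval z‖ₑ ^ p ∂m := by
  obtain ⟨A, hA, hAψ⟩ := exists_circleNorm_blockPoly_le hp
  have hp0 : 0 < p := by linarith
  have hc := D.c_pos
  refine ⟨D.c * A ^ p, by positivity, fun M F => ?_⟩
  set d : ℕ → ℝ := fun n => circleNorm p (fun t =>
        (blockPoly F.coeff (D.N n) (D.N (n + 1))).eval (circlePt t)) with hd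
  have hd0 : ∀ n, 0 ≤ d n := fun n => circleNorm_nonneg _ _
  set Φ : ℂ → ℝ := fun z => circleNorm p (fun t => F.eval (z * circlePt t)) with hΦ
  -- Truncation on the circle of radius $|z|$ costs $A$; returning from that circle to the unit
  -- circle costs $|z|^{N_{n+1}}$, as the degree is below $N_{n+1}$.
  have h1 : ∀ (z : ℂ) (n : ℕ), ‖z‖ < 1 → ‖z‖ ^ D.N (n + 1) * d n ≤ A * Φ z := by
    intro z n hz
    refine (pow_mul_circleNorm_blockPoly_le hp _ _ _ (norm_nonneg z) hz.le).trans ?_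
    simp only [hΦ]
    rw [circleNorm_eval_norm_mul F z]
    have hco : Continuous fun t => F.eval ((‖z‖ : ℂ) * circlePt t) :=
      F.continuous.comp (continuous_const.mul continuous_circlePt)
    refine le_trans (le_of_eq (circleNorm_congr fun t => ?_))
      (hAψ _ hco (D.N n) (D.N (n + 1)))
    simp only [eval_blockPoly]
    congr 1
    refine Finset.sum_congr rfl fun k _ => ?_
    have e := fourierCoeff_eval_circlePt (F.comp (Polynomial.C (‖z‖ : ℂ) * Polynomial.X)) k
    simp only [Polynomial.eval_comp, Polynomial.eval_mul, Polynomial.eval_C, Polynomial.eval_X,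
      Polynomial.comp_C_mul_X_coeff] at e
    rw [e, mul_pow]; ring
  -- The weights $|z|^{N_{n+1}}-|z|^{N_{n+2}}$ are nonnegative and telescope to at most $1$, so all
  -- blocks can be summed against one circle mean. The factor $|z|^{PN_{n+1}}$ pays for the $p$-th
  -- power of the loss, as $p\le P$.
  have h2 : ∀ z : ℂ, ‖z‖ < 1 → ∑ n ∈ Finset.range M,
      (‖z‖ ^ (P * D.N (n + 1) + D.N (n + 1)) - ‖z‖ ^ (P * D.N (n + 1) + D.N (n + 2))) * d n ^ p ≤
        A ^ p * Φ z ^ p := by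
    intro z hz
    have hw : ∀ n, 0 ≤ ‖z‖ ^ D.N (n + 1) - ‖z‖ ^ D.N (n + 2) := fun n => sub_nonneg.2
      (pow_le_pow_of_le_one (norm_nonneg _) hz.le (D.strictMono.monotone (by omega)))
    have hΦ0 : 0 ≤ Φ z := circleNorm_nonneg _ _
    calc _ ≤ ∑ n ∈ Finset.range M, (‖z‖ ^ D.N (n + 1) - ‖z‖ ^ D.N (n + 2)) *
          (A ^ p * Φ z ^ p) := by
          refine Finset.sum_le_sum fun n _ => ?_
          rw [pow_add, pow_add, ← mul_sub, mul_comm (‖z‖ ^ (P * D.N (n + 1))), mul_assoc]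
          refine mul_le_mul_of_nonneg_left ?_ (hw n)
          rw [← Real.mul_rpow hA hΦ0]
          refine le_trans ?_ (Real.rpow_le_rpow (mul_nonneg (by positivity) (hd0 n)) (h1 z n hz)
            hp0.le)
          rw [Real.mul_rpow (by positivity) (hd0 n)]
          refine mul_le_mul_of_nonneg_right ?_ (Real.rpow_nonneg (hd0 n) _)
          rw [← Real.rpow_natCast, ← Real.rpow_natCast, ← Real.rpow_mul (norm_nonneg _)]
          rcases (norm_nonneg z).eq_or_lt with h0 | h0
          · have hN : 0 < D.N (n + 1) := (Nat.zero_le _).trans_lt (D.strictMono n.lt_succ_self)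
            have hP0 : 0 < P := by
              have : (0 : ℝ) < P := by linarith
              exact_mod_cast this
            rw [← h0, Real.zero_rpow (by positivity), Real.zero_rpow (by positivity)]
          · refine Real.rpow_le_rpow_of_exponent_ge h0 hz.le ?_
            push_cast
            rw [mul_comm]
            gcongr
      _ = (‖z‖ ^ D.N 1 - ‖z‖ ^ D.N (M + 1)) * (A ^ p * Φ z ^ p) := by
          rw [← Finset.sum_mul, Finset.sum_range_sub' (fun n => ‖z‖ ^ D.N (n + 1))]
      _ ≤ 1 * (A ^ p * Φ z ^ p) := by
          refine mul_le_mul_of_nonneg_right ?_ (by positivity)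
          have e1 : ‖z‖ ^ D.N 1 ≤ 1 := pow_le_one₀ (norm_nonneg _) hz.le
          have e2 : 0 ≤ ‖z‖ ^ D.N (M + 1) := by positivity
          linarith
      _ = _ := one_mul _
  have hint : ∀ n, Integrable (fun z : ℂ => (‖z‖ ^ (P * D.N (n + 1) + D.N (n + 1)) -
      ‖z‖ ^ (P * D.N (n + 1) + D.N (n + 2))) * d n ^ p) m := fun n =>
    ((hm.integrable_norm_pow _).sub (hm.integrable_norm_pow _)).mul_const _
  have hmom : ∀ n, ∫ z, (‖z‖ ^ (P * D.N (n + 1) + D.N (n + 1)) -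
      ‖z‖ ^ (P * D.N (n + 1) + D.N (n + 2))) * d n ^ p ∂m =
      (moment m (P * D.N (n + 1) + D.N (n + 1)) - moment m (P * D.N (n + 1) + D.N (n + 2))) *
        d n ^ p := by
    intro n
    rw [integral_mul_const, integral_sub (hm.integrable_norm_pow _) (hm.integrable_norm_pow _)]
    rfl
  calc _ ≤ ENNReal.ofReal (D.c * ∫ z, ∑ n ∈ Finset.range M,
        (‖z‖ ^ (P * D.N (n + 1) + D.N (n + 1)) - ‖z‖ ^ (P * D.N (n + 1) + D.N (n + 2))) *
          d n ^ p ∂m) := by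
        refine ENNReal.ofReal_le_ofReal ?_
        rw [integral_finsetSum _ fun n _ => hint n, Finset.mul_sum]
        refine Finset.sum_le_sum fun n _ => ?_
        rw [hmom, ← mul_assoc]
        refine mul_le_mul_of_nonneg_right ((D.gap n).trans ?_) (Real.rpow_nonneg (hd0 n) _)
        refine mul_le_mul_of_nonneg_left (sub_le_sub_left ?_ _) hc.le
        exact hm.moment_antitone (by omega)
    _ = ENNReal.ofReal D.c * ∫⁻ z, ENNReal.ofReal (∑ n ∈ Finset.range M,
        (‖z‖ ^ (P * D.N (n + 1) + D.N (n + 1)) - ‖z‖ ^ (P * D.N (n + 1) + D.N (n + 2))) *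
          d n ^ p) ∂m := by
        rw [ENNReal.ofReal_mul hc.le, ofReal_integral_eq_lintegral_ofReal
          (integrable_finsetSum _ fun n _ => hint n)]
        refine hm.ae_norm_lt.mono fun z hz => Finset.sum_nonneg fun n _ =>
          mul_nonneg (sub_nonneg.2 ?_) (Real.rpow_nonneg (hd0 n) _)
        refine pow_le_pow_of_le_one (norm_nonneg _) hz.le (Nat.add_le_add_left ?_ _)
        exact D.strictMono.monotone (by omega)
    _ ≤ ENNReal.ofReal D.c * ∫⁻ z, ENNReal.ofReal (A ^ p) * ENNReal.ofReal (Φ z ^ p) ∂m := by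
        refine mul_le_mul' le_rfl ?_
        refine lintegral_mono_ae (hm.ae_norm_lt.mono fun z hz => ?_)
        rw [← ENNReal.ofReal_mul (by positivity)]
        exact ENNReal.ofReal_le_ofReal (h2 z hz)
    _ = _ := by
        rw [lintegral_const_mul' _ _ ENNReal.ofReal_ne_top, ← hm.lintegral_eval_rpow hp0,
          ← mul_assoc, ← ENNReal.ofReal_mul hc.le]

end

/-! ### Duality of Bergman spaces through blocks -/

section

variable {m : Measure ℂ}

lemma eLpNorm'_le_ofReal_rpow {p : ℝ} (hp : 0 < p) {u : ℂ → ℂ} {X : ℝ} (hX : 0 ≤ X)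
    (h : ∫⁻ z, ‖u z‖ₑ ^ p ∂m ≤ ENNReal.ofReal X) :
    eLpNorm' u p m ≤ ENNReal.ofReal (X ^ (1 / p)) := by
  rw [eLpNorm'_eq_lintegral_enorm, ← ENNReal.ofReal_rpow_of_nonneg hX (by positivity)]
  exact ENNReal.rpow_le_rpow h (by positivity)

lemma BlockData.sum_blocks {P : ℕ} (D : BlockData m P) {E : Type*} [AddCommMonoid E] (f : ℕ → E)
    (M : ℕ) : ∑ n ∈ Finset.range M, ∑ k ∈ Finset.Ico (D.N n) (D.N (n + 1)), f k =
      ∑ k ∈ Finset.Ico 0 (D.N M), f k := by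
  induction M with
  | zero => simp [D.N_zero]
  | succ M ih =>
    rw [Finset.sum_range_succ, ih, Finset.sum_Ico_consecutive _ (Nat.zero_le _)
      (D.strictMono.monotone (Nat.le_succ M))]

lemma BlockData.sum_blockPoly {P : ℕ} (D : BlockData m P) (u : ℕ → ℂ) (M : ℕ) :
    ∑ n ∈ Finset.range M, blockPoly u (D.N n) (D.N (n + 1)) = blockPoly u 0 (D.N M) :=
  D.sum_blocks (fun k => Polynomial.C (u k) * Polynomial.X ^ k) M

lemma BlockData.block_unique {P : ℕ} (D : BlockData m P) {n n' k : ℕ}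
    (h : k ∈ Finset.Ico (D.N n) (D.N (n + 1))) (h' : k ∈ Finset.Ico (D.N n') (D.N (n' + 1))) :
    n = n' := by
  rw [Finset.mem_Ico] at h h'
  have h1 := D.strictMono.lt_iff_lt.1 (h.1.trans_lt h'.2)
  have h2 := D.strictMono.lt_iff_lt.1 (h'.1.trans_lt h.2)
  omega

lemma blockPoly_congr {a b : ℕ → ℂ} {M N : ℕ} (h : ∀ k ∈ Finset.Ico M N, a k = b k) :
    blockPoly a M N = blockPoly b M N :=
  Finset.sum_congr rfl fun k hk => by rw [h k hk]

lemma blockPoly_eq_X_pow_mul (a : ℕ → ℂ) (M N : ℕ) :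
    blockPoly a M N = Polynomial.X ^ M * blockPoly (fun k => a (M + k)) 0 (N - M) := by
  rw [blockPoly, blockPoly, Finset.sum_Ico_eq_sum_range, Finset.mul_sum, Finset.sum_Ico_eq_sum_range]
  simp only [Nat.sub_zero, zero_add]
  refine Finset.sum_congr rfl fun k _ => ?_
  rw [pow_add]; ring

lemma circleNorm_X_pow_mul {p : ℝ} (M : ℕ) (Q : Polynomial ℂ) :
    circleNorm p (fun t => (Polynomial.X ^ M * Q).eval (circlePt t)) =
      circleNorm p (fun t => Q.eval (circlePt t)) :=
  circleNorm_congr fun t => by simp only [Polynomial.eval_mul, Polynomial.eval_pow,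
    Polynomial.eval_X, norm_mul, norm_pow, norm_circlePt, one_pow, one_mul]

/-- Used to divide a finite sum $S$ by the power of itself that testing on an extremal element
produces. -/
lemma rpow_le_of_le_mul_rpow {S X q r : ℝ} (hqr : q.HolderConjugate r) (hS : 0 ≤ S) (hX : 0 ≤ X)
    (h : S ≤ X * S ^ (1 / r)) : S ≤ X ^ q := by
  have hq0 := hqr.pos
  rcases hS.eq_or_lt with h0 | h0
  · rw [← h0]; positivity
  have e : S = S ^ (1 / q) * S ^ (1 / r) := by
    rw [← Real.rpow_add h0, one_div, one_div, hqr.inv_add_inv_eq_one, Real.rpow_one]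
  have h1 : S ^ (1 / q) ≤ X := by
    refine le_of_mul_le_mul_right ?_ (by positivity : 0 < S ^ (1 / r))
    rw [← e]; exact h
  calc S = (S ^ (1 / q)) ^ q := by
        rw [← Real.rpow_mul hS, one_div, inv_mul_cancel₀ hq0.ne', Real.rpow_one]
    _ ≤ X ^ q := Real.rpow_le_rpow (by positivity) h1 hq0.le

/-- A sequence of Taylor coefficients that induces a bounded functional on the polynomials has
bounded block norms. -/
lemma IsRadialDoubling.exists_sum_block_le (hm : IsRadialDoubling m) {P : ℕ} (D : BlockData m P)
    {q r : ℝ} (hqr : q.HolderConjugate r) (hr : r ≤ P) :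
    ∃ C : ℝ, 0 ≤ C ∧ ∀ (u : ℕ → ℂ) (L : ℝ), 0 ≤ L →
      (∀ (R : ℕ) (h : ℕ → ℂ), ‖∑ k ∈ Finset.Ico 0 R, u k * conj (h k) * moment m (2 * k)‖ₑ ≤
        ENNReal.ofReal L * eLpNorm' (fun z => (blockPoly h 0 R).eval z) r m) →
      ∀ M, ∑ n ∈ Finset.range M, D.K⁻¹ ^ n * circleNorm q (fun t =>
        (blockPoly u (D.N n) (D.N (n + 1))).eval (circlePt t)) ^ q ≤ (C * L) ^ q := by
  obtain ⟨A, hA, hAdual⟩ := exists_dual_block hqr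
  obtain ⟨A₂, hA2, hA2'⟩ := exists_circleNorm_blockPoly_le hqr.symm.lt
  obtain ⟨C₁, hC1, hsyn⟩ := hm.exists_synthesis D hqr.symm.lt hr
  have hc := D.c_pos
  have hr0 : 0 < r := hqr.symm.pos
  have hκ : 0 < D.K⁻¹ := inv_pos.2 D.K_pos
  set G := (C₁ * (A₂ * D.c * A) ^ r) ^ (1 / r) with hG
  have hG0 : 0 ≤ G := by positivity
  refine ⟨G, hG0, fun u L hL hbd M => ?_⟩
  set E : ℕ → ℝ := fun n => circleNorm q (fun t =>
        (blockPoly u (D.N n) (D.N (n + 1))).eval (circlePt t)) with hE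
  have hE0 : ∀ n, 0 ≤ E n := fun n => circleNorm_nonneg _ _
  set S := ∑ n ∈ Finset.range M, D.K⁻¹ ^ n * E n ^ q with hS
  have hS0 : 0 ≤ S := Finset.sum_nonneg fun n _ =>
    mul_nonneg (by positivity) (Real.rpow_nonneg (hE0 n) _)
  choose h₀ hh1 hh2 using fun n => hAdual u (D.N n) (D.N (n + 1))
  -- The functional weights the coefficient $k$ by the moment of order $2k$. This multiplier
  -- replaces it by $K^{-n}$ on the block; it increases with $k$ and is at most `D.c` below
  -- $N_{n+1}$ by `D.lower`, so it costs only a constant.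
  set lam : ℕ → ℕ → ℝ := fun n k => D.K⁻¹ ^ n / moment m (2 * k) with hlam
  have hmp := hm.moment_pos
  set b : ℕ → ℕ → ℂ := fun n k => lam n k * h₀ n k with hb
  have hbn : ∀ n, circleNorm r (fun t => (blockPoly (b n) (D.N n) (D.N (n + 1))).eval
      (circlePt t)) ≤ A₂ * D.c * A * E n ^ (q - 1) := by
    intro n
    refine (circleNorm_blockPoly_mul_le hqr.symm.lt hA2' hA2 (lam := lam n) (L := D.c)
      (fun i j hij => ?_) (fun k => ?_) (h₀ n) (fun k hk => ?_)).trans ?_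
    · exact div_le_div_of_nonneg_left (by positivity) (hmp _) (hm.moment_antitone (by omega))
    · exact div_nonneg (by positivity) (hmp _).le
    · exact div_le_of_le_mul₀ (hmp _).le hc.le (D.lower n k hk)
    · rw [mul_assoc (A₂ * D.c)]
      exact mul_le_mul_of_nonneg_left (hh2 n) (by positivity)
  set h : ℕ → ℂ := fun k => ∑ n ∈ Finset.range M,
    if k ∈ Finset.Ico (D.N n) (D.N (n + 1)) then b n k else 0 with hh
  have hhb : ∀ n ∈ Finset.range M, ∀ k ∈ Finset.Ico (D.N n) (D.N (n + 1)), h k = b n k := by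
    intro n hn k hk
    rw [hh]
    simp only
    rw [Finset.sum_eq_single n, if_pos hk]
    · intro n' _ hne
      rw [if_neg fun hk' => hne (D.block_unique hk' hk)]
    · exact fun hn' => absurd hn hn'
  -- The glued test polynomial turns the functional into exactly $S$, while its norm is at most a
  -- multiple of $S^{1/r}$ by synthesis.
  have hpair : ∑ k ∈ Finset.Ico 0 (D.N M), u k * conj (h k) * moment m (2 * k) = ((S : ℝ) : ℂ) := by
    rw [← D.sum_blocks, hS, Complex.ofReal_sum]
    refine Finset.sum_congr rfl fun n hn => ?_
    rw [Complex.ofReal_mul, ← hh1 n, Finset.mul_sum]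
    refine Finset.sum_congr rfl fun k hk => ?_
    have hl : (lam n k : ℂ) * moment m (2 * k) = ((D.K⁻¹ ^ n : ℝ) : ℂ) := by
      rw [← Complex.ofReal_mul, hlam, div_mul_cancel₀ _ (hmp _).ne']
    rw [hhb n hn k hk, ← hl]
    simp only [hb, map_mul, Complex.conj_ofReal]
    ring
  have hpoly : blockPoly h 0 (D.N M) = ∑ n ∈ Finset.range M, Polynomial.X ^ D.N n *
      blockPoly (fun k => b n (D.N n + k)) 0 (D.N (n + 1) - D.N n) := by
    rw [← D.sum_blockPoly]
    refine Finset.sum_congr rfl fun n hn => ?_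
    rw [blockPoly_congr (hhb n hn), blockPoly_eq_X_pow_mul]
  have h1 := hsyn M D.N (fun n => blockPoly (fun k => b n (D.N n + k)) 0 (D.N (n + 1) - D.N n))
    (fun n => by omega)
  rw [← hpoly] at h1
  have h2 : ∑ n ∈ Finset.range M, D.K⁻¹ ^ n * circleNorm r (fun t =>
      (blockPoly (fun k => b n (D.N n + k)) 0 (D.N (n + 1) - D.N n)).eval (circlePt t)) ^ r ≤
        (A₂ * D.c * A) ^ r * S := by
    rw [hS, Finset.mul_sum]
    refine Finset.sum_le_sum fun n _ => ?_
    rw [← circleNorm_X_pow_mul (D.N n), ← blockPoly_eq_X_pow_mul, mul_left_comm]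
    refine mul_le_mul_of_nonneg_left ?_ (by positivity)
    refine (Real.rpow_le_rpow (circleNorm_nonneg _ _) (hbn n) hr0.le).trans (le_of_eq ?_)
    rw [Real.mul_rpow (by positivity) (Real.rpow_nonneg (hE0 n) _), ← Real.rpow_mul (hE0 n),
      hqr.sub_one_mul_conj]
  have h3 := eLpNorm'_le_ofReal_rpow hr0 (X := C₁ * ((A₂ * D.c * A) ^ r * S)) (by positivity)
    (h1.trans (ENNReal.ofReal_le_ofReal (mul_le_mul_of_nonneg_left h2 hC1)))
  have h4 := hbd (D.N M) h
  rw [hpair, ← ofReal_norm, Complex.norm_real, Real.norm_of_nonneg hS0] at h4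
  have h5 := h4.trans (mul_le_mul' le_rfl h3)
  rw [← ENNReal.ofReal_mul hL, ENNReal.ofReal_le_ofReal_iff (by positivity), ← mul_assoc C₁,
    Real.mul_rpow (by positivity) hS0, ← hG, ← mul_assoc, mul_comm L] at h5
  exact rpow_le_of_le_mul_rpow hqr hS0 (by positivity) h5

/-- An analytic function that induces a bounded functional on the polynomials belongs to the dual
Bergman space. -/
lemma IsRadialDoubling.exists_eLpNorm'_le_of_functional (hm : IsRadialDoubling m) {P : ℕ}
    (D : BlockData m P) {q r : ℝ} (hqr : q.HolderConjugate r) (hq : q ≤ P) (hr : r ≤ P) :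
    ∃ C : ℝ, 0 ≤ C ∧ ∀ (F : ℂ → ℂ) (u : ℕ → ℂ) (L : ℝ), 0 ≤ L →
      (∀ z : ℂ, ‖z‖ < 1 → HasSum (fun k => u k * z ^ k) (F z)) →
      (∀ (R : ℕ) (h : ℕ → ℂ), ‖∑ k ∈ Finset.Ico 0 R, u k * conj (h k) * moment m (2 * k)‖ₑ ≤
        ENNReal.ofReal L * eLpNorm' (fun z => (blockPoly h 0 R).eval z) r m) →
      eLpNorm' F q m ≤ ENNReal.ofReal (C * L) := by
  obtain ⟨C, hC, hCb⟩ := hm.exists_sum_block_le D hqr hr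
  obtain ⟨C₁, hC1, hsyn⟩ := hm.exists_synthesis D hqr.lt hq
  have hq0 : 0 < q := hqr.pos
  refine ⟨C₁ ^ (1 / q) * C, by positivity, fun F u L hL hF hbd => ?_⟩
  have h1 : ∀ M, ∫⁻ z, ‖(blockPoly u 0 (D.N M)).eval z‖ₑ ^ q ∂m ≤
      ENNReal.ofReal (C₁ * (C * L) ^ q) := by
    intro M
    have h2 := hsyn M D.N (fun n => blockPoly (fun k => u (D.N n + k)) 0 (D.N (n + 1) - D.N n))
      (fun n => by omega)
    have h3 : ∀ n, circleNorm q (fun t => (blockPoly (fun k => u (D.N n + k)) 0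
        (D.N (n + 1) - D.N n)).eval (circlePt t)) = circleNorm q (fun t =>
          (blockPoly u (D.N n) (D.N (n + 1))).eval (circlePt t)) := fun n => by
      rw [blockPoly_eq_X_pow_mul u (D.N n), circleNorm_X_pow_mul]
    simp only [h3, ← blockPoly_eq_X_pow_mul] at h2
    rw [D.sum_blockPoly] at h2
    exact h2.trans (ENNReal.ofReal_le_ofReal (mul_le_mul_of_nonneg_left (hCb u L hL hbd M) hC1))
  have h2 : ∫⁻ z, ‖F z‖ₑ ^ q ∂m ≤ ENNReal.ofReal (C₁ * (C * L) ^ q) := by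
    -- Fatou's lemma along the partial sums that end at the frequencies $N_M$. No integrability of
    -- $F$ is needed in advance.
    calc ∫⁻ z, ‖F z‖ₑ ^ q ∂m = ∫⁻ z, Filter.liminf (fun M =>
          ‖(blockPoly u 0 (D.N M)).eval z‖ₑ ^ q) Filter.atTop ∂m := by
          refine lintegral_congr_ae (hm.ae_norm_lt.mono fun z hz => ?_)
          refine (Filter.Tendsto.liminf_eq ?_).symm
          have ht := (hF z hz).tendsto_sum_nat.comp D.strictMono.tendsto_atTop
          have ht' : Filter.Tendsto (fun M => (blockPoly u 0 (D.N M)).eval z) Filter.atTop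
              (nhds (F z)) := by
            refine ht.congr fun M => ?_
            rw [eval_blockPoly, Function.comp_apply, Finset.range_eq_Ico]
          exact (ENNReal.continuous_rpow_const.tendsto _).comp ht'.enorm
      _ ≤ Filter.liminf (fun M => ∫⁻ z, ‖(blockPoly u 0 (D.N M)).eval z‖ₑ ^ q ∂m) Filter.atTop :=
          lintegral_liminf_le fun M =>
            (Polynomial.continuous _).measurable.enorm.pow_const q
      _ ≤ _ := by
          refine Filter.liminf_le_of_le (by isBoundedDefault) fun b hb => ?_
          obtain ⟨M, hM⟩ := hb.exists
          exact hM.trans (h1 M)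
  refine (eLpNorm'_le_ofReal_rpow hq0 (by positivity) h2).trans (le_of_eq ?_)
  rw [Real.mul_rpow hC1 (by positivity), ← Real.rpow_mul (by positivity), mul_one_div_cancel hq0.ne',
    Real.rpow_one, mul_assoc]

end

/-! ### Weak factorization: from bilinear forms to functionals -/

section

variable {m : Measure ℂ}

/-- The diagonal sum of a matrix is bounded by the supremum of its unimodular twists. -/
lemma norm_sum_diag_le (β : ℕ → ℕ → ℂ) (M : ℕ) {X : ℝ}
    (h : ∀ t : UnitAddCircle, ‖∑ n ∈ Finset.range M, ∑ k ∈ Finset.range M,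
      fourier ((k : ℤ) - n) t * β n k‖ ≤ X) : ‖∑ n ∈ Finset.range M, β n n‖ ≤ X := by
  have hint : ∀ n k : ℕ, Integrable (fun t : UnitAddCircle =>
      (fourier ((k : ℤ) - n) t : ℂ) * β n k) circleMeasure := fun n k =>
    integrable_of_continuous (by fun_prop)
  have e : ∫ t, ∑ n ∈ Finset.range M, ∑ k ∈ Finset.range M,
      fourier ((k : ℤ) - n) t * β n k ∂circleMeasure = ∑ n ∈ Finset.range M, β n n := by
    rw [integral_finsetSum _ fun n _ => integrable_finsetSum _ fun k _ => hint n k]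
    refine Finset.sum_congr rfl fun n hn => ?_
    rw [integral_finsetSum _ fun k _ => hint n k, Finset.sum_eq_single n]
    · rw [integral_mul_const, integral_fourier]; simp
    · intro k _ hk
      rw [integral_mul_const, integral_fourier, if_neg (by omega), zero_mul]
    · exact fun hn' => absurd hn hn'
  rw [← e]
  refine (norm_integral_le_of_norm_le_const (Filter.Eventually.of_forall h)).trans ?_
  simp [circleMeasure]

lemma conj_fourier_mul_conj_fourier (n k : ℕ) (t : UnitAddCircle) :
    conj (fourier (n : ℤ) t : ℂ) * conj (fourier (-(k : ℤ)) t : ℂ) = fourier ((k : ℤ) - n) t := by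
  rw [← fourier_neg, ← fourier_neg, ← fourier_add]
  congr 2; ring

lemma norm_fourier_apply (n : ℤ) (t : UnitAddCircle) : ‖(fourier n t : ℂ)‖ = 1 := by
  rw [fourier_apply]; exact Circle.norm_coe _

lemma eval_twist_sum (j : ℕ → ℕ) (a : ℕ → Polynomial ℂ) (c : ℕ → ℂ) (M : ℕ) (z : ℂ) :
    (∑ n ∈ Finset.range M, Polynomial.X ^ j n * (Polynomial.C (c n) * a n)).eval z =
      ∑ n ∈ Finset.range M, c n * (z ^ j n * (a n).eval z) := by
  rw [Polynomial.eval_finsetSum]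
  refine Finset.sum_congr rfl fun n _ => ?_
  simp only [Polynomial.eval_mul, Polynomial.eval_pow, Polynomial.eval_X, Polynomial.eval_C]
  ring

lemma IsRadialDoubling.integrable_mul_bounded (hm : IsRadialDoubling m) {f g : ℂ → ℂ}
    (hf : Integrable f m) (hg : Continuous g) : Integrable (fun z => f z * g z) m := by
  obtain ⟨B, hB⟩ := (isCompact_closedBall (0 : ℂ) 1).exists_bound_of_continuousOn hg.continuousOn
  refine hf.mul_bdd (c := B) hg.aestronglyMeasurable (hm.ae_norm_lt.mono fun z hz => hB z ?_)
  simpa using hz.le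

/-- A synthesis bound with unimodular twists, stated for the norm. -/
lemma IsRadialDoubling.exists_twist_le (hm : IsRadialDoubling m) {P : ℕ} (D : BlockData m P)
    {p : ℝ} (hp : 1 < p) (hP : p ≤ P) (A : ℝ) (hA : 0 ≤ A) (s : ℝ) :
    ∃ C : ℝ, 0 ≤ C ∧ ∀ (M : ℕ) (j : ℕ → ℕ) (a : ℕ → Polynomial ℂ) (c : ℕ → ℂ) (x : ℕ → ℝ),
      (∀ n, D.N n ≤ 2 * j n + 1) → (∀ n, ‖c n‖ = 1) → (∀ n, 0 ≤ x n) →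
      (∀ n, circleNorm p (fun t => (a n).eval (circlePt t)) ≤ A * x n ^ (s / p)) →
      eLpNorm' (fun z => (∑ n ∈ Finset.range M,
        Polynomial.X ^ j n * (Polynomial.C (c n) * a n)).eval z) p m ≤
        ENNReal.ofReal (C * (∑ n ∈ Finset.range M, D.K⁻¹ ^ n * x n ^ s) ^ (1 / p)) := by
  obtain ⟨C, hC, h⟩ := hm.exists_synthesis D hp hP
  have hp0 : 0 < p := by linarith
  have hκ : 0 < D.K⁻¹ := inv_pos.2 D.K_pos
  refine ⟨(C * A ^ p) ^ (1 / p), by positivity, fun M j a c x hj hc hx hax => ?_⟩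
  have h1 := h M j (fun n => Polynomial.C (c n) * a n) hj
  have hW : 0 ≤ ∑ n ∈ Finset.range M, D.K⁻¹ ^ n * x n ^ s :=
    Finset.sum_nonneg fun n _ => mul_nonneg (by positivity) (Real.rpow_nonneg (hx n) _)
  rw [← Real.mul_rpow (by positivity) hW]
  refine eLpNorm'_le_ofReal_rpow hp0 (by positivity) (h1.trans (ENNReal.ofReal_le_ofReal ?_))
  rw [mul_assoc]
  refine mul_le_mul_of_nonneg_left ?_ hC
  rw [Finset.mul_sum]
  refine Finset.sum_le_sum fun n _ => ?_
  rw [mul_left_comm]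
  refine mul_le_mul_of_nonneg_left ?_ (by positivity)
  have e : circleNorm p (fun t => (Polynomial.C (c n) * a n).eval (circlePt t)) =
      circleNorm p (fun t => (a n).eval (circlePt t)) :=
    circleNorm_congr fun t => by simp [hc n]
  rw [e]
  refine (Real.rpow_le_rpow (circleNorm_nonneg _ _) (hax n) hp0.le).trans (le_of_eq ?_)
  rw [Real.mul_rpow hA (Real.rpow_nonneg (hx n) _), ← Real.rpow_mul (hx n), div_mul_cancel₀ _ hp0.ne']

/-- If the bilinear form `(g, h) ↦ ∫ f conj g conj h` is bounded on the polynomials for exponents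
`p` and `r`, then the functional `H ↦ ∫ f conj H` is bounded for the exponent `t` with
`1 / t = 1 / p + 1 / r`. -/
lemma IsRadialDoubling.exists_functional_le_of_bilinear (hm : IsRadialDoubling m) {P : ℕ}
    (D : BlockData m P) {p r t : ℝ} (hp : 1 < p) (hr : 1 < r) (ht : 1 < t)
    (h : 1 / p + 1 / r = 1 / t) (hpP : p ≤ P) (hrP : r ≤ P) (htP : t ≤ P) :
    ∃ C : ℝ, 0 ≤ C ∧ ∀ (f : ℂ → ℂ) (L : ℝ), Integrable f m → 0 ≤ L →
      (∀ a b : Polynomial ℂ, ‖∫ z, f z * conj (a.eval z) * conj (b.eval z) ∂m‖ₑ ≤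
        ENNReal.ofReal L * eLpNorm' (fun z => a.eval z) p m * eLpNorm' (fun z => b.eval z) r m) →
      ∀ H : Polynomial ℂ, ‖∫ z, f z * conj (H.eval z) ∂m‖ₑ ≤
        ENNReal.ofReal (C * L) * eLpNorm' (fun z => H.eval z) t m := by
  obtain ⟨A, hA, hfac⟩ := exists_approx_factor ht hp hr h
  obtain ⟨C₁, hC1, hsyn1⟩ := hm.exists_twist_le D hp hpP A hA t
  obtain ⟨C₂, hC2, hsyn2⟩ := hm.exists_twist_le D hr hrP A hA t
  obtain ⟨C₃, hC3, hana⟩ := hm.exists_analysis D ht htP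
  have hκ : 0 < D.K⁻¹ := inv_pos.2 D.K_pos
  have hp0 : 0 < p := by linarith
  have hr0 : 0 < r := by linarith
  have ht0 : 0 < t := by linarith
  refine ⟨C₁ * C₂ * C₃ ^ (1 / t), by positivity, fun f L hf hL hbd H => ?_⟩
  obtain ⟨M, hM⟩ : ∃ M, H.natDegree < D.N M :=
    ⟨H.natDegree + 1, (Nat.lt_succ_self _).trans_le (D.strictMono.le_apply)⟩
  set Q : ℕ → Polynomial ℂ := fun n =>
    blockPoly (fun k => H.coeff (D.N n + k)) 0 (D.N (n + 1) - D.N n) with hQ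
  have hH : ∀ z, H.eval z = ∑ n ∈ Finset.range M, z ^ D.N n * (Q n).eval z := by
    intro z
    have e : H = blockPoly H.coeff 0 (D.N M) := by
      rw [blockPoly, ← Finset.range_eq_Ico]
      exact H.as_sum_range_C_mul_X_pow' hM
    conv_lhs => rw [e, ← D.sum_blockPoly, Polynomial.eval_finsetSum]
    refine Finset.sum_congr rfl fun n _ => ?_
    rw [blockPoly_eq_X_pow_mul, Polynomial.eval_mul, Polynomial.eval_pow, Polynomial.eval_X]
  set x : ℕ → ℝ := fun n => circleNorm t (fun τ => (Q n).eval (circlePt τ)) with hx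
  have hx0 : ∀ n, 0 ≤ x n := fun n => circleNorm_nonneg _ _
  set W := ∑ n ∈ Finset.range M, D.K⁻¹ ^ n * x n ^ t with hW
  have hW0 : 0 ≤ W := Finset.sum_nonneg fun n _ =>
    mul_nonneg (by positivity) (Real.rpow_nonneg (hx0 n) _)
  have hWH : ENNReal.ofReal (W ^ (1 / t)) ≤
      ENNReal.ofReal (C₃ ^ (1 / t)) * eLpNorm' (fun z => H.eval z) t m := by
    have h1 := hana M H
    have e : ∀ n, circleNorm t (fun τ => (blockPoly H.coeff (D.N n) (D.N (n + 1))).eval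
        (circlePt τ)) = x n := fun n => by
      rw [blockPoly_eq_X_pow_mul, circleNorm_X_pow_mul]
    simp only [e] at h1
    rw [← ENNReal.ofReal_rpow_of_nonneg hW0 (by positivity),
      ← ENNReal.ofReal_rpow_of_nonneg hC3 (by positivity), eLpNorm'_eq_lintegral_enorm,
      ← ENNReal.mul_rpow_of_nonneg _ _ (by positivity)]
    exact ENNReal.rpow_le_rpow h1 (by positivity)
  have hWpr : W ^ (1 / p) * W ^ (1 / r) = W ^ (1 / t) := by
    rw [← h, Real.rpow_add_of_nonneg hW0 (by positivity) (by positivity)]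
  set I := ∫ z, ‖f z‖ ∂m with hI
  have key : ∀ δ : ℝ, 0 < δ → ‖∫ z, f z * conj (H.eval z) ∂m‖ ≤
      L * (C₁ * C₂ * W ^ (1 / t)) + I * (M * δ) := by
    intro δ hδ
    choose a b ha hb hab using fun n => hfac (Q n) δ hδ
    -- The factor $z^{N_n}$ is shared, one half going with $a_n$ and the other with $b_n$. Both
    -- halves have order $j$ with $N_n\le2j+1$, as synthesis requires.
    set β : ℕ → ℕ → ℂ := fun n k => ∫ z, f z * conj (z ^ (D.N n / 2) * (a n).eval z) *
      conj (z ^ (D.N k - D.N k / 2) * (b k).eval z) ∂m with hβ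
    have hβi : ∀ n k, Integrable (fun z => f z * conj (z ^ (D.N n / 2) * (a n).eval z) *
        conj (z ^ (D.N k - D.N k / 2) * (b k).eval z)) m := fun n k => by
      simp only [mul_assoc (f _)]
      exact hm.integrable_mul_bounded hf (by fun_prop)
    -- Inserting the twists $e^{in\tau}$ and $e^{-ik\tau}$ gives the double sum of
    -- $e^{i(k-n)\tau}\beta_{nk}$ as a single value of the bilinear form. Its bound is uniform in
    -- $\tau$, because synthesis does not see unimodular constants.
    have hdiag : ‖∑ n ∈ Finset.range M, β n n‖ ≤ L * (C₁ * C₂ * W ^ (1 / t)) := by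
      refine norm_sum_diag_le β M fun τ => ?_
      have h1 := hsyn1 M (fun n => D.N n / 2) a (fun n => fourier (n : ℤ) τ) x
        (fun n => by omega) (fun n => norm_fourier_apply _ _) hx0 ha
      have h2 := hsyn2 M (fun n => D.N n - D.N n / 2) b (fun n => fourier (-(n : ℤ)) τ) x
        (fun n => by omega) (fun n => norm_fourier_apply _ _) hx0 hb
      have h3 := (hbd _ _).trans (mul_le_mul' (mul_le_mul' le_rfl h1) h2)
      have e : ∑ n ∈ Finset.range M, ∑ k ∈ Finset.range M,
          fourier ((k : ℤ) - n) τ * β n k = ∫ z, f z *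
          conj ((∑ n ∈ Finset.range M, Polynomial.X ^ (D.N n / 2) *
            (Polynomial.C (fourier (n : ℤ) τ : ℂ) * a n)).eval z) *
          conj ((∑ n ∈ Finset.range M, Polynomial.X ^ (D.N n - D.N n / 2) *
            (Polynomial.C (fourier (-(n : ℤ)) τ : ℂ) * b n)).eval z) ∂m := by
        have e1 : ∀ z, f z *
          conj ((∑ n ∈ Finset.range M, Polynomial.X ^ (D.N n / 2) *
            (Polynomial.C (fourier (n : ℤ) τ : ℂ) * a n)).eval z) *
          conj ((∑ n ∈ Finset.range M, Polynomial.X ^ (D.N n - D.N n / 2) *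
            (Polynomial.C (fourier (-(n : ℤ)) τ : ℂ) * b n)).eval z) =
            ∑ n ∈ Finset.range M, ∑ k ∈ Finset.range M, (fourier ((k : ℤ) - n) τ : ℂ) *
              (f z * conj (z ^ (D.N n / 2) * (a n).eval z) *
                conj (z ^ (D.N k - D.N k / 2) * (b k).eval z)) := by
          intro z
          rw [eval_twist_sum, eval_twist_sum, map_sum, map_sum, mul_assoc, Finset.sum_mul_sum,
            Finset.mul_sum]
          refine Finset.sum_congr rfl fun n _ => ?_
          rw [Finset.mul_sum]
          refine Finset.sum_congr rfl fun k _ => ?_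
          rw [← conj_fourier_mul_conj_fourier]
          simp only [map_mul]
          ring
        simp only [e1]
        rw [integral_finsetSum _ fun n _ => integrable_finsetSum _ fun k _ => (hβi n k).const_mul _]
        refine Finset.sum_congr rfl fun n _ => ?_
        rw [integral_finsetSum _ fun k _ => (hβi n k).const_mul _]
        refine Finset.sum_congr rfl fun k _ => ?_
        rw [integral_const_mul]
      rw [← e, ← ofReal_norm, ← ENNReal.ofReal_mul hL, ← ENNReal.ofReal_mul (by positivity),
        ENNReal.ofReal_le_ofReal_iff (by positivity)] at h3
      refine h3.trans (le_of_eq ?_)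
      rw [← hWpr]; ring
    -- On the diagonal the halves recombine to $z^{N_n}a_nb_n$, which differs from the block by at
    -- most $\delta$. The bound for the diagonal does not depend on $\delta$, so $\delta$ can tend
    -- to $0$.
    have herr : ‖∫ z, f z * conj (H.eval z) ∂m - ∑ n ∈ Finset.range M, β n n‖ ≤ I * (M * δ) := by
      rw [hβ, ← integral_finsetSum _ fun n _ => hβi n n,
        ← integral_sub (hm.integrable_mul_bounded hf (by fun_prop))
          (integrable_finsetSum _ fun n _ => hβi n n), hI, ← integral_mul_const]
      refine norm_integral_le_of_norm_le (hf.norm.mul_const _) (hm.ae_norm_lt.mono fun z hz => ?_)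
      have e : f z * conj (H.eval z) - ∑ n ∈ Finset.range M,
          f z * conj (z ^ (D.N n / 2) * (a n).eval z) *
            conj (z ^ (D.N n - D.N n / 2) * (b n).eval z) =
          f z * conj (∑ n ∈ Finset.range M, z ^ D.N n *
            ((Q n).eval z - (a n).eval z * (b n).eval z)) := by
        rw [hH, map_sum, map_sum, Finset.mul_sum, Finset.mul_sum, ← Finset.sum_sub_distrib]
        refine Finset.sum_congr rfl fun n _ => ?_
        have e2 : D.N n = D.N n / 2 + (D.N n - D.N n / 2) := by omega
        have e3 : z ^ D.N n = z ^ (D.N n / 2) * z ^ (D.N n - D.N n / 2) := by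
          rw [← pow_add, ← e2]
        rw [e3]
        simp only [map_mul, map_sub]
        ring
      rw [e, norm_mul, RCLike.norm_conj]
      refine mul_le_mul_of_nonneg_left ?_ (norm_nonneg _)
      refine (norm_sum_le_of_le _ (f := fun n => z ^ D.N n *
        ((Q n).eval z - (a n).eval z * (b n).eval z)) (n := fun _ => δ) fun n _ => ?_).trans ?_
      · rw [norm_mul, norm_pow]
        exact (mul_le_of_le_one_left (norm_nonneg _) (pow_le_one₀ (norm_nonneg _) hz.le)).trans
          (hab n z hz.le)
      · simp
    calc _ = ‖∑ n ∈ Finset.range M, β n n +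
          (∫ z, f z * conj (H.eval z) ∂m - ∑ n ∈ Finset.range M, β n n)‖ := by
          rw [add_sub_cancel]
      _ ≤ _ := (norm_add_le _ _).trans (add_le_add hdiag herr)
  have hfin : ‖∫ z, f z * conj (H.eval z) ∂m‖ ≤ L * (C₁ * C₂ * W ^ (1 / t)) := by
    have hI0 : 0 ≤ I := integral_nonneg fun z => norm_nonneg _
    refine le_of_forall_pos_le_add fun ε hε => (key (ε / (I * M + 1)) (by positivity)).trans ?_
    refine add_le_add le_rfl ?_
    rw [← mul_assoc, mul_div_assoc', div_le_iff₀ (by positivity)]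
    nlinarith
  calc ‖∫ z, f z * conj (H.eval z) ∂m‖ₑ
      ≤ ENNReal.ofReal (L * (C₁ * C₂ * W ^ (1 / t))) := by
        rw [← ofReal_norm]; exact ENNReal.ofReal_le_ofReal hfin
    _ = ENNReal.ofReal (L * (C₁ * C₂)) * ENNReal.ofReal (W ^ (1 / t)) := by
        rw [← ENNReal.ofReal_mul (by positivity), mul_assoc L]
    _ ≤ ENNReal.ofReal (L * (C₁ * C₂)) *
        (ENNReal.ofReal (C₃ ^ (1 / t)) * eLpNorm' (fun z => H.eval z) t m) :=
        mul_le_mul' le_rfl hWH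
    _ = _ := by
        rw [← mul_assoc, ← ENNReal.ofReal_mul (by positivity)]
        congr 2; ring

end

/-! ### Power series and the reproducing kernel of a radial measure -/

section

variable {m : Measure ℂ}

lemma isOpen_unitDisc : IsOpen unitDisc := Metric.isOpen_ball

lemma mem_unitDisc {z : ℂ} : z ∈ unitDisc ↔ ‖z‖ < 1 := by simp [unitDisc]

/-- `F` is the sum of the power series with coefficients `u` in the unit disc. -/
def HasSeries (u : ℕ → ℂ) (F : ℂ → ℂ) : Prop :=
  ∀ z : ℂ, ‖z‖ < 1 → HasSum (fun k => u k * z ^ k) (F z)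

lemma exists_hasSeries {F : ℂ → ℂ} (hF : DifferentiableOn ℂ F unitDisc) : ∃ u, HasSeries u F := by
  refine ⟨fun k => (k.factorial : ℂ)⁻¹ * iteratedDeriv k F 0, fun z hz => ?_⟩
  refine (congrArg (HasSum · _) (funext fun k => ?_)).mpr (Complex.hasSum_taylorSeries_on_ball hF (mem_unitDisc.2 hz))
  beta_reduce
  simp only [sub_zero, smul_eq_mul]
  ring

lemma HasSeries.differentiableOn {u : ℕ → ℂ} {F : ℂ → ℂ} (h : HasSeries u F) :
    DifferentiableOn ℂ F unitDisc := by
  intro z hz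
  rw [mem_unitDisc] at hz
  obtain ⟨ρ, hρ, hρ1⟩ := exists_between hz
  have hρ0 : 0 ≤ ρ := (norm_nonneg z).trans hρ.le
  have hs : Summable fun k => ‖u k * (ρ : ℂ) ^ k‖ :=
    (h ρ (by rwa [Complex.norm_real, Real.norm_of_nonneg hρ0])).summable.norm
  have hd : DifferentiableOn ℂ (fun w => ∑' k, u k * w ^ k) (Metric.ball 0 ρ) := by
    refine Complex.differentiableOn_tsum_of_summable_norm hs
      (fun k => ((differentiable_id.pow k).const_mul _).differentiableOn) Metric.isOpen_ball
      fun k w hw => ?_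
    rw [norm_mul, norm_mul, norm_pow, norm_pow, Complex.norm_real, Real.norm_of_nonneg hρ0]
    exact mul_le_mul_of_nonneg_left (pow_le_pow_left₀ (norm_nonneg _)
      (by simpa using (Metric.mem_ball.1 hw).le) _) (norm_nonneg _)
  have hz' : z ∈ Metric.ball (0 : ℂ) ρ := by simpa using hρ
  refine (((hd.congr fun w hw => ?_).differentiableAt
    (Metric.isOpen_ball.mem_nhds hz')).differentiableWithinAt)
  exact (h w ((by simpa using hw : ‖w‖ < ρ).trans hρ1)).tsum_eq.symm

namespace IsRadialDoubling

lemma aestronglyMeasurable (hm : IsRadialDoubling m) {F : ℂ → ℂ} (hF : ContinuousOn F unitDisc) :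
    AEStronglyMeasurable F m := by
  rw [← Measure.restrict_eq_self_of_ae_mem hm.ae_mem]
  exact hF.aestronglyMeasurable isOpen_unitDisc.measurableSet

lemma measurePreserving_rot (hm : IsRadialDoubling m) :
    MeasurePreserving (fun x : ℂ × UnitAddCircle => circlePt x.2 * x.1) (m.prod circleMeasure) m := by
  have := hm.finite
  have hc : Measurable fun x : ℂ × UnitAddCircle => circlePt x.2 * x.1 :=
    ((continuous_circlePt.comp continuous_snd).mul continuous_fst).measurable
  refine ⟨hc, Measure.ext fun s hs => ?_⟩
  rw [← lintegral_indicator_one hs, ← lintegral_indicator_one hs,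
    lintegral_map (measurable_one.indicator hs) hc,
    lintegral_prod (fun x : ℂ × UnitAddCircle => s.indicator 1 (circlePt x.2 * x.1))
      ((measurable_one.indicator hs).comp hc).aemeasurable]
  exact hm.lintegral_average (measurable_one.indicator hs)

lemma integral_average (hm : IsRadialDoubling m) {F : ℂ → ℂ} (hF : Integrable F m) :
    ∫ z, F z ∂m = ∫ z, ∫ t, F (circlePt t * z) ∂circleMeasure ∂m := by
  have := hm.finite
  have h := hm.measurePreserving_rot
  have h1 := (h.integrable_comp hF.aestronglyMeasurable).2 hF
  rw [← integral_prod (fun x : ℂ × UnitAddCircle => F (circlePt x.2 * x.1)) h1]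
  conv_lhs => rw [← h.map_eq]
  exact integral_map h.measurable.aemeasurable (by rw [h.map_eq]; exact hF.aestronglyMeasurable)

end IsRadialDoubling

lemma HasSeries.integral_circle {u : ℕ → ℂ} {F : ℂ → ℂ} (h : HasSeries u F) (k : ℕ) {z : ℂ}
    (hz : ‖z‖ < 1) : ∫ t, F (circlePt t * z) * conj ((circlePt t * z) ^ k) ∂circleMeasure =
      u k * (‖z‖ ^ (2 * k) : ℝ) := by
  set G : ℕ → UnitAddCircle → ℂ := fun j t =>
    u j * z ^ j * conj (z ^ k) * fourier ((j : ℤ) - k) t with hG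
  have hGe : ∀ j t, G j t = u j * (circlePt t * z) ^ j * conj ((circlePt t * z) ^ k) := by
    intro j t
    have e : (fourier ((j : ℤ) - k) t : ℂ) = circlePt t ^ j * conj (circlePt t ^ k) := by
      rw [circlePt_pow, circlePt_pow, ← fourier_neg, ← fourier_add, sub_eq_add_neg]
    simp only [hG, e, map_mul, mul_pow]
    ring
  have hnorm : ∀ j t, ‖G j t‖ = ‖u j * z ^ j‖ * ‖z ^ k‖ := fun j t => by
    simp only [hG, norm_mul, norm_fourier_apply, RCLike.norm_conj, mul_one]
  have h1 := hasSum_integral_of_summable_integral_norm (μ := circleMeasure) (F := G)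
    (fun j => integrable_of_continuous (by fun_prop)) (by
      simp only [hnorm, integral_const, circleMeasure, probReal_univ, one_smul]
      exact ((h z hz).summable.norm).mul_right _)
  have e1 : ∀ t, ∑' j, G j t = F (circlePt t * z) * conj ((circlePt t * z) ^ k) := by
    intro t
    simp only [hGe]
    rw [tsum_mul_right, (h _ (by rwa [norm_mul, norm_circlePt, one_mul])).tsum_eq]
  simp only [e1] at h1
  rw [← h1.tsum_eq, tsum_eq_single k]
  · simp only [hG, integral_const_mul, integral_fourier, sub_self, if_true, mul_one]
    rw [mul_assoc, Complex.mul_conj, Complex.normSq_eq_norm_sq, norm_pow, ← pow_mul, mul_comm 2 k]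
  · intro j hj
    simp only [hG, integral_const_mul, integral_fourier]
    rw [if_neg (by omega), mul_zero]

namespace IsRadialDoubling

/-- The moments against monomials of an integrable analytic function are multiples of its Taylor
coefficients. -/
lemma integral_mul_conj_pow (hm : IsRadialDoubling m) {u : ℕ → ℂ} {F : ℂ → ℂ} (h : HasSeries u F)
    (hF : Integrable F m) (k : ℕ) :
    ∫ z, F z * conj (z ^ k) ∂m = u k * moment m (2 * k) := by
  rw [hm.integral_average (hm.integrable_mul_bounded hF (by fun_prop)), moment,
    ← integral_complex_ofReal, ← integral_const_mul]
  refine integral_congr_ae (hm.ae_norm_lt.mono fun z hz => ?_)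
  exact h.integral_circle k hz

/-- The measure has mass on $|z|\ge\sigma=\sqrt\rho$: otherwise the moment of order $2k+1$ would be
at most $\sigma^{k+1}$ times that of order $k$, against doubling for large $k$. This bound makes the
kernel series converge. -/
lemma exists_mul_pow_le_moment (hm : IsRadialDoubling m) {ρ : ℝ} (h0 : 0 ≤ ρ) (h1 : ρ < 1) :
    ∃ c : ℝ, 0 < c ∧ ∀ k, c * ρ ^ k ≤ moment m (2 * k) := by
  have hfin := hm.finite
  set σ := Real.sqrt ρ with hσ
  have hσ0 : 0 ≤ σ := Real.sqrt_nonneg _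
  have hσ1 : σ < 1 := by rw [hσ, Real.sqrt_lt' one_pos]; simpa using h1
  have hρσ : ρ = σ ^ 2 := (Real.sq_sqrt h0).symm
  refine ⟨m.real {z | σ ≤ ‖z‖}, ?_, fun k => ?_⟩
  · rw [measureReal_def, ENNReal.toReal_pos_iff]
    refine ⟨pos_iff_ne_zero.2 fun hz => ?_, measure_lt_top _ _⟩
    obtain ⟨C, hC1, hC⟩ := hm.exists_doubling
    have hae : ∀ᵐ z ∂m, ‖z‖ < σ := by
      rw [ae_iff]; simpa using hz
    have hle : ∀ k, moment m (2 * k + 1) ≤ σ ^ (k + 1) * moment m k := fun k => by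
      rw [moment, moment, ← integral_const_mul]
      refine integral_mono_ae (hm.integrable_norm_pow _) ((hm.integrable_norm_pow _).const_mul _)
        (hae.mono fun z hz => ?_)
      simp only
      rw [show 2 * k + 1 = (k + 1) + k by ring, pow_add]
      exact mul_le_mul_of_nonneg_right (pow_le_pow_left₀ (norm_nonneg _) hz.le _) (by positivity)
    have ht := ((tendsto_pow_atTop_nhds_zero_of_lt_one hσ0 hσ1).const_mul C).eventually_lt_const
      (by simp : C * 0 < 1)
    obtain ⟨k, hk, hk0⟩ := (ht.and (Filter.eventually_ge_atTop 1)).exists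
    have hpos := hm.moment_pos k
    have h2 := (hC k).trans (mul_le_mul_of_nonneg_left (hle k) (by linarith))
    have h3 : σ ^ (k + 1) ≤ σ ^ k := pow_le_pow_of_le_one hσ0 hσ1.le (Nat.le_succ k)
    have h4 : C * (σ ^ (k + 1) * moment m k) ≤ C * σ ^ k * moment m k := by
      rw [mul_assoc]; gcongr
    nlinarith
  · rw [hρσ, ← pow_mul, mul_comm]
    refine le_trans ?_ (mul_meas_ge_le_integral_of_nonneg
      (Filter.Eventually.of_forall fun z => by positivity) (hm.integrable_norm_pow (2 * k))
      (σ ^ (2 * k)))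
    refine mul_le_mul_of_nonneg_left ?_ (by positivity)
    exact measureReal_mono fun z hz => pow_le_pow_left₀ hσ0 hz _

lemma summable_pow_div_moment (hm : IsRadialDoubling m) {x : ℝ} (hx0 : 0 ≤ x) (hx1 : x < 1) :
    Summable fun k => x ^ k / moment m (2 * k) := by
  obtain ⟨ρ, hρ, hρ1⟩ := exists_between hx1
  have hρ0 : 0 < ρ := hx0.trans_lt hρ
  obtain ⟨c, hc, hck⟩ := hm.exists_mul_pow_le_moment hρ0.le hρ1
  refine Summable.of_nonneg_of_le (fun k => div_nonneg (by positivity) (moment_nonneg _))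
    (fun k => ?_) ((summable_geometric_of_lt_one (div_nonneg hx0 hρ0.le)
      ((div_lt_one hρ0).2 hρ)).mul_left c⁻¹)
  rw [div_pow, ← div_eq_inv_mul, div_div, mul_comm _ c]
  exact div_le_div_of_nonneg_left (by positivity) (by positivity) (hck k)

end IsRadialDoubling

/-- The reproducing kernel of the Bergman space of a radial measure, as a power series. -/
def kernelSeries (m : Measure ℂ) (z ζ : ℂ) : ℂ := ∑' k, conj (z ^ k) / moment m (2 * k) * ζ ^ k

namespace IsRadialDoubling

lemma norm_kernel_term_le (z : ℂ) {ζ : ℂ} (hζ : ‖ζ‖ ≤ 1) (k : ℕ) :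
    ‖conj (z ^ k) / moment m (2 * k) * ζ ^ k‖ ≤ ‖z‖ ^ k / moment m (2 * k) := by
  rw [norm_mul, norm_div, RCLike.norm_conj, norm_pow, norm_pow, Complex.norm_real,
    Real.norm_of_nonneg (moment_nonneg _)]
  exact mul_le_of_le_one_right (div_nonneg (by positivity) (moment_nonneg _))
    (pow_le_one₀ (norm_nonneg _) hζ)

lemma hasSum_kernelSeries (hm : IsRadialDoubling m) {z ζ : ℂ} (hz : ‖z‖ < 1) (hζ : ‖ζ‖ ≤ 1) :
    HasSum (fun k => conj (z ^ k) / moment m (2 * k) * ζ ^ k) (kernelSeries m z ζ) :=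
  (Summable.of_norm_bounded (hm.summable_pow_div_moment (norm_nonneg z) hz)
    fun k => norm_kernel_term_le z hζ k).hasSum

lemma hasSeries_kernelSeries (hm : IsRadialDoubling m) {z : ℂ} (hz : ‖z‖ < 1) :
    HasSeries (fun k => conj (z ^ k) / moment m (2 * k)) (kernelSeries m z) :=
  fun _ hζ => hm.hasSum_kernelSeries hz hζ.le

lemma exists_norm_kernelSeries_le (hm : IsRadialDoubling m) {z : ℂ} (hz : ‖z‖ < 1) :
    ∃ B : ℝ, ∀ ζ, ‖ζ‖ < 1 → ‖kernelSeries m z ζ‖ ≤ B :=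
  ⟨_, fun _ hζ => tsum_of_norm_bounded (hm.summable_pow_div_moment (norm_nonneg z) hz).hasSum
    fun k => norm_kernel_term_le z hζ.le k⟩

/-- Integration against the kernel, as a power series. -/
lemma hasSeries_projection (hm : IsRadialDoubling m) {F : ℂ → ℂ} (hF : Integrable F m) :
    HasSeries (fun k => (∫ ζ, F ζ * conj (ζ ^ k) ∂m) / moment m (2 * k))
      (fun z => ∫ ζ, F ζ * conj (kernelSeries m z ζ) ∂m) := by
  intro z hz
  set G : ℕ → ℂ → ℂ := fun k ζ => z ^ k / moment m (2 * k) * (F ζ * conj (ζ ^ k)) with hG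
  have hi : ∀ k, Integrable (G k) m := fun k =>
    (hm.integrable_mul_bounded hF (by fun_prop)).const_mul _
  have hGe : ∀ k ζ, G k ζ = F ζ * conj (conj (z ^ k) / moment m (2 * k) * ζ ^ k) := fun k ζ => by
    simp only [hG, map_mul, map_div₀, Complex.conj_conj, Complex.conj_ofReal]; ring
  have hle : ∀ k, ∫ ζ, ‖G k ζ‖ ∂m ≤ (∫ ζ, ‖F ζ‖ ∂m) * (‖z‖ ^ k / moment m (2 * k)) := by
    intro k
    rw [← integral_mul_const]
    refine integral_mono_ae (hi k).norm (hF.norm.mul_const _) (hm.ae_norm_lt.mono fun ζ hζ => ?_)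
    simp only [hGe]
    rw [norm_mul, RCLike.norm_conj]
    exact mul_le_mul_of_nonneg_left (norm_kernel_term_le z hζ.le k) (norm_nonneg _)
  have h1 := hasSum_integral_of_summable_integral_norm hi (Summable.of_nonneg_of_le
    (fun k => integral_nonneg fun _ => norm_nonneg _) hle
    ((hm.summable_pow_div_moment (norm_nonneg z) hz).mul_left _))
  have e : ∫ ζ, ∑' k, G k ζ ∂m = ∫ ζ, F ζ * conj (kernelSeries m z ζ) ∂m := by
    refine integral_congr_ae (hm.ae_norm_lt.mono fun ζ hζ => ?_)
    simp only [hGe]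
    rw [tsum_mul_left, kernelSeries, Complex.conj_tsum]
  rw [e] at h1
  refine (congrArg (HasSum · _) (funext fun k => ?_)).mpr (h1)
  beta_reduce
  simp only [hG]
  rw [integral_const_mul]; ring

/-- The kernel reproduces integrable analytic functions. -/
lemma integral_mul_conj_kernelSeries (hm : IsRadialDoubling m) {F : ℂ → ℂ}
    (hF : DifferentiableOn ℂ F unitDisc) (hFi : Integrable F m) {z : ℂ} (hz : ‖z‖ < 1) :
    ∫ ζ, F ζ * conj (kernelSeries m z ζ) ∂m = F z := by
  obtain ⟨u, hu⟩ := exists_hasSeries hF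
  refine (hm.hasSeries_projection hFi z hz).unique ?_
  simp only [hm.integral_mul_conj_pow hu hFi]
  refine (congrArg (HasSum · _) (funext fun k => ?_)).mpr (hu z hz)
  rw [mul_div_cancel_right₀]
  exact_mod_cast (hm.moment_pos _).ne'

/-- A function that reproduces the monomials is the kernel. -/
lemma eq_kernelSeries (hm : IsRadialDoubling m) {K : ℂ → ℂ} (hK : DifferentiableOn ℂ K unitDisc)
    (hKi : Integrable K m) {z : ℂ} (hz : ‖z‖ < 1) (h : ∀ k : ℕ, z ^ k = ∫ ζ, ζ ^ k * conj (K ζ) ∂m)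
    {ζ : ℂ} (hζ : ‖ζ‖ < 1) : K ζ = kernelSeries m z ζ := by
  obtain ⟨u, hu⟩ := exists_hasSeries hK
  refine (hu ζ hζ).unique ?_
  refine (congrArg (HasSum · _) (funext fun k => ?_)).mpr (hm.hasSeries_kernelSeries hz ζ hζ)
  beta_reduce
  have h1 := hm.integral_mul_conj_pow hu hKi k
  have h2 : conj (z ^ k) = u k * moment m (2 * k) := by
    rw [h k, ← integral_conj, ← h1]
    simp only [map_mul, Complex.conj_conj, mul_comm]
  rw [h2, mul_div_cancel_right₀]
  exact_mod_cast (hm.moment_pos _).ne'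

end IsRadialDoubling

end

/-! ### The two implications for a radial measure -/

section

variable {m : Measure ℂ}

namespace IsRadialDoubling

lemma integrable_of_eLpNorm'_lt_top (hm : IsRadialDoubling m) {F : ℂ → ℂ} {p : ℝ} (hp : 1 ≤ p)
    (hF : AEStronglyMeasurable F m) (h : eLpNorm' F p m < ∞) : Integrable F m := by
  have := hm.finite
  have h1 := eLpNorm'_lt_top_of_eLpNorm'_lt_top_of_exponent_le hF h zero_le_one hp
  refine ⟨hF, ?_⟩
  simpa [eLpNorm'_eq_lintegral_enorm, HasFiniteIntegral] using h1

lemma eLpNorm'_lt_top_of_bound (hm : IsRadialDoubling m) {p : ℝ} (hp : 0 < p) {f : ℂ → ℂ} {B : ℝ}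
    (hB : ∀ z, ‖z‖ < 1 → ‖f z‖ ≤ B) : eLpNorm' f p m < ∞ := by
  have := hm.finite
  refine (eLpNorm'_mono_enorm_ae (g := fun _ => B) hp.le
    (hm.ae_norm_lt.mono fun z hz => ?_)).trans_lt ?_
  · rw [← ofReal_norm, ← ofReal_norm]
    exact ENNReal.ofReal_le_ofReal ((hB z hz).trans (Real.le_norm_self _))
  · rw [eLpNorm'_const _ hp]
    exact ENNReal.mul_lt_top enorm_lt_top
      (ENNReal.rpow_lt_top_of_nonneg (by positivity) (measure_ne_top _ _))

lemma eLpNorm'_eval_lt_top (hm : IsRadialDoubling m) {p : ℝ} (hp : 0 < p) (a : Polynomial ℂ) :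
    eLpNorm' (fun z => a.eval z) p m < ∞ := by
  obtain ⟨B, hB⟩ := (isCompact_closedBall (0 : ℂ) 1).exists_bound_of_continuousOn
    a.continuous.continuousOn
  exact hm.eLpNorm'_lt_top_of_bound hp fun z hz => hB z (by simpa using hz.le)

lemma integral_mul_conj_blockPoly (hm : IsRadialDoubling m) {F : ℂ → ℂ} (hF : Integrable F m)
    (h : ℕ → ℂ) (R : ℕ) : ∫ z, F z * conj ((blockPoly h 0 R).eval z) ∂m =
      ∑ k ∈ Finset.Ico 0 R, conj (h k) * ∫ z, F z * conj (z ^ k) ∂m := by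
  simp only [eval_blockPoly, map_sum, Finset.mul_sum, map_mul]
  rw [integral_finsetSum]
  · refine Finset.sum_congr rfl fun k _ => ?_
    rw [← integral_const_mul]
    refine integral_congr_ae (Filter.Eventually.of_forall fun z => ?_)
    ring
  · exact fun k _ => hm.integrable_mul_bounded hF (by fun_prop)

lemma integral_mul_conj_eval (hm : IsRadialDoubling m) {F : ℂ → ℂ} (hF : Integrable F m)
    (H : Polynomial ℂ) : ∫ z, F z * conj (H.eval z) ∂m =
      ∑ k ∈ Finset.Ico 0 (H.natDegree + 1), conj (H.coeff k) * ∫ z, F z * conj (z ^ k) ∂m := by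
  rw [← hm.integral_mul_conj_blockPoly hF]
  congr! 4
  rw [blockPoly, ← Finset.range_eq_Ico]
  exact congrArg _ H.as_sum_range_C_mul_X_pow

lemma moment_ne_zero (hm : IsRadialDoubling m) (k : ℕ) : (moment m k : ℂ) ≠ 0 := by
  exact_mod_cast (hm.moment_pos k).ne'

/-- The projection of a function and the function itself induce the same functional on
polynomials. -/
lemma integral_projection_mul_conj_eval (hm : IsRadialDoubling m) {F : ℂ → ℂ}
    (hF : Integrable F m)
    (hP : Integrable (fun z => ∫ ζ, F ζ * conj (kernelSeries m z ζ) ∂m) m) (H : Polynomial ℂ) :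
    ∫ z, (∫ ζ, F ζ * conj (kernelSeries m z ζ) ∂m) * conj (H.eval z) ∂m =
      ∫ z, F z * conj (H.eval z) ∂m := by
  rw [hm.integral_mul_conj_eval hP, hm.integral_mul_conj_eval hF]
  refine Finset.sum_congr rfl fun k _ => ?_
  rw [hm.integral_mul_conj_pow (hm.hasSeries_projection hF) hP,
    div_mul_cancel₀ _ (hm.moment_ne_zero _)]

lemma eLpNorm'_mul_conj_le {f g : ℂ → ℂ} (hf : AEStronglyMeasurable f m)
    (hg : AEStronglyMeasurable g m) {p q s : ℝ} (hq : 0 < q) (hqp : q < p)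
    (hs : 1 / s = 1 / q - 1 / p) :
    eLpNorm' (fun z => f z * conj (g z)) q m ≤ eLpNorm' f s m * eLpNorm' g p m := by
  have h1 : 1 / q = 1 / p + 1 / s := by rw [hs]; ring
  have h := eLpNorm'_le_eLpNorm'_mul_eLpNorm' hg hf (fun x y : ℂ => y * conj x) 1
    (Filter.Eventually.of_forall fun z => by
      rw [nnnorm_mul, RCLike.nnnorm_conj, one_mul, mul_comm]) hq hqp h1
  rwa [ENNReal.coe_one, one_mul, mul_comm] at h

/-- Symbols in the space with exponent `s` induce bounded operators. -/
theorem hankel_bounded_of_mem (hm : IsRadialDoubling m) {p q s : ℝ} (hq : 1 < q) (hqp : q < p)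
    (hs : 1 / s = 1 / q - 1 / p) {f : ℂ → ℂ} (hf : AEStronglyMeasurable f m)
    (hfs : eLpNorm' f s m < ∞) :
    ∃ C : ℝ, 0 ≤ C ∧ ∀ g : ℂ → ℂ, AEStronglyMeasurable g m → eLpNorm' g p m < ∞ →
      Integrable (fun z => f z * conj (g z)) m ∧
      eLpNorm' (fun z => ∫ ζ, f ζ * conj (g ζ) * conj (kernelSeries m z ζ) ∂m) q m ≤
        ENNReal.ofReal C * eLpNorm' g p m := by
  have hqr := Real.HolderConjugate.conjExponent hq
  set r := q.conjExponent with hr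
  obtain ⟨P, hP⟩ := exists_nat_ge (max q r)
  obtain ⟨D⟩ := hm.nonempty_blockData P
  obtain ⟨C, hC, hfun⟩ := hm.exists_eLpNorm'_le_of_functional D hqr
    ((le_max_left _ _).trans hP) ((le_max_right _ _).trans hP)
  refine ⟨C * (eLpNorm' f s m).toReal, by positivity, fun g hg hgp => ?_⟩
  have hFm : AEStronglyMeasurable (fun z => f z * conj (g z)) m :=
    hf.mul (Complex.continuous_conj.comp_aestronglyMeasurable hg)
  have hle := eLpNorm'_mul_conj_le hf hg (by linarith) hqp hs
  have hlt := hle.trans_lt (ENNReal.mul_lt_top hfs hgp)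
  have hF := hm.integrable_of_eLpNorm'_lt_top hq.le hFm hlt
  refine ⟨hF, ?_⟩
  have h := hfun _ _ ((eLpNorm' f s m).toReal * (eLpNorm' g p m).toReal) (by positivity)
    (hm.hasSeries_projection hF) fun R h => ?_
  · refine h.trans (le_of_eq ?_)
    rw [← mul_assoc, ENNReal.ofReal_mul (by positivity), ENNReal.ofReal_toReal hgp.ne]
  -- The coefficients of the projection define the same functional on polynomials as $f\bar g$, to
  -- which Hölder's inequality applies. The argument uses only coefficients, so the projection need
  -- not be known to be integrable.
  · have e : ∑ k ∈ Finset.Ico 0 R, (∫ ζ, f ζ * conj (g ζ) * conj (ζ ^ k) ∂m) / moment m (2 * k) *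
        conj (h k) * moment m (2 * k) =
        ∫ z, f z * conj (g z) * conj ((blockPoly h 0 R).eval z) ∂m := by
      rw [hm.integral_mul_conj_blockPoly hF]
      refine Finset.sum_congr rfl fun k _ => ?_
      have := hm.moment_ne_zero (2 * k)
      field_simp
    rw [e, ENNReal.ofReal_mul (by positivity), ENNReal.ofReal_toReal hgp.ne,
      ENNReal.ofReal_toReal hfs.ne]
    refine (enorm_integral_mul_le hqr hFm (Continuous.aestronglyMeasurable (by fun_prop))).trans ?_
    refine mul_le_mul' hle (le_of_eq ?_)
    exact eLpNorm'_congr_norm_ae (Filter.Eventually.of_forall fun z => RCLike.norm_conj _)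

/-- Analytic symbols of bounded operators belong to the space with exponent `s`. -/
theorem mem_of_hankel_bounded (hm : IsRadialDoubling m) {p q s : ℝ} (hq : 1 < q) (hqp : q < p)
    (hs : 1 / s = 1 / q - 1 / p) {f : ℂ → ℂ} (hf : DifferentiableOn ℂ f unitDisc) {C : ℝ}
    (hC : 0 ≤ C)
    (hint : ∀ a : Polynomial ℂ, Integrable (fun z => f z * conj (a.eval z)) m)
    (hbd : ∀ a : Polynomial ℂ,
      eLpNorm' (fun z => ∫ ζ, f ζ * conj (a.eval ζ) * conj (kernelSeries m z ζ) ∂m) q m ≤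
        ENNReal.ofReal C * eLpNorm' (fun z => a.eval z) p m) :
    eLpNorm' f s m < ∞ := by
  have hqr := Real.HolderConjugate.conjExponent hq
  set r := q.conjExponent with hr
  have hp1 : 1 < p := hq.trans hqp
  have hp0 : 0 < p := by linarith
  have hq0 : 0 < q := by linarith
  have hs1 : 1 < s := by
    have h1 : 0 < 1 / s := by
      rw [hs, sub_pos]; exact one_div_lt_one_div_of_lt hq0 hqp
    have h2 : 1 / s < 1 := by
      have h3 : 1 / q < 1 := by rw [div_lt_one hq0]; exact hq
      have h4 : 0 < 1 / p := by positivity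
      linarith
    rw [one_div, inv_pos] at h1
    rwa [div_lt_one h1] at h2
  have hst := Real.HolderConjugate.conjExponent hs1
  set t := s.conjExponent with ht
  -- With $r=q'$ and $t=s'$, the relation for $s$ becomes the one required for factoring $A^t$
  -- through exponents $p$ and $r$.
  have hprt : 1 / p + 1 / r = 1 / t := by
    have h1 := hqr.inv_add_inv_eq_one
    have h2 := hst.inv_add_inv_eq_one
    rw [← one_div, ← one_div] at h1 h2
    linarith
  obtain ⟨P, hP⟩ := exists_nat_ge (max (max p r) (max s t))
  simp only [max_le_iff] at hP
  obtain ⟨D⟩ := hm.nonempty_blockData P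
  obtain ⟨C₁, hC1, hfac⟩ := hm.exists_functional_le_of_bilinear D hp1 hqr.symm.lt hst.symm.lt hprt
    hP.1.1 hP.1.2 hP.2.2
  obtain ⟨C₂, hC2, hfun⟩ := hm.exists_eLpNorm'_le_of_functional D hst hP.2.1 hP.2.2
  have hfi : Integrable f m := by simpa using hint 1
  -- The bilinear form is the pairing of $b$ with the projection of $f\bar a$; the latter is
  -- integrable by the assumed bound, so Hölder's inequality applies.
  have hbil : ∀ a b : Polynomial ℂ, ‖∫ z, f z * conj (a.eval z) * conj (b.eval z) ∂m‖ₑ ≤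
      ENNReal.ofReal C * eLpNorm' (fun z => a.eval z) p m *
        eLpNorm' (fun z => b.eval z) r m := by
    intro a b
    have hPm := hm.aestronglyMeasurable
      (hm.hasSeries_projection (hint a)).differentiableOn.continuousOn
    have hPi := hm.integrable_of_eLpNorm'_lt_top hq.le hPm ((hbd a).trans_lt
      (ENNReal.mul_lt_top ENNReal.ofReal_lt_top (hm.eLpNorm'_eval_lt_top hp0 a)))
    rw [← hm.integral_projection_mul_conj_eval (hint a) hPi]
    refine (enorm_integral_mul_le hqr hPm (Continuous.aestronglyMeasurable (by fun_prop))).trans ?_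
    refine mul_le_mul' (hbd a) (le_of_eq ?_)
    exact eLpNorm'_congr_norm_ae (Filter.Eventually.of_forall fun z => RCLike.norm_conj _)
  have hH := hfac f C hfi hC hbil
  obtain ⟨u, hu⟩ := exists_hasSeries hf
  refine (hfun f u (C₁ * C) (by positivity) hu fun R h => ?_).trans_lt ENNReal.ofReal_lt_top
  convert hH (blockPoly h 0 R) using 2
  rw [hm.integral_mul_conj_blockPoly hfi]
  refine Finset.sum_congr rfl fun k _ => ?_
  rw [hm.integral_mul_conj_pow hu hfi]
  ring

end IsRadialDoubling

end

/-! ### From a doubling weight to a radial measure with doubling moments -/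

section

/-- The measure `ω dA` on the unit disc. -/
def weightMeasure (ω : ℂ → ℝ) : Measure ℂ :=
  areaMeasure.withDensity fun z => ENNReal.ofReal (ω z)

/-- The integral over a rectangle of a function of the first variable; no measurability is
needed. -/
lemma lintegral_prod_fst {α β : Type*} [MeasurableSpace α] [MeasurableSpace β] (μ : Measure α)
    (ν : Measure β) [IsFiniteMeasure ν] (h : α → ℝ≥0∞) :
    ∫⁻ x, h x.1 ∂μ.prod ν = (∫⁻ x, h x ∂μ) * ν univ := by
  refine le_antisymm ((lintegral_prod_le _).trans (le_of_eq ?_)) ?_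
  · simp only [lintegral_const]
    exact lintegral_mul_const' _ _ (measure_ne_top _ _)
  · have h1 := lintegral_map_le (μ := μ.prod ν) h Prod.fst
    rwa [Measure.map_fst_prod, lintegral_smul_measure, smul_eq_mul, mul_comm] at h1

lemma areaMeasure_ae_mem : ∀ᵐ z ∂areaMeasure, z ∈ unitDisc :=
  Measure.ae_smul_measure (ae_restrict_mem isOpen_unitDisc.measurableSet) _

lemma norm_circlePt_mul (t : UnitAddCircle) (z : ℂ) : ‖circlePt t * z‖ = ‖z‖ := by
  rw [norm_mul, norm_circlePt, one_mul]

lemma measurePreserving_circlePt_mul (t : UnitAddCircle) :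
    MeasurePreserving (fun z => circlePt t * z) areaMeasure areaMeasure := by
  obtain ⟨c, hc⟩ : ∃ c : Circle, (c : ℂ) = circlePt t := ⟨_, (fourier_apply ..).symm⟩
  have h : MeasurePreserving (fun z => circlePt t * z) volume volume := by
    rw [← hc]; exact (rotation c).measurePreserving
  refine MeasurePreserving.smul_measure ?_ _
  have h1 := h.restrict_preimage isOpen_unitDisc.measurableSet
  have e : (fun z => circlePt t * z) ⁻¹' unitDisc = unitDisc := by
    ext z
    rw [mem_preimage, mem_unitDisc, mem_unitDisc, norm_circlePt_mul]
  rwa [e] at h1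

lemma measurableEmbedding_circlePt_mul (t : UnitAddCircle) :
    MeasurableEmbedding (fun z => circlePt t * z) := by
  have h : circlePt t ≠ 0 := norm_ne_zero_iff.1 (by rw [norm_circlePt]; exact one_ne_zero)
  exact (Homeomorph.mulLeft₀ _ h).measurableEmbedding

variable {ω : ℂ → ℝ}

lemma IsWeight.aemeasurable (h : IsWeight ω) :
    AEMeasurable (fun z => ENNReal.ofReal (ω z)) areaMeasure :=
  h.integrable.aestronglyMeasurable.aemeasurable.ennreal_ofReal

lemma IsWeight.lintegral_weightMeasure (h : IsWeight ω) (g : ℂ → ℝ≥0∞) :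
    ∫⁻ z, g z ∂weightMeasure ω = ∫⁻ z, g z * ENNReal.ofReal (ω z) ∂areaMeasure := by
  rw [weightMeasure, lintegral_withDensity_eq_lintegral_mul_non_measurable₀ _ h.aemeasurable
    (Filter.Eventually.of_forall fun _ => ENNReal.ofReal_lt_top)]
  simp only [Pi.mul_apply, mul_comm]

lemma IsWeight.bergmanNorm_eq (h : IsWeight ω) (p : ℝ) (f : ℂ → ℂ) :
    bergmanNorm ω p f = eLpNorm' f p (weightMeasure ω) := by
  rw [bergmanNorm, eLpNorm'_eq_lintegral_enorm, h.lintegral_weightMeasure]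

lemma IsWeight.toReal_smul_ae_eq (h : IsWeight ω) (F : ℂ → ℂ) :
    (fun z => (ENNReal.ofReal (ω z)).toReal • F z) =ᵐ[areaMeasure] fun z => F z * (ω z : ℂ) := by
  filter_upwards [areaMeasure_ae_mem] with z hz
  rw [ENNReal.toReal_ofReal (h.nonneg z hz), Complex.real_smul, mul_comm]

lemma IsWeight.integral_weightMeasure (h : IsWeight ω) (F : ℂ → ℂ) :
    ∫ z, F z ∂weightMeasure ω = ∫ z, F z * (ω z : ℂ) ∂areaMeasure := by
  rw [weightMeasure, integral_withDensity_eq_integral_toReal_smul₀ h.aemeasurable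
    (Filter.Eventually.of_forall fun _ => ENNReal.ofReal_lt_top)]
  exact integral_congr_ae (h.toReal_smul_ae_eq F)

lemma IsWeight.integrable_weightMeasure (h : IsWeight ω) {F : ℂ → ℂ} :
    Integrable F (weightMeasure ω) ↔ Integrable (fun z => F z * (ω z : ℂ)) areaMeasure := by
  rw [weightMeasure, integrable_withDensity_iff_integrable_smul₀' h.aemeasurable
    (Filter.Eventually.of_forall fun _ => ENNReal.ofReal_lt_top)]
  exact integrable_congr (h.toReal_smul_ae_eq F)

lemma IsWeight.isFiniteMeasure (h : IsWeight ω) : IsFiniteMeasure (weightMeasure ω) := by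
  have h1 := h.lintegral_weightMeasure fun _ => 1
  refine ⟨?_⟩
  rw [lintegral_one] at h1
  rw [h1]
  simp only [one_mul]
  refine (lintegral_mono fun z => ?_).trans_lt h.integrable.hasFiniteIntegral
  exact Real.ofReal_le_enorm (ω z)

lemma weightMeasure_ae_mem (ω : ℂ → ℝ) : ∀ᵐ z ∂weightMeasure ω, z ∈ unitDisc :=
  (withDensity_absolutelyContinuous _ _).ae_le areaMeasure_ae_mem

lemma IsRadialWeight.measurePreserving (h : IsRadialWeight ω) (t : UnitAddCircle) :
    MeasurePreserving (fun z => circlePt t * z) (weightMeasure ω) (weightMeasure ω) := by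
  have hr := measurePreserving_circlePt_mul t
  refine ⟨hr.measurable, Measure.ext fun s hs => ?_⟩
  rw [Measure.map_apply hr.measurable hs, weightMeasure, withDensity_apply _ hs,
    withDensity_apply _ (hr.measurable hs),
    ← hr.setLIntegral_comp_preimage_emb (measurableEmbedding_circlePt_mul t) _ s]
  refine lintegral_congr_ae (ae_restrict_of_ae (areaMeasure_ae_mem.mono fun z hz => ?_))
  have hz' : circlePt t * z ∈ unitDisc := by
    rw [mem_unitDisc, norm_circlePt_mul]; exact mem_unitDisc.1 hz
  simp only
  rw [h.radial z hz, h.radial _ hz', norm_circlePt_mul]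

/-- The mass of an annulus, in polar coordinates. -/
lemma IsRadialWeight.weightMeasure_annulus (h : IsRadialWeight ω) {r : ℝ} (hr : 0 ≤ r) :
    weightMeasure ω {z | r < ‖z‖} =
      2 * ∫⁻ t in Ioo r 1, ENNReal.ofReal t * ENNReal.ofReal (ω (t : ℂ)) := by
  have hs : MeasurableSet {z : ℂ | r < ‖z‖} := (isOpen_lt continuous_const continuous_norm).measurableSet
  set k : ℝ → ℝ≥0∞ := (Ioo r 1).indicator fun t => ENNReal.ofReal t * ENNReal.ofReal (ω (t : ℂ))
    with hk
  have h1 : ∫⁻ z in unitDisc ∩ {z | r < ‖z‖}, ENNReal.ofReal (ω z) =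
      (∫⁻ t in Ioo r 1, ENNReal.ofReal t * ENNReal.ofReal (ω (t : ℂ))) *
        ENNReal.ofReal (2 * Real.pi) := by
    rw [← lintegral_indicator (isOpen_unitDisc.measurableSet.inter hs),
      ← Complex.lintegral_comp_polarCoord_symm, polarCoord_target]
    have e : ∀ p ∈ Ioi (0 : ℝ) ×ˢ Ioo (-Real.pi) Real.pi, ENNReal.ofReal p.1 •
        (unitDisc ∩ {z | r < ‖z‖}).indicator (fun z => ENNReal.ofReal (ω z))
          (Complex.polarCoord.symm p) = k p.1 := by
      intro p hp
      have hp0 : 0 < p.1 := hp.1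
      have hn : ‖Complex.polarCoord.symm p‖ = p.1 := by
        rw [Complex.norm_polarCoord_symm, abs_of_pos hp0]
      by_cases hmem : Complex.polarCoord.symm p ∈ unitDisc ∩ {z | r < ‖z‖}
      · have hI : p.1 ∈ Ioo r 1 := by
          rw [← hn]; exact ⟨hmem.2, mem_unitDisc.1 hmem.1⟩
        rw [indicator_of_mem hmem, hk, indicator_of_mem hI, h.radial _ hmem.1, hn, smul_eq_mul]
      · have hI : p.1 ∉ Ioo r 1 := by
          rw [← hn]; exact fun hI => hmem ⟨mem_unitDisc.2 hI.2, hI.1⟩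
        rw [indicator_of_notMem hmem, hk, indicator_of_notMem hI, smul_zero]
    -- The radial profile $t\mapsto\omega(t)$ is not assumed measurable, so `lintegral_prod_fst`
    -- takes the place of Tonelli's theorem.
    rw [setLIntegral_congr_fun (measurableSet_Ioi.prod measurableSet_Ioo) e,
      Measure.volume_eq_prod, ← Measure.prod_restrict, lintegral_prod_fst,
      Measure.restrict_apply_univ, Real.volume_Ioo, hk, lintegral_indicator measurableSet_Ioo,
      Measure.restrict_restrict measurableSet_Ioo]
    congr 2
    · exact congrArg _ (inter_eq_left.2 fun t ht => hr.trans_lt ht.1)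
    · ring
  have hpi : (ENNReal.ofReal Real.pi)⁻¹ * ENNReal.ofReal (2 * Real.pi) = 2 := by
    rw [mul_comm (2 : ℝ), ENNReal.ofReal_mul Real.pi_pos.le, ← mul_assoc, ENNReal.inv_mul_cancel
      (by simpa using Real.pi_pos) ENNReal.ofReal_ne_top]
    simp
  rw [weightMeasure, withDensity_apply _ hs, areaMeasure, Measure.restrict_smul,
    lintegral_smul_measure, Measure.restrict_restrict hs, inter_comm, h1, smul_eq_mul,
    mul_comm (∫⁻ _ in _, _), ← mul_assoc, hpi]

lemma IsRadialWeight.weightMeasure_annulus_le (h : IsRadialWeight ω) {r : ℝ} (hr : 0 ≤ r) :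
    weightMeasure ω {z | r < ‖z‖} ≤ 2 * tail ω r := by
  rw [h.weightMeasure_annulus hr, tail]
  refine mul_le_mul' le_rfl (setLIntegral_mono' measurableSet_Ioo fun t ht => ?_)
  exact mul_le_of_le_one_left' (ENNReal.ofReal_le_one.2 ht.2.le)

/-- The density $2t$ of polar coordinates is at least $1$ once $t\ge1/2$. -/
lemma IsRadialWeight.le_weightMeasure_annulus (h : IsRadialWeight ω) {r : ℝ} (hr : 1 / 2 ≤ r) :
    tail ω r ≤ weightMeasure ω {z | r < ‖z‖} := by
  rw [h.weightMeasure_annulus (by linarith), tail, ← lintegral_const_mul' _ _ (by simp)]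
  refine setLIntegral_mono' measurableSet_Ioo fun t ht => ?_
  rw [← mul_assoc]
  refine le_mul_of_one_le_left' ?_
  have e : (2 : ℝ≥0∞) = ENNReal.ofReal 2 := by simp
  rw [e, ← ENNReal.ofReal_mul (by norm_num), ENNReal.one_le_ofReal]
  linarith [ht.1]

/-- Since $((1+r)/2)^2\ge r$, the annulus beyond $(1+r)/2$ lies in $\{|z|^2>r\}$; and
$(1+r)/2\ge1/2$, where tails and masses are comparable. The form with $|z|^2$ suits moments, in
which squaring doubles the order. -/
lemma IsDoublingWeight.exists_annulus_le (h : IsDoublingWeight ω) : ∃ C : ℝ, 1 ≤ C ∧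
    ∀ r, 0 ≤ r → weightMeasure ω {z | r < ‖z‖} ≤
      ENNReal.ofReal C * weightMeasure ω {z | r < ‖z‖ ^ 2} := by
  obtain ⟨C, hC1, hC⟩ := h.doubling
  refine ⟨2 * C, by linarith, fun r hr => ?_⟩
  rcases lt_or_ge r 1 with h1 | h1
  · calc weightMeasure ω {z | r < ‖z‖} ≤ 2 * tail ω r := h.weightMeasure_annulus_le hr
      _ ≤ 2 * (ENNReal.ofReal C * tail ω ((1 + r) / 2)) := mul_le_mul' le_rfl (hC r ⟨hr, h1⟩)
      _ ≤ 2 * (ENNReal.ofReal C * weightMeasure ω {z | (1 + r) / 2 < ‖z‖}) :=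
          mul_le_mul' le_rfl (mul_le_mul' le_rfl (h.le_weightMeasure_annulus (by linarith)))
      _ ≤ 2 * (ENNReal.ofReal C * weightMeasure ω {z | r < ‖z‖ ^ 2}) := by
          refine mul_le_mul' le_rfl (mul_le_mul' le_rfl (measure_mono fun z hz => ?_))
          simp only [mem_ofPred_eq] at hz ⊢
          nlinarith [sq_nonneg (1 - r), norm_nonneg z]
      _ = _ := by
          rw [ENNReal.ofReal_mul (by norm_num), mul_assoc]; simp
  · refine le_of_eq_of_le ?_ zero_le
    rw [measure_eq_zero_iff_ae_notMem]
    exact (weightMeasure_ae_mem ω).mono fun z hz => by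
      simpa using (mem_unitDisc.1 hz).le.trans h1

lemma IsDoublingWeight.weightMeasure_half_pos (h : IsDoublingWeight ω) :
    0 < weightMeasure ω {z | 1 / 2 < ‖z‖} :=
  (h.tail_pos (1 / 2) ⟨by norm_num, by norm_num⟩).trans_le (h.le_weightMeasure_annulus le_rfl)

lemma integrable_norm_pow_weightMeasure (h : IsWeight ω) (k : ℕ) :
    Integrable (fun z : ℂ => ‖z‖ ^ k) (weightMeasure ω) := by
  have := h.isFiniteMeasure
  refine Integrable.of_bound (continuous_norm.pow k).aestronglyMeasurable 1
    ((weightMeasure_ae_mem ω).mono fun z hz => ?_)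
  rw [norm_pow, norm_norm]
  exact pow_le_one₀ (norm_nonneg _) (mem_unitDisc.1 hz).le

lemma IsWeight.ofReal_moment (h : IsWeight ω) (k : ℕ) :
    ENNReal.ofReal (moment (weightMeasure ω) k) = ∫⁻ s in Ioi (0 : ℝ), weightMeasure ω {z | s < ‖z‖ ^ k} := by
  rw [moment, ofReal_integral_eq_lintegral_ofReal (integrable_norm_pow_weightMeasure h k)
    (Filter.Eventually.of_forall fun z => by positivity)]
  exact lintegral_eq_lintegral_meas_lt _ (Filter.Eventually.of_forall fun z => by positivity)
    (continuous_norm.pow k).measurable.aemeasurable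

/-- The measure of a doubling weight is a rotation invariant measure with doubling moments. -/
lemma IsDoublingWeight.isRadialDoubling (h : IsDoublingWeight ω) :
    IsRadialDoubling (weightMeasure ω) := by
  have hw : IsWeight ω := h.toIsWeight
  have hfin := hw.isFiniteMeasure
  have hpos := h.weightMeasure_half_pos
  refine ⟨hfin, weightMeasure_ae_mem ω, h.measurePreserving,
    (hpos.trans_le (measure_mono (subset_univ _))).ne', ?_⟩
  obtain ⟨C, hC1, hC⟩ := h.exists_annulus_le
  have hanti : ∀ i j, i ≤ j → moment (weightMeasure ω) j ≤ moment (weightMeasure ω) i :=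
    fun i j hij => integral_mono_ae (integrable_norm_pow_weightMeasure hw j)
      (integrable_norm_pow_weightMeasure hw i) ((weightMeasure_ae_mem ω).mono fun z hz =>
        pow_le_pow_of_le_one (norm_nonneg _) (mem_unitDisc.1 hz).le hij)
  -- Layer-cake formula: the level sets of $|z|^k$ and $|z|^{2k}$ at height $s$ are $\{|z|>\rho\}$
  -- and $\{|z|^2>\rho\}$ with $\rho=s^{1/k}$.
  have hstep : ∀ k, k ≠ 0 → moment (weightMeasure ω) k ≤ C * moment (weightMeasure ω) (2 * k) := by
    intro k hk
    have hm0 : 0 ≤ moment (weightMeasure ω) (2 * k) := IsRadialDoubling.moment_nonneg _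
    rw [← ENNReal.ofReal_le_ofReal_iff (by positivity), ENNReal.ofReal_mul (by linarith),
      hw.ofReal_moment, hw.ofReal_moment, ← lintegral_const_mul' _ _ ENNReal.ofReal_ne_top]
    refine setLIntegral_mono' measurableSet_Ioi fun s hs => ?_
    have hs0 : 0 ≤ s := le_of_lt hs
    have e : (s ^ ((k : ℝ)⁻¹)) ^ k = s := Real.rpow_inv_natCast_pow hs0 hk
    have hr0 : 0 ≤ s ^ ((k : ℝ)⁻¹) := Real.rpow_nonneg hs0 _
    have e1 : {z : ℂ | s < ‖z‖ ^ k} = {z : ℂ | s ^ ((k : ℝ)⁻¹) < ‖z‖} := Set.ext fun z => by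
      rw [mem_ofPred_eq, mem_ofPred_eq, ← pow_lt_pow_iff_left₀ hr0 (norm_nonneg _) hk, e]
    have e2 : {z : ℂ | s < ‖z‖ ^ (2 * k)} = {z : ℂ | s ^ ((k : ℝ)⁻¹) < ‖z‖ ^ 2} := Set.ext fun z => by
      rw [mem_ofPred_eq, mem_ofPred_eq, ← pow_lt_pow_iff_left₀ hr0 (by positivity) hk, e, pow_mul]
    rw [e1, e2]
    exact hC _ hr0
  have h1pos : 0 < moment (weightMeasure ω) 1 := by
    have h2 := mul_meas_ge_le_integral_of_nonneg (μ := weightMeasure ω)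
      (Filter.Eventually.of_forall fun z => by positivity)
      (integrable_norm_pow_weightMeasure hw 1) (1 / 2)
    refine lt_of_lt_of_le (mul_pos (by norm_num) ?_) h2
    rw [measureReal_def, ENNReal.toReal_pos_iff]
    refine ⟨hpos.trans_le (measure_mono fun z hz => ?_), measure_lt_top _ _⟩
    simpa using (le_of_lt hz : (1 / 2 : ℝ) ≤ ‖z‖)
  -- For $k\ge1$ two doublings reach the order $4k\ge2k+1$, whence $C^2$. For $k=0$ doubling the
  -- order gives nothing, and the quotient of the first two moments is used.
  refine ⟨max (C ^ 2) (moment (weightMeasure ω) 0 / moment (weightMeasure ω) 1), fun k => ?_⟩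
  rcases eq_or_ne k 0 with rfl | hk
  · refine le_trans (le_of_eq ?_) (mul_le_mul_of_nonneg_right (le_max_right _ _) h1pos.le)
    rw [div_mul_cancel₀ _ h1pos.ne']
  · refine le_trans ?_ (mul_le_mul_of_nonneg_right (le_max_left _ _) (IsRadialDoubling.moment_nonneg _))
    calc moment (weightMeasure ω) k ≤ C * moment (weightMeasure ω) (2 * k) := hstep k hk
      _ ≤ C * (C * moment (weightMeasure ω) (2 * (2 * k))) :=
          mul_le_mul_of_nonneg_left (hstep (2 * k) (by omega)) (by linarith)
      _ ≤ C * (C * moment (weightMeasure ω) (2 * k + 1)) :=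
          mul_le_mul_of_nonneg_left (mul_le_mul_of_nonneg_left (hanti _ _ (by omega))
            (by linarith)) (by linarith)
      _ = _ := by ring

end

/-! ### The small Hankel operator as a projection, and the theorem -/

section

variable {ω : ℂ → ℝ}

namespace IsDoublingWeight

lemma memBergman_iff (h : IsDoublingWeight ω) {p : ℝ} {f : ℂ → ℂ} : MemBergman ω p f ↔
    DifferentiableOn ℂ f unitDisc ∧ eLpNorm' f p (weightMeasure ω) < ∞ := by
  rw [MemBergman, h.bergmanNorm_eq]

lemma integrable_of_memBergman (h : IsDoublingWeight ω) {p : ℝ} (hp : 1 ≤ p) {f : ℂ → ℂ}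
    (hf : MemBergman ω p f) : Integrable f (weightMeasure ω) :=
  h.isRadialDoubling.integrable_of_eLpNorm'_lt_top hp
    (h.isRadialDoubling.aestronglyMeasurable hf.1.continuousOn) (h.memBergman_iff.1 hf).2

lemma memBergman_of_bound (h : IsDoublingWeight ω) {p : ℝ} (hp : 0 < p) {f : ℂ → ℂ}
    (hf : DifferentiableOn ℂ f unitDisc) {B : ℝ} (hB : ∀ z, ‖z‖ < 1 → ‖f z‖ ≤ B) :
    MemBergman ω p f :=
  h.memBergman_iff.2 ⟨hf, h.isRadialDoubling.eLpNorm'_lt_top_of_bound hp hB⟩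

/-- Existence has to be shown because `reproducingKernel` is zero by default. For fixed $z$ the
kernel series is bounded on the disc, hence lies in $A^2_\omega$. -/
lemma isReproducingKernelAt (h : IsDoublingWeight ω) {z : ℂ} (hz : ‖z‖ < 1) :
    IsReproducingKernelAt ω z (kernelSeries (weightMeasure ω) z) := by
  have hm := h.isRadialDoubling
  obtain ⟨B, hB⟩ := hm.exists_norm_kernelSeries_le hz
  refine ⟨h.memBergman_of_bound (by norm_num) (hm.hasSeries_kernelSeries hz).differentiableOn hB,
    fun f hf => ?_⟩
  rw [← h.integral_weightMeasure, hm.integral_mul_conj_kernelSeries hf.1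
    (h.integrable_of_memBergman (by norm_num) hf) hz]

/-- The reproducing kernel is given by its power series. -/
lemma reproducingKernel_eq (h : IsDoublingWeight ω) {z ζ : ℂ} (hz : ‖z‖ < 1) (hζ : ‖ζ‖ < 1) :
    reproducingKernel ω z ζ = kernelSeries (weightMeasure ω) z ζ := by
  have hex : ∃ K : ℂ → ℂ, IsReproducingKernelAt ω z K := ⟨_, h.isReproducingKernelAt hz⟩
  have hK : IsReproducingKernelAt ω z (reproducingKernel ω z) := by
    rw [reproducingKernel, dif_pos hex]; exact hex.choose_spec
  refine h.isRadialDoubling.eq_kernelSeries hK.1.1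
    (h.integrable_of_memBergman (by norm_num) hK.1) hz (fun k => ?_) hζ
  rw [h.integral_weightMeasure]
  refine hK.2 (fun ζ => ζ ^ k) (h.memBergman_of_bound (by norm_num)
    (differentiable_id.pow k).differentiableOn (B := 1) fun w hw => ?_)
  rw [norm_pow]
  exact pow_le_one₀ (norm_nonneg _) hw.le

lemma hankelIntegrand_ae_eq (h : IsDoublingWeight ω) (f g : ℂ → ℂ) {z : ℂ} (hz : ‖z‖ < 1) :
    hankelIntegrand ω f g z =ᵐ[areaMeasure] fun ζ =>
      conj (f ζ * conj (g ζ) * conj (kernelSeries (weightMeasure ω) z ζ)) * (ω ζ : ℂ) := by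
  filter_upwards [areaMeasure_ae_mem] with ζ hζ
  rw [hankelIntegrand, h.reproducingKernel_eq hz (mem_unitDisc.1 hζ)]
  simp only [map_mul, Complex.conj_conj]

lemma integrable_conj_iff {m : Measure ℂ} {F : ℂ → ℂ} :
    Integrable (fun z => conj (F z)) m ↔ Integrable F m :=
  LinearIsometryEquiv.integrable_comp_iff Complex.conjLIE

lemma integrable_hankelIntegrand_iff (h : IsDoublingWeight ω) (f g : ℂ → ℂ) {z : ℂ}
    (hz : ‖z‖ < 1) : Integrable (hankelIntegrand ω f g z) areaMeasure ↔
      Integrable (fun ζ => f ζ * conj (g ζ) * conj (kernelSeries (weightMeasure ω) z ζ))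
        (weightMeasure ω) := by
  rw [integrable_congr (h.hankelIntegrand_ae_eq f g hz), ← h.integrable_weightMeasure,
    integrable_conj_iff]

/-- The bridge to the abstract setting: the conjugate of the Hankel image is the projection of
$f\bar g$. It is limited to the disc, where alone the kernel is identified. -/
lemma conj_smallHankel (h : IsDoublingWeight ω) (f g : ℂ → ℂ) {z : ℂ} (hz : ‖z‖ < 1) :
    conj (smallHankel ω f g z) =
      ∫ ζ, f ζ * conj (g ζ) * conj (kernelSeries (weightMeasure ω) z ζ) ∂weightMeasure ω := by
  rw [smallHankel, integral_congr_ae (h.hankelIntegrand_ae_eq f g hz), ← h.integral_weightMeasure,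
    integral_conj, Complex.conj_conj]

lemma bergmanNorm_smallHankel (h : IsDoublingWeight ω) (f g : ℂ → ℂ) (q : ℝ) :
    bergmanNorm ω q (smallHankel ω f g) = eLpNorm' (fun z => ∫ ζ, f ζ * conj (g ζ) *
      conj (kernelSeries (weightMeasure ω) z ζ) ∂weightMeasure ω) q (weightMeasure ω) := by
  rw [h.bergmanNorm_eq]
  refine eLpNorm'_congr_norm_ae (h.isRadialDoubling.ae_norm_lt.mono fun z hz => ?_)
  rw [← h.conj_smallHankel f g hz, RCLike.norm_conj]

lemma integrable_mul_conj_kernelSeries (h : IsDoublingWeight ω) {F : ℂ → ℂ}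
    (hF : Integrable F (weightMeasure ω)) {z : ℂ} (hz : ‖z‖ < 1) :
    Integrable (fun ζ => F ζ * conj (kernelSeries (weightMeasure ω) z ζ)) (weightMeasure ω) := by
  have hm := h.isRadialDoubling
  obtain ⟨B, hB⟩ := hm.exists_norm_kernelSeries_le hz
  refine hF.mul_bdd (c := B) (Complex.continuous_conj.comp_aestronglyMeasurable
    (hm.aestronglyMeasurable (hm.hasSeries_kernelSeries hz).differentiableOn.continuousOn))
    (hm.ae_norm_lt.mono fun ζ hζ => ?_)
  rw [RCLike.norm_conj]
  exact hB ζ hζ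

lemma kernelSeries_zero (m : Measure ℂ) (ζ : ℂ) : kernelSeries m 0 ζ = 1 / moment m 0 := by
  rw [kernelSeries, tsum_eq_single 0]
  · simp
  · intro k hk
    simp [hk]

/-- The kernel at the origin is a nonzero constant, so absolute convergence at that single point is
integrability of $f\bar g$. -/
lemma integrable_mul_conj_of_hankelIntegrand (h : IsDoublingWeight ω) {f g : ℂ → ℂ}
    (hi : Integrable (hankelIntegrand ω f g 0) areaMeasure) :
    Integrable (fun ζ => f ζ * conj (g ζ)) (weightMeasure ω) := by
  rw [h.integrable_hankelIntegrand_iff f g (by simp)] at hi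
  simp only [kernelSeries_zero] at hi
  refine (integrable_mul_const_iff (IsUnit.mk0 _ ?_) _).1 hi
  have := h.isRadialDoubling.moment_ne_zero 0
  simpa using this

/-- The small Hankel operator is bounded if its symbol belongs to the space with exponent `s`. -/
theorem hankelBounded_of_memBergman (h : IsDoublingWeight ω) {p q s : ℝ} (hq : 1 < q)
    (hqp : q < p) (hs : 1 / s = 1 / q - 1 / p) {f : ℂ → ℂ} (hf : MemBergman ω s f) :
    HankelBounded ω f p q := by
  have hm := h.isRadialDoubling
  obtain ⟨C, hC, hfun⟩ := hm.hankel_bounded_of_mem hq hqp hs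
    (hm.aestronglyMeasurable hf.1.continuousOn) (h.memBergman_iff.1 hf).2
  have hfun' : ∀ g, MemBergman ω p g → _ := fun g hg =>
    hfun g (hm.aestronglyMeasurable hg.1.continuousOn) (h.memBergman_iff.1 hg).2
  have hb : ∀ g : ℂ → ℂ, MemBergman ω p g →
      bergmanNorm ω q (smallHankel ω f g) ≤ ENNReal.ofReal C * bergmanNorm ω p g := fun g hg => by
    rw [h.bergmanNorm_smallHankel, h.bergmanNorm_eq p]
    exact (hfun' g hg).2
  refine ⟨fun g hg z hz => ?_, fun g hg => ⟨?_, ?_⟩, C, hC, hb⟩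
  · rw [h.integrable_hankelIntegrand_iff f g (mem_unitDisc.1 hz)]
    exact h.integrable_mul_conj_kernelSeries (hfun' g hg).1 (mem_unitDisc.1 hz)
  · exact (hm.hasSeries_projection (hfun' g hg).1).differentiableOn.congr fun z hz =>
      h.conj_smallHankel f g (mem_unitDisc.1 hz)
  · have e : bergmanNorm ω q (fun z => conj (smallHankel ω f g z)) =
        bergmanNorm ω q (smallHankel ω f g) := by
      rw [h.bergmanNorm_eq, h.bergmanNorm_eq]
      exact eLpNorm'_congr_norm_ae (Filter.Eventually.of_forall fun z => RCLike.norm_conj _)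
    rw [e]
    exact (hb g hg).trans_lt (ENNReal.mul_lt_top ENNReal.ofReal_lt_top hg.2)

/-- The analytic symbol of a bounded small Hankel operator belongs to the space with exponent
`s`. -/
theorem memBergman_of_hankelBounded (h : IsDoublingWeight ω) {p q s : ℝ} (hq : 1 < q)
    (hqp : q < p) (hs : 1 / s = 1 / q - 1 / p) {f : ℂ → ℂ} (hf : DifferentiableOn ℂ f unitDisc)
    (hb : HankelBounded ω f p q) : MemBergman ω s f := by
  have hm := h.isRadialDoubling
  obtain ⟨C, hC, hCb⟩ := hb.bound
  -- Necessity tests the operator on polynomials only.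
  have hpoly : ∀ a : Polynomial ℂ, MemBergman ω p fun z => a.eval z := fun a =>
    h.memBergman_iff.2 ⟨a.differentiable.differentiableOn,
      hm.eLpNorm'_eval_lt_top (by linarith) a⟩
  refine h.memBergman_iff.2 ⟨hf, hm.mem_of_hankel_bounded hq hqp hs hf hC (fun a => ?_) fun a => ?_⟩
  · exact h.integrable_mul_conj_of_hankelIntegrand
      (hb.integrable _ (hpoly a) 0 (mem_unitDisc.2 (by simp)))
  · have h1 := hCb _ (hpoly a)
    rwa [h.bergmanNorm_smallHankel, h.bergmanNorm_eq] at h1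

end IsDoublingWeight

end

end Bergman

end

theorem mainTheorem5 (p q s : ℝ) (hq : 1 < q) (hqp : q < p) (hs : 1 / s = 1 / q - 1 / p)
    (ω : ℂ → ℝ) (hω : Bergman.IsDoublingWeight ω)
    (f : ℂ → ℂ) (hf : DifferentiableOn ℂ f Bergman.unitDisc) :
    Bergman.HankelBounded ω f p q ↔ Bergman.MemBergman ω s f :=
  ⟨hω.memBergman_of_hankelBounded hq hqp hs hf, hω.hankelBounded_of_memBergman hq hqp hs⟩
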